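/- Let $p\ge 1$, $q\ge 0$, $k\ge 2$ with $k\ge p+1$, and let $D\subset\mathbb R^p$ be compact and convex. For constants $M_0,L_0$ let $\mathcal F$ be the set of probability densities $f$ on $\mathbb R^p$ with $\{f\neq 0\}=D$, with $1/M_0\le f\le M_0$ on $D$, and which are $k$ times continuously differentiable on $D$ with derivatives of orders $1,\dots,k$ bounded by $L_0$. Let $\mathcal G$ be a class of univariate densities $g$, each supported on a compact interval, such that all supports lie in one bounded set, $g$ and $1/g$ are bounded on the support of $g$ uniformly in $g\in\mathcal G$, and $g$ is $k$ times continuously differentiable on its support with derivatives bounded uniformly in $g$. Let $\Theta$ be the unit sphere of $\mathbb R^p$ with surface measure, let $I_\theta\subset\mathbb R$ for $\theta\in\Theta$, let $\Lambda_\Theta$ be the set of measurable square integrable maps $\lambda$ with $\lambda(\theta)\in\mathcal G$ supported on $I_\theta$ for all $\theta$, and let $\Gamma_\Theta$ be the corresponding set of maps $\gamma$ for which $\gamma(\theta)$ is the quantile function of a density in $\mathcal G$ supported on $I_\theta$; $\varrho$ replaces quantile functions by the corresponding densities. Put $d_2(\lambda_1,\lambda_2)^2=\int_\Theta\int_{\mathbb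 R}(\lambda_1-\lambda_2)^2\,du\,d\theta$ and $d_{DW}(\gamma_1,\gamma_2)^2=\int_\Theta\int_0^1(\gamma_1-\gamma_2)^2\,ds\,d\theta$, identify maps that agree almost everywhere, and assume that $\Gamma_\Theta$ is convex and closed for $d_{DW}$. Let $d_\infty$ be the sup-norm distance on $D$. Let $\psi:\mathcal F\to\Lambda_\Theta$ be a slicing transform: $\psi$ is injective with an inverse $\psi^{-1}$ on its image; $\|\psi(f_1)(\theta)-\psi(f_2)(\theta)\|_{L^2}\le C_0\|f_1-f_2\|_{L^2}$ for all $\theta$; and there are maps $\psi_\tau^{-1}:\Lambda_\Theta\to\mathcal F$, $\tau>0$, with $d_\infty(\psi_\tau^{-1}\psi(f),f)\le C_1(\tau)$ for all $f\in\mathcal F$, and $d_\infty(\psi_\tau^{-1}\psi(f),\psi_\tau^{-1}(\lambda))\le C_2(\tau)\,d_2(\psi(f),\lambda)$ for all $f\in\mathcal F$, $\lambda\in\Lambda_\Theta$ with $d_2(\psi(f),\lambda)<\delta(\tau)$, where $\delta(\tau)>0$, $C_1$ decreases to $0$ and $C_2\ge0$ is increasing as $\tau\to\infty$. Let $\widetilde\psi(f)(\theta)$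 be the quantile function of $\psi(f)(\theta)$. Let $(X_i,f_i)$, $i\ge1$, be i.i.d. with values in $\mathbb R^q\times\mathcal F$, $E\|X_1\|^4<\infty$ and $\mathrm{Var}(X_1)$ positive definite. Put $s_G(X,x)=1+(X-EX)^T\mathrm{Var}(X)^{-1}(x-EX)$ and $s_{iG}(x)=1+(X_i-\bar X)^T\hat\Sigma^{-1}(x-\bar X)$, with the sample mean $\bar X$ and sample covariance $\hat\Sigma$ of $X_1,\dots,X_n$ (the inverse is read as $0$ if $\hat\Sigma$ is singular). Let $M_G(\gamma,x)=E[s_G(X_1,x)\,d_{DW}^2(\widetilde\psi(f_1),\gamma)]$ and $\check M_G(\gamma,x)=n^{-1}\sum_{i=1}^n s_{iG}(x)\,d_{DW}^2(\widetilde\psi(f_i),\gamma)$. Then $M_G(\cdot,x)$ and, for $n\ge1$, $\check M_G(\cdot,x)$ have minimizers over $\Gamma_\Theta$, unique up to null sets. If the minimizer of $M_G(\cdot,x)$ lies in $\widetilde\psi(\mathcal F)$, let $m_G(x)\in\mathcal F$ be the unique density that $\widetilde\psi$ maps to it (up to a null set), and let $\check m_{G,\tau}(x)=\psi_\tau^{-1}\varrho(\operatorname{argmin}_{\Gamma_\Theta}\check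 M_G(\cdot,x))$, for any version of the minimizer. (1) If the minimizer of $M_G(\cdot,x)$ lies in $\widetilde\psi(\mathcal F)$ for a fixed $x\in\mathbb R^q$, then for every deterministic sequence $\tau=\tau_n>0$ with $n^{-2/7}=o(\delta(\tau_n))$ (every sequence, if $\delta$ is constant), as $n\to\infty$, $$d_\infty(m_G(x),\check m_{G,\tau}(x))=O_p\big(C_1(\tau)+C_2(\tau)n^{-2/7}\big).$$ (2) If this holds for all $\|x\|\le B$, where $B>0$, then for every $\varepsilon>0$ and every deterministic sequence $\tau=\tau_n>0$ with $n^{-2/(7+\varepsilon)}=o(\delta(\tau_n))$, $$\sup_{\|x\|\le B}d_\infty(m_G(x),\check m_{G,\tau}(x))=O_p\big(C_1(\tau)+C_2(\tau)n^{-2/(7+\varepsilon)}\big).$$ (3) The same existence and uniqueness and the same rates (1), (2) hold when the $f_i$ in $\check M_G$ are replaced by density estimates $\tilde f_i$ as follows. There are $\epsilon_0>0$ and constants such that $f_i$ is the truncation to $D$ of a random distribution $\nu_i$ on $\mathbb R^p$, whose density is, on the $\epsilon_0$-neighborhood of $D$, bounded above and away from zero and $k$ times continuously differentiable with bounded derivatives,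 uniformly in $i$ and in the outcome. Given all $(X_l,\nu_l)$, the observations $Z_{ij}$ are independent with $Z_{ij}\sim\nu_i$. The kernel $\kappa$ is a symmetric, bounded, $k$ times continuously differentiable probability density with compact support, $\check f_i(z)=(N_ib_i^p)^{-1}\sum_{j\le N_i}\kappa((z-Z_{ij})/b_i)$ and $\hat f_i=\check f_i1_D/\int_D\check f_i$, where $\min_{i\le n}N_i\ge c\,n^{(p+4)/4}$ and $c_1N_i^{-1/(p+4)}\le b_i\le c_2N_i^{-1/(p+4)}$ for all $i\le n$ and all large $n$, with constants $c,c_1>0$ and $c_2$. Finally $\tilde f_i\in\mathcal F$ is a version of $\hat f_i$ in the domain of $\psi$: $\|\tilde f_i-\hat f_i\|_{L^2}\le2\|f-\hat f_i\|_{L^2}$ for all $f\in\mathcal F$, so that $\tilde f_i=\hat f_i$ whenever $\hat f_i\in\mathcal F$. -/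

import Mathlib

open MeasureTheory ProbabilityTheory Filter Topology Set
open scoped ENNReal NNReal Matrix

noncomputable section

namespace GSWW

/-- `ℝ^p` with the Euclidean norm. -/
abbrev Euc (p : ℕ) := EuclideanSpace ℝ (Fin p)

/-- The slicing parameter set `Θ`: the unit sphere of `ℝ^p`. -/
abbrev Sph (p : ℕ) := Metric.sphere (0 : Euc p) 1

/-- The surface measure on the unit sphere (counting measure when `p = 1`). -/
def surf (p : ℕ) : Measure (Sph p) := (volume : Measure (Euc p)).toSphere

/-! ### Spaces of densities, slices and quantile functions -/

/-- The class `𝓕` of `p`-variate densities with support `D`, bounded above by `M₀` and below by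
`1 / M₀` on `D`, and `k` times continuously differentiable on `D` with derivatives bounded
by `L₀`. -/
def densityClass {p : ℕ} (D : Set (Euc p)) (k : ℕ) (M₀ L₀ : ℝ) : Set (Euc p → ℝ) :=
  {f | (∀ z, 0 ≤ f z) ∧ Integrable f ∧ ∫ z, f z = 1 ∧ Function.support f = D ∧
    (∀ z ∈ D, f z ≤ M₀ ∧ 1 / f z ≤ M₀) ∧
    ContDiffOn ℝ k f D ∧
    ∀ j, 1 ≤ j → j ≤ k → ∀ z ∈ D, ‖iteratedFDerivWithin ℝ j f D z‖ ≤ L₀}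

/-- The conditions on the class `𝒢` of univariate densities: supports are compact intervals
inside one bounded set, the densities are uniformly bounded above and away from zero on their
supports, and they are `k` times continuously differentiable there with uniformly bounded
derivatives. -/
def IsUnivariateClass (k : ℕ) (𝒢 : Set (ℝ → ℝ)) : Prop :=
  ∃ R M₁ L₁ : ℝ, ∀ g ∈ 𝒢,
    (∀ u, 0 ≤ g u) ∧ Integrable g ∧ ∫ u, g u = 1 ∧
    ∃ a b : ℝ, a < b ∧ Function.support g = Icc a b ∧ Icc a b ⊆ Icc (-R) R ∧
      (∀ u ∈ Icc a b, g u ≤ M₁ ∧ 1 / g u ≤ M₁) ∧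
      ContDiffOn ℝ k g (Icc a b) ∧
      ∀ j, 1 ≤ j → j ≤ k → ∀ u ∈ Icc a b, |iteratedDerivWithin j g (Icc a b) u| ≤ L₁

/-- The density slicing space `Λ_Θ`: square integrable maps `Θ → 𝒢`, whose value at `θ` has
support `I θ`. -/
def densitySlices {p : ℕ} (𝒢 : Set (ℝ → ℝ)) (I : Sph p → Set ℝ) : Set (Sph p → ℝ → ℝ) :=
  {l | (∀ θ, l θ ∈ 𝒢 ∧ Function.support (l θ) = I θ) ∧
    Measurable (Function.uncurry l) ∧
    MemLp (Function.uncurry l) 2 ((surf p).prod volume)}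

/-- The quantile function `s ↦ inf {u | F(u) ≥ s}` of the distribution with density `g`
(used for `0 < s ≤ 1`). -/
def quantile (g : ℝ → ℝ) (s : ℝ) : ℝ := sInf {u | s ≤ ∫ t in Iic u, g t}

/-- The quantile slicing space `Γ_Θ`: square integrable maps from `Θ` to quantile functions of
densities in `𝒢`, where the density at `θ` has support `I θ`. -/
def quantileSlices {p : ℕ} (𝒢 : Set (ℝ → ℝ)) (I : Sph p → Set ℝ) : Set (Sph p → ℝ → ℝ) :=
  {γ | (∀ θ, ∃ g ∈ 𝒢, Function.support g = I θ ∧ γ θ = quantile g) ∧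
    Measurable (Function.uncurry γ) ∧
    MemLp (Function.uncurry γ) 2 ((surf p).prod (volume.restrict (Icc (0 : ℝ) 1)))}

/-- `ϱ⁻¹ : Λ_Θ → Γ_Θ`, replacing each density by its quantile function. -/
def toQuantiles {p : ℕ} (l : Sph p → ℝ → ℝ) : Sph p → ℝ → ℝ := fun θ => quantile (l θ)

/-- `ϱ : Γ_Θ → Λ_Θ`, replacing each quantile function by the density in `𝒢` it belongs to. -/
def toDensities {p : ℕ} (𝒢 : Set (ℝ → ℝ)) (γ : Sph p → ℝ → ℝ) : Sph p → ℝ → ℝ :=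
  fun θ => Function.invFunOn quantile 𝒢 (γ θ)

/-! ### Distances -/

/-- Sup-norm distance on `D`. -/
def supDist {p : ℕ} (D : Set (Euc p)) (f g : Euc p → ℝ) : ℝ≥0∞ := ⨆ z ∈ D, ‖f z - g z‖ₑ

/-- `L²` distance of functions on `ℝ^p`. -/
def l2Dist {p : ℕ} (f g : Euc p → ℝ) : ℝ≥0∞ := eLpNorm (fun z => f z - g z) 2 volume

/-- `L²` distance of density slices, `(∫_Θ ∫_ℝ (l₁ - l₂)² du dθ)^{1/2}`. -/
def sliceDist {p : ℕ} (l₁ l₂ : Sph p → ℝ → ℝ) : ℝ≥0∞ :=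
  eLpNorm (fun z : Sph p × ℝ => l₁ z.1 z.2 - l₂ z.1 z.2) 2 ((surf p).prod volume)

/-- The distribution-slicing Wasserstein distance,
`(∫_Θ ∫_0^1 (γ₁ - γ₂)² ds dθ)^{1/2}`. -/
def wassDist {p : ℕ} (γ₁ γ₂ : Sph p → ℝ → ℝ) : ℝ≥0∞ :=
  eLpNorm (fun z : Sph p × ℝ => γ₁ z.1 z.2 - γ₂ z.1 z.2) 2
    ((surf p).prod (volume.restrict (Icc (0 : ℝ) 1)))

/-- Sequential closedness of a set of quantile slices for `wassDist`, where maps that agree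
almost everywhere are identified. -/
def IsClosedSlices {p : ℕ} (S : Set (Sph p → ℝ → ℝ)) : Prop :=
  ∀ (γ : ℕ → Sph p → ℝ → ℝ) (γ' : Sph p → ℝ → ℝ), (∀ n, γ n ∈ S) →
    Measurable (Function.uncurry γ') → Tendsto (fun n => wassDist (γ n) γ') atTop (𝓝 0) →
    ∃ γ'' ∈ S, wassDist γ'' γ' = 0

/-! ### Slicing transforms -/

/-- `ψ` is a valid slicing transform from `F = 𝓕` to the density slicing space, with
approximating inverses `ψinv τ`, `τ > 0`. The stability bound `stable` holds as
`sliceDist (ψ f) l → 0`, that is, below a positive threshold `δ τ`. -/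
structure IsSlicingTransform {p : ℕ} (D : Set (Euc p)) (F : Set (Euc p → ℝ))
    (𝒢 : Set (ℝ → ℝ)) (I : Sph p → Set ℝ) (ψ : (Euc p → ℝ) → Sph p → ℝ → ℝ)
    (ψinv : ℝ → (Sph p → ℝ → ℝ) → Euc p → ℝ) (C₁ C₂ δ : ℝ → ℝ) : Prop where
  /-- `ψ` is injective, where slices that agree almost everywhere are identified. -/
  injective : ∀ f₁ ∈ F, ∀ f₂ ∈ F, sliceDist (ψ f₁) (ψ f₂) = 0 → f₁ = f₂
  /-- `ψ` is Lipschitz on every slice, uniformly in the slice. -/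
  lipschitz : ∃ C₀ : ℝ≥0, ∀ f₁ ∈ F, ∀ f₂ ∈ F, ∀ θ,
    eLpNorm (fun u => ψ f₁ θ u - ψ f₂ θ u) 2 volume ≤ C₀ * l2Dist f₁ f₂
  /-- There is an inverse on the image. -/
  exists_inverse : ∃ φ : (Sph p → ℝ → ℝ) → Euc p → ℝ, ∀ f ∈ F, φ (ψ f) = f
  /-- The image is contained in the density slicing space. -/
  maps_to : ∀ f ∈ F, ψ f ∈ densitySlices 𝒢 I
  inv_maps_to : ∀ τ, 0 < τ → ∀ l ∈ densitySlices 𝒢 I, ψinv τ l ∈ F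
  bias : ∀ τ, 0 < τ → ∀ f ∈ F, supDist D (ψinv τ (ψ f)) f ≤ ENNReal.ofReal (C₁ τ)
  stable : ∀ τ, 0 < τ → ∀ f ∈ F, ∀ l ∈ densitySlices 𝒢 I,
    sliceDist (ψ f) l < ENNReal.ofReal (δ τ) →
    supDist D (ψinv τ (ψ f)) (ψinv τ l) ≤ ENNReal.ofReal (C₂ τ) * sliceDist (ψ f) l
  threshold_pos : ∀ τ, 0 < τ → 0 < δ τ
  bias_antitone : AntitoneOn C₁ (Ioi 0)
  bias_tendsto : Tendsto C₁ atTop (𝓝 0)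
  stable_nonneg : ∀ τ, 0 < τ → 0 ≤ C₂ τ
  stable_monotone : MonotoneOn C₂ (Ioi 0)

/-! ### Global Fréchet regression over the quantile slicing space -/

/-- The weight `1 + (y - m)ᵀ S⁻¹ (x - m)` of global Fréchet regression. -/
def weight {q : ℕ} (m : Euc q) (S : Matrix (Fin q) (Fin q) ℝ) (y x : Euc q) : ℝ :=
  1 + (fun a => y a - m a) ⬝ᵥ (S⁻¹ *ᵥ fun a => x a - m a)

section Population

variable {Ω : Type*} [MeasurableSpace Ω]

/-- The covariance matrix of the random vector `X`. -/
def popCov {q : ℕ} (P : Measure Ω) (X : Ω → Euc q) : Matrix (Fin q) (Fin q) ℝ :=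
  Matrix.of fun a b => ∫ ω, (X ω a - (∫ ω', X ω' ∂P) a) * (X ω b - (∫ ω', X ω' ∂P) b) ∂P

/-- The population objective `γ ↦ E[s_G(X, x) d_DW²(ψ̃(μ), γ)]`; `f` is the random density
of `μ`. -/
def popObjective {p q : ℕ} (P : Measure Ω) (ψ : (Euc p → ℝ) → Sph p → ℝ → ℝ)
    (X : Ω → Euc q) (f : Ω → Euc p → ℝ) (x : Euc q) (γ : Sph p → ℝ → ℝ) : ℝ :=
  ∫ ω, weight (∫ ω', X ω' ∂P) (popCov P X) (X ω) x *
    (wassDist (toQuantiles (ψ (f ω))) γ).toReal ^ 2 ∂P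

/-- `Y n = O_p(r n)`; `P` is read as outer probability on events that need not be measurable. -/
def IsBigOp (P : Measure Ω) (Y : ℕ → Ω → ℝ≥0∞) (r : ℕ → ℝ) : Prop :=
  ∀ η : ℝ, 0 < η → ∃ M : ℝ, 0 < M ∧
    ∀ᶠ n in atTop, P {ω | ENNReal.ofReal (M * r n) < Y n ω} ≤ ENNReal.ofReal η

end Population

/-- The sample mean of the first `n` observations. -/
def sampleMean {q : ℕ} (n : ℕ) (X : ℕ → Euc q) : Euc q :=
  (n : ℝ)⁻¹ • ∑ i ∈ Finset.range n, X i

/-- The sample covariance matrix of the first `n` observations. -/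
def sampleCov {q : ℕ} (n : ℕ) (X : ℕ → Euc q) : Matrix (Fin q) (Fin q) ℝ :=
  Matrix.of fun a b => (n : ℝ)⁻¹ *
    ∑ i ∈ Finset.range n, (X i a - sampleMean n X a) * (X i b - sampleMean n X b)

/-- The sample objective `γ ↦ n⁻¹ ∑ s_{iG}(x) d_DW²(ψ̃(μ_i), γ)`. -/
def sampleObjective {p q : ℕ} (ψ : (Euc p → ℝ) → Sph p → ℝ → ℝ) (n : ℕ)
    (X : ℕ → Euc q) (f : ℕ → Euc p → ℝ) (x : Euc q) (γ : Sph p → ℝ → ℝ) : ℝ :=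
  (n : ℝ)⁻¹ * ∑ i ∈ Finset.range n,
    weight (sampleMean n X) (sampleCov n X) (X i) x *
      (wassDist (toQuantiles (ψ (f i))) γ).toReal ^ 2

/-- `γ` minimizes `M` over `S`. -/
def IsArgmin {p : ℕ} (S : Set (Sph p → ℝ → ℝ)) (M : (Sph p → ℝ → ℝ) → ℝ)
    (γ : Sph p → ℝ → ℝ) : Prop :=
  γ ∈ S ∧ IsMinOn M S γ

/-- `M` has a minimizer over `S`, which is unique up to sets of measure zero. -/
def HasUniqueArgmin {p : ℕ} (S : Set (Sph p → ℝ → ℝ)) (M : (Sph p → ℝ → ℝ) → ℝ) : Prop :=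
  (∃ γ, IsArgmin S M γ) ∧ ∀ γ γ', IsArgmin S M γ → IsArgmin S M γ' → wassDist γ γ' = 0

/-- `m` is the image under the inverse transform of the minimizer of the objective `M`: it is
the density in `F` whose quantile slices minimize `M` over `S`. Such an `m` exists
if and only if the minimizer belongs to the image of the transform. -/
def IsTarget {p : ℕ} (F : Set (Euc p → ℝ)) (ψ : (Euc p → ℝ) → Sph p → ℝ → ℝ)
    (S : Set (Sph p → ℝ → ℝ)) (M : (Sph p → ℝ → ℝ) → ℝ) (m : Euc p → ℝ) : Prop :=
  m ∈ F ∧ IsArgmin S M (toQuantiles (ψ m))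

/-! ### Density estimation -/

/-- The kernel estimator `(N b^p)⁻¹ ∑ κ((z - Z_j) / b)`. -/
def kernelEstimate {p : ℕ} (κ : Euc p → ℝ) (b : ℝ) (N : ℕ) (Z : ℕ → Euc p) (z : Euc p) : ℝ :=
  ((N : ℝ) * b ^ p)⁻¹ * ∑ j ∈ Finset.range N, κ (b⁻¹ • (z - Z j))

/-- The kernel estimator truncated to `D` and normalized. -/
def truncatedKernelEstimate {p : ℕ} (D : Set (Euc p)) (κ : Euc p → ℝ) (b : ℝ) (N : ℕ)
    (Z : ℕ → Euc p) : Euc p → ℝ :=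
  D.indicator fun z => kernelEstimate κ b N Z z / ∫ u in D, kernelEstimate κ b N Z u

/-- The conditions on the kernel. -/
structure IsKernel {p : ℕ} (k : ℕ) (κ : Euc p → ℝ) : Prop where
  nonneg : ∀ z, 0 ≤ κ z
  integral_eq_one : ∫ z, κ z = 1
  compactSupport : HasCompactSupport κ
  symmetric : ∀ z, κ (-z) = κ z
  bounded : ∃ K : ℝ, ∀ z, κ z ≤ K
  contDiff : ContDiff ℝ k κ

/-- The `i`-th response, with density `f` on `D`, is the truncation to `D` of the original
distribution `ν`. The latter has a density, which on the `ε`-neighborhood of `D` is bounded above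
and below and `k` times continuously differentiable with bounded derivatives. -/
def IsTruncation {p : ℕ} (D : Set (Euc p)) (k : ℕ) (ε M L : ℝ) (ν : Measure (Euc p))
    (f : Euc p → ℝ) : Prop :=
  IsProbabilityMeasure ν ∧ ∃ h : Euc p → ℝ, Measurable h ∧ (∀ z, 0 ≤ h z) ∧
    ν = volume.withDensity (fun z => ENNReal.ofReal (h z)) ∧
    (∀ z ∈ Metric.thickening ε D, h z ≤ M ∧ 1 / M ≤ h z) ∧
    ContDiffOn ℝ k h (Metric.thickening ε D) ∧
    (∀ j, 1 ≤ j → j ≤ k → ∀ z ∈ Metric.thickening ε D,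
      ‖iteratedFDerivWithin ℝ j h (Metric.thickening ε D) z‖ ≤ L) ∧
    ∀ z ∈ D, f z = h z / ∫ u in D, h u

/-- The random mechanism behind the density estimates. Given all pairs `(X l, ν l)`, the
observations `Z i j` are independent and `Z i j` has distribution `ν i`; the `i`-th density is
estimated from `Z i 0, …, Z i (N n i - 1)` with bandwidth `b n i` when the sample size is `n`. -/
structure IsDensitySampling {p q : ℕ} {Ω : Type*} [MeasurableSpace Ω] (P : Measure Ω)
    (D : Set (Euc p)) (k : ℕ) (X : ℕ → Ω → Euc q) (f : ℕ → Ω → Euc p → ℝ)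
    (ν : ℕ → Ω → Measure (Euc p)) (Z : ℕ → ℕ → Ω → Euc p)
    (N : ℕ → ℕ → ℕ) (b : ℕ → ℕ → ℝ) : Prop where
  truncation : ∃ ε M L : ℝ, 0 < ε ∧ 0 < M ∧ ∀ i ω, IsTruncation D k ε M L (ν i ω) (f i ω)
  measurable_parent : ∀ i, Measurable (ν i)
  measurable_obs : ∀ i j, Measurable (Z i j)
  conditional_law : ∀ (J : Finset (ℕ × ℕ)) (A : ℕ × ℕ → Set (Euc p)) (C : Set Ω),
    (∀ c, MeasurableSet (A c)) →
    MeasurableSet[⨆ l, MeasurableSpace.comap (fun ω => (X l ω, ν l ω)) inferInstance] C →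
    P (C ∩ ⋂ c ∈ J, Z c.1 c.2 ⁻¹' A c) = ∫⁻ ω in C, ∏ c ∈ J, ν c.1 ω (A c) ∂P
  sample_sizes : ∃ c : ℝ, 0 < c ∧ ∀ᶠ n : ℕ in atTop, ∀ i < n,
    c * (n : ℝ) ^ (((p : ℝ) + 4) / 4) ≤ (N n i : ℝ)
  bandwidths : ∃ c₁ c₂ : ℝ, 0 < c₁ ∧ ∀ᶠ n : ℕ in atTop, ∀ i < n,
    c₁ * (N n i : ℝ) ^ (-(1 / ((p : ℝ) + 4))) ≤ b n i ∧
    b n i ≤ c₂ * (N n i : ℝ) ^ (-(1 / ((p : ℝ) + 4)))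

/-- `f'` is a version of the density estimate `g` in the domain `F` of the slicing transform: an
`L²` projection of `g` to `F` up to the factor two. In particular `f'` coincides with `g` almost
everywhere if `g ∈ F`. -/
def IsProjectionTo {p : ℕ} (F : Set (Euc p → ℝ)) (g f' : Euc p → ℝ) : Prop :=
  f' ∈ F ∧ ∀ f ∈ F, l2Dist f' g ≤ 2 * l2Dist f g

/-- The rates claimed for estimators `est n τ x ω` of targets: `isTarget x m` says that `m` is the
target at `x`. For a fixed `x` the rate is `C₁(τ) + C₂(τ) n^{-2/7}`, and uniformly over
`‖x‖ ≤ B` it is `C₁(τ) + C₂(τ) n^{-2/(7+ε)}`. Here `τ = τ n` is any deterministic sequence along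
which the respective power of `n` becomes negligible against the threshold `δ (τ n)`. -/
def HasRates {p q : ℕ} {Ω : Type*} [MeasurableSpace Ω] (P : Measure Ω) (D : Set (Euc p))
    (C₁ C₂ δ : ℝ → ℝ) (isTarget : Euc q → (Euc p → ℝ) → Prop)
    (est : ℕ → ℝ → Euc q → Ω → Euc p → ℝ) : Prop :=
  (∀ (x : Euc q) (m : Euc p → ℝ), isTarget x m →
    ∀ τ : ℕ → ℝ, (∀ n, 0 < τ n) →
      (fun n : ℕ => (n : ℝ) ^ (-(2 / 7) : ℝ)) =o[atTop] (fun n => δ (τ n)) →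
      IsBigOp P (fun n ω => supDist D m (est n (τ n) x ω))
        (fun n => C₁ (τ n) + C₂ (τ n) * (n : ℝ) ^ (-(2 / 7) : ℝ))) ∧
  (∀ (B ε : ℝ) (m : Euc q → Euc p → ℝ), 0 < B → 0 < ε → (∀ x, ‖x‖ ≤ B → isTarget x (m x)) →
    ∀ τ : ℕ → ℝ, (∀ n, 0 < τ n) →
      (fun n : ℕ => (n : ℝ) ^ (-(2 / (7 + ε)))) =o[atTop] (fun n => δ (τ n)) →
      IsBigOp P (fun n ω => ⨆ (x : Euc q) (_ : ‖x‖ ≤ B), supDist D (m x) (est n (τ n) x ω))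
        (fun n => C₁ (τ n) + C₂ (τ n) * (n : ℝ) ^ (-(2 / (7 + ε)))))

end GSWW

end

/-!
Why the rates hold. The quantile slices form a closed convex subset of the Hilbert space
`L²(Θ × [0, 1])`, and the Wasserstein distance is the distance of this space. The weights of global
Fréchet regression have mean one, so that both objectives are, up to additive constants, squared
distances to weighted means of the responses (`sampleObjective_eq`, `popObjective_eq`). Their
minimizers are therefore the metric projections of these weighted means: they exist, are unique
(`hasUniqueArgmin`), and depend on the weighted mean in a nonexpansive way (`IsArgmin.wassDist_le`).
The weighted means are affine in `x`, and their coefficients are smooth functions of averages of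
independent square integrable elements of the Hilbert space, so the Wasserstein error of the sample
minimizer is `O_p(n^{-1/2})`, uniformly over bounded sets of `x` (`exists_regression_rate`).

The exponent `2/7 = 1/2 · 4/7` stems from an interpolation inequality. For two densities with common
support `[a, b]`, the difference `E` of the distribution functions vanishes at both endpoints, and
its derivative `h` has two bounded derivatives. Integration by parts gives
`‖h‖₂⁴ ≤ ‖h'‖₂² ‖E‖₂²` and `‖h'‖₂² ≲ ‖h‖_∞`, while `‖h‖_∞⁴ ≲ ‖h‖₂²`; hence
`‖h‖₂ ≲ ‖E‖₂^{4/7}` (`exists_interpolation_const`). As `‖E‖₂` is at most a multiple of the `L²`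
distance of the quantile functions, the density slices have an error of order `n^{-2/7}`
(`exists_sliceDist_le`). The bias and stability bounds of the approximating inverse turn it into
the error `C₁ τ + C₂ τ n^{-2/7}` of the densities (`hasRates_of_wassDist_le`); the condition on the
threshold makes the stability bound applicable with probability tending to one. The uniform rate
is no harder, because the Wasserstein error is already uniform.

For estimated densities, the slices are Lipschitz in the densities for the `L²` distance
(`exists_wassDist_le`). It suffices that the mean squared `L²` error of the estimated densities is
`O_p(n⁻¹)` (`hasRates_of_surrogates`), for by the Cauchy–Schwarz inequality the weighted mean then
moves by `O_p(n^{-1/2})`. Truncation, normalization and projection cost a constant factor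
(`exists_sq_l2Dist_projection_le`). The squared bias of the kernel estimator is of order `b⁴`
(`abs_kernelMean_sub_le`), and its variance is of order `(N b^p)⁻¹`, by conditional independence of
the observations (`lintegral_sq_average_sub_le`). Both are `O(n⁻¹)` for the given bandwidths and
sample sizes (`IsDensitySampling.exists_bandwidth_bound`).
-/

noncomputable section

namespace GSWW

/-! ### Interpolation inequalities on an interval -/

theorem sq_integral_mul_le {α : Type*} [MeasurableSpace α] {μ : Measure α} {f g : α → ℝ}
    (hf : Integrable (fun x => f x ^ 2) μ) (hg : Integrable (fun x => g x ^ 2) μ)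
    (hfg : Integrable (fun x => f x * g x) μ) :
    (∫ x, f x * g x ∂μ) ^ 2 ≤ (∫ x, f x ^ 2 ∂μ) * ∫ x, g x ^ 2 ∂μ := by
  have key : ∀ t : ℝ, 0 ≤ (∫ x, f x ^ 2 ∂μ) * (t * t) + (2 * ∫ x, f x * g x ∂μ) * t
      + ∫ x, g x ^ 2 ∂μ := by
    intro t
    have h : ∫ x, (t * f x + g x) ^ 2 ∂μ = (∫ x, f x ^ 2 ∂μ) * (t * t)
        + (2 * ∫ x, f x * g x ∂μ) * t + ∫ x, g x ^ 2 ∂μ := by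
      have : ∀ x, (t * f x + g x) ^ 2 = (t * t) * f x ^ 2 + (2 * t) * (f x * g x) + g x ^ 2 :=
        fun x => by ring
      simp_rw [this]
      rw [integral_add (f := fun x => t * t * f x ^ 2 + 2 * t * (f x * g x))
          ((hf.const_mul _).add (hfg.const_mul _)) hg,
        integral_add (hf.const_mul _) (hfg.const_mul _), integral_const_mul, integral_const_mul]
      ring
    rw [← h]
    exact integral_nonneg fun x => sq_nonneg _
  have := discrim_le_zero key
  unfold discrim at this
  nlinarith

section Interpolation

variable {a b L : ℝ} {E h h1 h2 : ℝ → ℝ}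

theorem ContinuousOn.intervalIntegrable_Icc {f : ℝ → ℝ} (hab : a ≤ b)
    (hf : ContinuousOn f (Icc a b)) : IntervalIntegrable f volume a b :=
  ContinuousOn.intervalIntegrable (by rwa [uIcc_of_le hab])

theorem sq_intervalIntegral_mul_le (hab : a ≤ b) {f g : ℝ → ℝ}
    (hf : ContinuousOn f (Icc a b)) (hg : ContinuousOn g (Icc a b)) :
    (∫ x in a..b, f x * g x) ^ 2 ≤ (∫ x in a..b, f x ^ 2) * ∫ x in a..b, g x ^ 2 := by
  simp only [intervalIntegral.integral_of_le hab]
  apply sq_integral_mul_le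
  · exact (ContinuousOn.intervalIntegrable_Icc hab (hf.pow 2)).1
  · exact (ContinuousOn.intervalIntegrable_Icc hab (hg.pow 2)).1
  · exact (ContinuousOn.intervalIntegrable_Icc hab (hf.mul hg)).1

/-- Integration by parts: `‖h‖₂⁴ ≤ ‖h'‖₂² ‖E‖₂²` if `E` is a primitive of `h` that vanishes at both
endpoints. -/
theorem sq_integral_sq_le_of_primitive (hab : a ≤ b) (hE : ContinuousOn E (Icc a b))
    (hh : ContinuousOn h (Icc a b)) (hh1 : ContinuousOn h1 (Icc a b))
    (dE : ∀ x ∈ Ioo a b, HasDerivAt E (h x) x) (dh : ∀ x ∈ Ioo a b, HasDerivAt h (h1 x) x)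
    (hEa : E a = 0) (hEb : E b = 0) :
    (∫ x in a..b, h x ^ 2) ^ 2 ≤ (∫ x in a..b, h1 x ^ 2) * ∫ x in a..b, E x ^ 2 := by
  have := intervalIntegral.integral_mul_deriv_eq_deriv_mul_of_hasDerivAt
    (a := a) (b := b) (u := h) (v := E) (u' := h1) (v' := h)
    (by rwa [uIcc_of_le hab]) (by rwa [uIcc_of_le hab])
    (by rw [min_eq_left hab, max_eq_right hab]; exact dh)
    (by rw [min_eq_left hab, max_eq_right hab]; exact dE)
    (ContinuousOn.intervalIntegrable_Icc hab hh1) (ContinuousOn.intervalIntegrable_Icc hab hh)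
  rw [hEa, hEb] at this
  simp only [← pow_two, mul_zero, sub_zero, zero_sub] at this
  rw [this, neg_sq]
  exact sq_intervalIntegral_mul_le hab hh1 hE

/-- Integration by parts: `‖h'‖₂²` is at most a multiple of `‖h‖_∞`. The summand `2 L` of the
constant bounds the boundary terms. -/
theorem integral_sq_deriv_le (hab : a ≤ b) (hh : ContinuousOn h (Icc a b))
    (hh1 : ContinuousOn h1 (Icc a b)) (hh2 : ContinuousOn h2 (Icc a b))
    (dh : ∀ x ∈ Ioo a b, HasDerivAt h (h1 x) x) (dh1 : ∀ x ∈ Ioo a b, HasDerivAt h1 (h2 x) x)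
    (bh1 : ∀ x ∈ Icc a b, |h1 x| ≤ L) (bh2 : ∀ x ∈ Icc a b, |h2 x| ≤ L)
    {S : ℝ} (hS : ∀ x ∈ Icc a b, |h x| ≤ S) :
    ∫ x in a..b, h1 x ^ 2 ≤ (2 * L + L * (b - a)) * S := by
  have := intervalIntegral.integral_mul_deriv_eq_deriv_mul_of_hasDerivAt
    (a := a) (b := b) (u := h1) (v := h) (u' := h2) (v' := h1)
    (by rwa [uIcc_of_le hab]) (by rwa [uIcc_of_le hab])
    (by rw [min_eq_left hab, max_eq_right hab]; exact dh1)
    (by rw [min_eq_left hab, max_eq_right hab]; exact dh)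
    (ContinuousOn.intervalIntegrable_Icc hab hh2) (ContinuousOn.intervalIntegrable_Icc hab hh1)
  simp only [← pow_two] at this
  rw [this]
  have ha : a ∈ Icc a b := left_mem_Icc.2 hab
  have hb : b ∈ Icc a b := right_mem_Icc.2 hab
  have hL : 0 ≤ L := (abs_nonneg _).trans (bh1 a ha)
  have m : ∀ x ∈ Icc a b, ∀ y : ℝ, |y| ≤ L → |y * h x| ≤ L * S := fun x hx y hy => by
    rw [abs_mul]; exact mul_le_mul hy (hS x hx) (abs_nonneg _) hL
  have i : |∫ x in a..b, h2 x * h x| ≤ L * S * (b - a) := by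
    have := intervalIntegral.norm_integral_le_of_norm_le_const (a := a) (b := b) (C := L * S)
      (f := fun x => h2 x * h x) (fun x hx => by
        rw [uIoc_of_le hab] at hx
        exact m x ⟨hx.1.le, hx.2⟩ _ (bh2 x ⟨hx.1.le, hx.2⟩))
    rwa [Real.norm_eq_abs, abs_of_nonneg (sub_nonneg.2 hab)] at this
  have j := m a ha _ (bh1 a ha)
  have k := m b hb _ (bh1 b hb)
  have := abs_le.1 i; have := abs_le.1 j; have := abs_le.1 k
  nlinarith

/-- The sup-norm of `h` is controlled by its `L²` norm if `h'` is bounded: compare `h x ^ 2` with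
`h y ^ 2` and average over `y`. -/
theorem sq_le_of_integral_sq (hab : a < b) (hh : ContinuousOn h (Icc a b))
    (hh1 : ContinuousOn h1 (Icc a b))
    (dh : ∀ x ∈ Ioo a b, HasDerivAt h (h1 x) x)
    (bh1 : ∀ x ∈ Icc a b, |h1 x| ≤ L) {x : ℝ} (hx : x ∈ Icc a b) :
    (b - a) * h x ^ 2 ≤ (∫ y in a..b, h y ^ 2)
      + 2 * L * (b - a) * √((b - a) * ∫ y in a..b, h y ^ 2) := by
  have hL : 0 ≤ L := (abs_nonneg _).trans (bh1 x hx)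
  set A := ∫ y in a..b, h y ^ 2
  have i1 : ∫ y in a..b, |h y| ≤ √((b - a) * A) := by
    apply Real.le_sqrt_of_sq_le
    have := sq_intervalIntegral_mul_le hab.le (f := fun _ => 1) (g := fun y => |h y|)
      continuousOn_const hh.abs
    simpa [sq_abs] using this
  have iabs : IntervalIntegrable (fun y => |h y|) volume a b :=
    ContinuousOn.intervalIntegrable_Icc hab.le hh.abs
  have pt : ∀ y ∈ Icc a b, h x ^ 2 ≤ h y ^ 2 + 2 * L * √((b - a) * A) := by
    intro y hy
    have sub : uIcc y x ⊆ Icc a b := uIcc_subset_Icc hy hx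
    have sub' : Ioo (min y x) (max y x) ⊆ Ioo a b := by
      intro z hz
      exact ⟨(le_min hy.1 hx.1).trans_lt hz.1, hz.2.trans_le (max_le hy.2 hx.2)⟩
    have ii : IntervalIntegrable (fun z => 2 * h z * h1 z) volume y x :=
      ((continuousOn_const.mul (hh.mono sub)).mul (hh1.mono sub)).intervalIntegrable
    have ftc := intervalIntegral.integral_eq_sub_of_hasDeriv_right (a := y) (b := x)
      (f := fun z => h z ^ 2) (f' := fun z => 2 * h z * h1 z) ((hh.mono sub).pow 2)
      (fun z hz => by
        have := ((dh z (sub' hz)).fun_pow 2).hasDerivWithinAt (s := Ioi z)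
        norm_num at this
        exact this.mono Ioi_subset_Ici_self) ii
    have bd : |∫ z in y..x, 2 * h z * h1 z| ≤ |(∫ z in y..x, 2 * L * |h z|)| := by
      have := intervalIntegral.norm_integral_le_abs_of_norm_le (a := y) (b := x)
        (f := fun z => 2 * h z * h1 z) (g := fun z => 2 * L * |h z|) (μ := volume) ?_ ?_
      · simpa using this
      · refine (ae_restrict_iff' measurableSet_uIoc).2 (.of_forall fun z hz => ?_)
        have := bh1 z (sub (uIoc_subset_uIcc hz))
        rw [Real.norm_eq_abs, abs_mul, abs_mul, abs_two]
        nlinarith [abs_nonneg (h z)]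
      · exact (continuousOn_const.mul (hh.mono sub).abs).intervalIntegrable
    have bd2 : |(∫ z in y..x, 2 * L * |h z|)| ≤ 2 * L * ∫ z in a..b, |h z| := by
      rw [intervalIntegral.integral_const_mul, abs_mul, abs_of_nonneg (by positivity)]
      refine mul_le_mul_of_nonneg_left ?_ (by positivity)
      refine (intervalIntegral.abs_integral_mono_interval (c := a) (d := b) ?_ ?_ iabs).trans ?_
      · rw [uIoc_of_le hab.le]
        intro z hz
        rw [uIoc, mem_Ioc] at hz
        exact ⟨(le_min hy.1 hx.1).trans_lt hz.1, hz.2.trans (max_le hy.2 hx.2)⟩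
      · exact .of_forall fun z => abs_nonneg _
      · rw [abs_of_nonneg]
        exact intervalIntegral.integral_nonneg hab.le fun z _ => abs_nonneg _
    have := le_abs_self (∫ z in y..x, 2 * h z * h1 z)
    have : 2 * L * ∫ z in a..b, |h z| ≤ 2 * L * √((b - a) * A) :=
      mul_le_mul_of_nonneg_left i1 (by positivity)
    linarith
  have i2 : IntervalIntegrable (fun y => h y ^ 2) volume a b :=
    ContinuousOn.intervalIntegrable_Icc hab.le (hh.pow 2)
  have := intervalIntegral.integral_mono_on hab.le (f := fun _ => h x ^ 2)
    (g := fun y => h y ^ 2 + 2 * L * √((b - a) * A)) (by simp)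
    (i2.add (by simp)) pt
  rw [intervalIntegral.integral_add i2 (by simp), intervalIntegral.integral_const,
    intervalIntegral.integral_const, smul_eq_mul, smul_eq_mul] at this
  nlinarith

/-- The interpolation inequality `‖h‖₂^{14} ≤ C ‖E‖₂^8`, that is `‖h‖₂ ≤ C ‖E‖₂^{4/7}`, for a
function `E` on `[a, b]` vanishing at both endpoints whose derivative `h` has two bounded
derivatives; and the bound `‖h‖_∞^4 ≤ C ‖h‖₂²`. The constant depends only on the bounds. -/
theorem exists_interpolation_const (l₀ l₁ K L : ℝ) (hl₀ : 0 < l₀) :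
    ∃ C : ℝ, 0 ≤ C ∧ ∀ {a b : ℝ} {E h h1 h2 : ℝ → ℝ}, l₀ ≤ b - a → b - a ≤ l₁ →
      ContinuousOn E (Icc a b) → ContinuousOn h (Icc a b) →
      ContinuousOn h1 (Icc a b) → ContinuousOn h2 (Icc a b) →
      (∀ x ∈ Ioo a b, HasDerivAt E (h x) x) → (∀ x ∈ Ioo a b, HasDerivAt h (h1 x) x) →
      (∀ x ∈ Ioo a b, HasDerivAt h1 (h2 x) x) →
      (∀ x ∈ Icc a b, |h x| ≤ K) →
      (∀ x ∈ Icc a b, |h1 x| ≤ L) → (∀ x ∈ Icc a b, |h2 x| ≤ L) →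
      E a = 0 → E b = 0 →
      (∫ x in a..b, h x ^ 2) ^ 7 ≤ C * (∫ x in a..b, E x ^ 2) ^ 4 ∧
      ∀ x ∈ Icc a b, h x ^ 4 ≤ C * ∫ x in a..b, h x ^ 2 := by
  set c₁ := |K| * √l₁ / l₀ + 2 * |L| * √l₁
  set c₂ := 2 * |L| + |L| * l₁
  refine ⟨max (c₁ ^ 2) ((c₂ ^ 2 * c₁) ^ 2), by positivity, ?_⟩
  intro a b E h h1 h2 hl hl' hE hh hh1 hh2 dE dh dh1 bh bh1 bh2 hEa hEb
  have hab : a < b := by linarith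
  have hL : 0 ≤ L := (abs_nonneg _).trans (bh1 a (left_mem_Icc.2 hab.le))
  have hK : 0 ≤ K := (abs_nonneg _).trans (bh a (left_mem_Icc.2 hab.le))
  have hc₁ : 0 ≤ c₁ := by positivity
  have eK : |K| = K := abs_of_nonneg hK
  have eL : |L| = L := abs_of_nonneg hL
  set A := ∫ y in a..b, h y ^ 2 with hA
  set B := ∫ y in a..b, E y ^ 2 with hB
  set A1 := ∫ y in a..b, h1 y ^ 2 with hA1
  have A0 : 0 ≤ A := intervalIntegral.integral_nonneg hab.le fun _ _ => sq_nonneg _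
  have B0 : 0 ≤ B := intervalIntegral.integral_nonneg hab.le fun _ _ => sq_nonneg _
  have A10 : 0 ≤ A1 := intervalIntegral.integral_nonneg hab.le fun _ _ => sq_nonneg _
  have AK : A ≤ K ^ 2 * l₁ := by
    have := intervalIntegral.integral_mono_on hab.le (f := fun y => h y ^ 2)
      (g := fun y => K ^ 2) (ContinuousOn.intervalIntegrable_Icc hab.le (hh.pow 2)) (by simp)
      (fun x hx => by rw [← sq_abs]; exact pow_le_pow_left₀ (abs_nonneg _) (bh x hx) 2)
    rw [intervalIntegral.integral_const, smul_eq_mul] at this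
    nlinarith [sq_nonneg K]
  have sup : ∀ x ∈ Icc a b, h x ^ 2 ≤ c₁ * √A := by
    intro x hx
    have h0 := sq_le_of_integral_sq hab hh hh1 dh bh1 hx
    rw [Real.sqrt_mul (by linarith)] at h0
    have e1 : A ≤ K * √l₁ * √A := by
      calc A = √A * √A := (Real.mul_self_sqrt A0).symm
        _ ≤ (K * √l₁) * √A := by
          refine mul_le_mul_of_nonneg_right ?_ (Real.sqrt_nonneg _)
          rw [← Real.sqrt_sq hK, ← Real.sqrt_mul (sq_nonneg _)]
          exact Real.sqrt_le_sqrt AK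
    have e2 : √(b - a) ≤ √l₁ := Real.sqrt_le_sqrt hl'
    have h1' : h x ^ 2 ≤ A / (b - a) + 2 * L * (√(b - a) * √A) := by
      rw [← mul_le_mul_iff_right₀ (show 0 < b - a by linarith)]
      refine h0.trans (le_of_eq ?_)
      have : b - a ≠ 0 := by linarith
      field_simp
      rw [← hA]
    have e3 : A / (b - a) ≤ K * √l₁ * √A / l₀ := by
      gcongr
    have e4 : 2 * L * (√(b - a) * √A) ≤ 2 * L * (√l₁ * √A) := by gcongr
    have : c₁ * √A = K * √l₁ * √A / l₀ + 2 * L * (√l₁ * √A) := by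
      simp only [c₁, eK, eL]; ring
    linarith
  have sup4 : ∀ x ∈ Icc a b, h x ^ 4 ≤ c₁ ^ 2 * A := by
    intro x hx
    calc h x ^ 4 = (h x ^ 2) ^ 2 := by ring
      _ ≤ (c₁ * √A) ^ 2 := pow_le_pow_left₀ (sq_nonneg _) (sup x hx) 2
      _ = c₁ ^ 2 * A := by rw [mul_pow, Real.sq_sqrt A0]
  refine ⟨?_, fun x hx => (sup4 x hx).trans (mul_le_mul_of_nonneg_right (le_max_left _ _) A0)⟩
  obtain ⟨x₀, hx₀, hmax⟩ := isCompact_Icc.exists_isMaxOn (nonempty_Icc.2 hab.le) hh.abs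
  have s1 : A1 ≤ (2 * L + L * (b - a)) * |h x₀| :=
    integral_sq_deriv_le hab.le hh hh1 hh2 dh dh1 bh1 bh2 fun x hx => hmax hx
  have s2 : A1 ≤ c₂ * |h x₀| := by
    refine s1.trans (mul_le_mul_of_nonneg_right ?_ (abs_nonneg _))
    simp only [c₂, eL]; gcongr
  have s3 : A1 ^ 4 ≤ (c₂ ^ 2 * c₁) ^ 2 * A := by
    calc A1 ^ 4 ≤ (c₂ * |h x₀|) ^ 4 := pow_le_pow_left₀ A10 s2 4
      _ = c₂ ^ 4 * h x₀ ^ 4 := by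
        rw [mul_pow, show |h x₀| ^ 4 = h x₀ ^ 4 from Even.pow_abs (by decide) _]
      _ ≤ c₂ ^ 4 * (c₁ ^ 2 * A) := by gcongr; exact sup4 x₀ hx₀
      _ = _ := by ring
  have s4 : A ^ 2 ≤ A1 * B := sq_integral_sq_le_of_primitive hab.le hE hh hh1 dE dh hEa hEb
  -- `‖h‖⁴ ≤ ‖h'‖² ‖E‖²`, `‖h'‖² ≲ ‖h‖_∞` and `‖h‖_∞⁴ ≲ ‖h‖²` combine to `A ^ 8 ≲ B ^ 4 A`
  have s5 : A ^ 8 ≤ (c₂ ^ 2 * c₁) ^ 2 * B ^ 4 * A := by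
    calc A ^ 8 = (A ^ 2) ^ 4 := by ring
      _ ≤ (A1 * B) ^ 4 := pow_le_pow_left₀ (sq_nonneg _) s4 4
      _ = A1 ^ 4 * B ^ 4 := mul_pow _ _ _
      _ ≤ ((c₂ ^ 2 * c₁) ^ 2 * A) * B ^ 4 := by gcongr
      _ = _ := by ring
  have s6 : A ^ 7 ≤ (c₂ ^ 2 * c₁) ^ 2 * B ^ 4 := by
    rcases A0.eq_or_lt with h0 | h0
    · rw [← h0]; simp; positivity
    · refine le_of_mul_le_mul_right ?_ h0
      calc A ^ 7 * A = A ^ 8 := by ring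
        _ ≤ _ := s5
  exact s6.trans (mul_le_mul_of_nonneg_right (le_max_right _ _) (by positivity))

end Interpolation

/-! ### Distribution and quantile functions of smooth densities -/

/-- A probability density with support `[a, b] ⊆ [-R, R]`, with values in `[1 / M, M]` on its
support, together with two derivatives bounded by `L` there. -/
structure IsSmoothDensity (R M L a b : ℝ) (g : ℝ → ℝ) : Prop where
  lt : a < b
  subset : Icc a b ⊆ Icc (-R) R
  M_pos : 0 < M
  nonneg : ∀ u, 0 ≤ g u
  integrable : Integrable g
  integral_eq : ∫ u, g u = 1
  support_eq : Function.support g = Icc a b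
  le : ∀ u, g u ≤ M
  ge : ∀ u ∈ Icc a b, M⁻¹ ≤ g u
  contDiffOn : ContDiffOn ℝ 2 g (Icc a b)
  deriv_le : ∀ u ∈ Icc a b, |iteratedDerivWithin 1 g (Icc a b) u| ≤ L
  deriv2_le : ∀ u ∈ Icc a b, |iteratedDerivWithin 2 g (Icc a b) u| ≤ L

theorem IsUnivariateClass.exists_isSmoothDensity {k : ℕ} (hk : 2 ≤ k) {𝒢 : Set (ℝ → ℝ)}
    (h : IsUnivariateClass k 𝒢) :
    ∃ R M L : ℝ, 0 < R ∧ 0 < M ∧ ∀ g ∈ 𝒢, ∃ a b, IsSmoothDensity R M L a b g := by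
  obtain ⟨R, M, L, h⟩ := h
  refine ⟨max R 1, max M 1, L, by positivity, by positivity, fun g hg => ?_⟩
  obtain ⟨h0, hi, h1, a, b, hab, hs, hR, hM, hc, hL⟩ := h g hg
  have z : ∀ u, u ∉ Icc a b → g u = 0 := fun u hu => by
    by_contra h'; exact hu (hs ▸ h')
  refine ⟨a, b, hab, hR.trans (Icc_subset_Icc (by simp) (by simp)), by positivity,
    h0, hi, h1, hs, ?_, ?_, hc.of_le (by exact_mod_cast hk),
    hL 1 le_rfl (by omega), hL 2 (by omega) hk⟩
  · intro u
    by_cases hu : u ∈ Icc a b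
    · exact (hM u hu).1.trans (le_max_left _ _)
    · rw [z u hu]; positivity
  · intro u hu
    have pos : 0 < g u :=
      lt_of_le_of_ne (h0 u) (Ne.symm (show u ∈ Function.support g from hs ▸ hu))
    have := (hM u hu).2.trans (le_max_left M 1)
    rw [one_div] at this
    exact inv_le_of_inv_le₀ pos this

/-- The distribution function of the density `g`. -/
def cdfOf (g : ℝ → ℝ) (u : ℝ) : ℝ := ∫ t in Iic u, g t

namespace IsSmoothDensity

variable {R M L a b : ℝ} {g : ℝ → ℝ}

theorem eq_zero (hg : IsSmoothDensity R M L a b g) {u : ℝ} (hu : u ∉ Icc a b) : g u = 0 := by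
  by_contra h'; exact hu (hg.support_eq ▸ h')

theorem cdf_sub (hg : IsSmoothDensity R M L a b g) (u v : ℝ) :
    cdfOf g v - cdfOf g u = ∫ t in u..v, g t :=
  intervalIntegral.integral_Iic_sub_Iic hg.integrable.integrableOn hg.integrable.integrableOn

theorem cdf_mono (hg : IsSmoothDensity R M L a b g) : Monotone (cdfOf g) := fun u v huv => by
  rw [← sub_nonneg, hg.cdf_sub]
  exact intervalIntegral.integral_nonneg huv fun t _ => hg.nonneg t

theorem cdf_of_le (hg : IsSmoothDensity R M L a b g) {u : ℝ} (hu : u ≤ a) : cdfOf g u = 0 := by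
  have : cdfOf g u = ∫ t in Iio u, g t := integral_Iic_eq_integral_Iio
  rw [this, setIntegral_eq_zero_of_forall_eq_zero]
  intro t ht
  exact hg.eq_zero fun h => absurd (ht.trans_le hu) (not_lt.2 h.1)

theorem cdf_of_ge (hg : IsSmoothDensity R M L a b g) {u : ℝ} (hu : b ≤ u) : cdfOf g u = 1 := by
  rw [← hg.integral_eq]
  refine setIntegral_eq_integral_of_forall_compl_eq_zero fun t ht => hg.eq_zero fun h => ?_
  exact ht (h.2.trans hu)

theorem cdf_sub_le (hg : IsSmoothDensity R M L a b g) {u v : ℝ} (huv : u ≤ v) :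
    cdfOf g v - cdfOf g u ≤ M * (v - u) := by
  rw [hg.cdf_sub]
  have := intervalIntegral.integral_mono_on huv hg.integrable.intervalIntegrable
    (intervalIntegrable_const (c := M)) fun t _ => hg.le t
  simpa [mul_comm] using this

theorem abs_cdf_sub_le (hg : IsSmoothDensity R M L a b g) (u v : ℝ) :
    |cdfOf g v - cdfOf g u| ≤ M * |v - u| := by
  rcases le_total u v with h | h
  · rw [abs_of_nonneg (sub_nonneg.2 (hg.cdf_mono h)), abs_of_nonneg (sub_nonneg.2 h)]
    exact hg.cdf_sub_le h
  · rw [abs_sub_comm, abs_sub_comm v u, abs_of_nonneg (sub_nonneg.2 (hg.cdf_mono h)),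
      abs_of_nonneg (sub_nonneg.2 h)]
    exact hg.cdf_sub_le h

theorem le_cdf_sub (hg : IsSmoothDensity R M L a b g) {u v : ℝ} (huv : u ≤ v)
    (hu : u ∈ Icc a b) (hv : v ∈ Icc a b) : v - u ≤ M * (cdfOf g v - cdfOf g u) := by
  rw [hg.cdf_sub]
  have := intervalIntegral.integral_mono_on huv (intervalIntegrable_const (c := M⁻¹))
    hg.integrable.intervalIntegrable fun t ht => hg.ge t ⟨hu.1.trans ht.1, ht.2.trans hv.2⟩
  rw [intervalIntegral.integral_const, smul_eq_mul] at this
  have hM := hg.M_pos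
  calc v - u = M * ((v - u) * M⁻¹) := by field_simp
    _ ≤ _ := by gcongr

theorem abs_sub_le_cdf (hg : IsSmoothDensity R M L a b g) {u v : ℝ}
    (hu : u ∈ Icc a b) (hv : v ∈ Icc a b) : |v - u| ≤ M * |cdfOf g v - cdfOf g u| := by
  rcases le_total u v with h | h
  · rw [abs_of_nonneg (sub_nonneg.2 (hg.cdf_mono h)), abs_of_nonneg (sub_nonneg.2 h)]
    exact hg.le_cdf_sub h hu hv
  · rw [abs_sub_comm, abs_sub_comm (cdfOf g v), abs_of_nonneg (sub_nonneg.2 (hg.cdf_mono h)),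
      abs_of_nonneg (sub_nonneg.2 h)]
    exact hg.le_cdf_sub h hv hu

theorem continuous_cdf (hg : IsSmoothDensity R M L a b g) : Continuous (cdfOf g) := by
  refine (LipschitzWith.of_dist_le_mul (K := ⟨M, hg.M_pos.le⟩) fun u v => ?_).continuous
  rw [Real.dist_eq, Real.dist_eq]
  exact hg.abs_cdf_sub_le v u

theorem cdf_mem_Icc (hg : IsSmoothDensity R M L a b g) (u : ℝ) : cdfOf g u ∈ Icc (0 : ℝ) 1 := by
  constructor
  · rw [← hg.cdf_of_le (min_le_right u a)]
    exact hg.cdf_mono (min_le_left _ _)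
  · rw [← hg.cdf_of_ge (le_max_right u b)]
    exact hg.cdf_mono (le_max_left _ _)

theorem hasDerivWithinAt_cdf (hg : IsSmoothDensity R M L a b g) {u : ℝ} (hu : u ∈ Icc a b) :
    HasDerivWithinAt (cdfOf g) (g u) (Icc a b) u := by
  have : cdfOf g = fun v => ∫ t in a..v, g t := by
    ext v; rw [← hg.cdf_sub, hg.cdf_of_le le_rfl, sub_zero]
  rw [this]
  have : Fact (u ∈ Icc a b) := ⟨hu⟩
  refine intervalIntegral.integral_hasDerivWithinAt_right hg.integrable.intervalIntegrable
    (s := Icc a b) (t := Icc a b) ?_ (hg.contDiffOn.continuousOn u hu)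
  exact hg.integrable.aestronglyMeasurable.stronglyMeasurableAtFilter

theorem hasDerivAt_cdf (hg : IsSmoothDensity R M L a b g) {u : ℝ} (hu : u ∈ Ioo a b) :
    HasDerivAt (cdfOf g) (g u) u :=
  (hg.hasDerivWithinAt_cdf (Ioo_subset_Icc_self hu)).hasDerivAt (Icc_mem_nhds hu.1 hu.2)

theorem exists_cdf_eq (hg : IsSmoothDensity R M L a b g) {s : ℝ} (hs : s ∈ Ioc (0 : ℝ) 1) :
    ∃ u ∈ Ioc a b, cdfOf g u = s := by
  have := intermediate_value_Icc hg.lt.le hg.continuous_cdf.continuousOn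
  rw [hg.cdf_of_le le_rfl, hg.cdf_of_ge le_rfl] at this
  obtain ⟨u, hu, h⟩ := this (Ioc_subset_Icc_self hs)
  refine ⟨u, ⟨lt_of_le_of_ne hu.1 ?_, hu.2⟩, h⟩
  rintro rfl
  rw [hg.cdf_of_le le_rfl] at h
  exact hs.1.ne h

theorem quantile_cdf (hg : IsSmoothDensity R M L a b g) {u : ℝ} (hu : u ∈ Ioc a b) :
    quantile g (cdfOf g u) = u := by
  have : {v | cdfOf g u ≤ cdfOf g v} = Ici u := by
    ext v
    refine ⟨fun h => ?_, fun h => hg.cdf_mono h⟩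
    by_contra hv
    simp only [mem_Ici, not_le] at hv
    have hm : max v a < u := max_lt hv hu.1
    have h1 := hg.le_cdf_sub (u := max v a) (v := u) hm.le
      ⟨le_max_right _ _, hm.le.trans hu.2⟩ ⟨hu.1.le, hu.2⟩
    have h2 : cdfOf g u ≤ cdfOf g (max v a) := le_trans h (hg.cdf_mono (le_max_left _ _))
    nlinarith [hg.M_pos]
  change sInf {v | cdfOf g u ≤ cdfOf g v} = u
  rw [this, csInf_Ici]

theorem cdf_pos (hg : IsSmoothDensity R M L a b g) {u : ℝ} (hu : u ∈ Ioc a b) :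
    cdfOf g u ∈ Ioc (0 : ℝ) 1 := by
  refine ⟨?_, (hg.cdf_mem_Icc u).2⟩
  have := hg.le_cdf_sub hu.1.le (left_mem_Icc.2 hg.lt.le) ⟨hu.1.le, hu.2⟩
  rw [hg.cdf_of_le le_rfl] at this
  have h := hu.1
  by_contra hc
  nlinarith [hg.M_pos]

theorem quantile_spec (hg : IsSmoothDensity R M L a b g) {s : ℝ} (hs : s ∈ Ioc (0 : ℝ) 1) :
    quantile g s ∈ Ioc a b ∧ cdfOf g (quantile g s) = s := by
  obtain ⟨u, hu, rfl⟩ := hg.exists_cdf_eq hs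
  rw [hg.quantile_cdf hu]
  exact ⟨hu, rfl⟩

theorem quantile_le_iff (hg : IsSmoothDensity R M L a b g) {s : ℝ} (hs : s ∈ Ioc (0 : ℝ) 1)
    {u : ℝ} : quantile g s ≤ u ↔ s ≤ cdfOf g u := by
  obtain ⟨h1, h2⟩ := hg.quantile_spec hs
  refine ⟨fun h => h2 ▸ hg.cdf_mono h, fun h => ?_⟩
  refine csInf_le ⟨a, fun v hv => ?_⟩ h
  by_contra hva
  have hv' : s ≤ cdfOf g v := hv
  rw [hg.cdf_of_le (not_le.1 hva).le] at hv'
  exact absurd hs.1 (not_lt.2 hv')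

/-- Outside `(0, 1]` the infimum defining the quantile is over the whole line or over the empty
set, and takes the default value. -/
theorem quantile_of_notMem (hg : IsSmoothDensity R M L a b g) {s : ℝ} (hs : s ∉ Ioc (0 : ℝ) 1) :
    quantile g s = 0 := by
  change sInf {v | s ≤ cdfOf g v} = 0
  by_cases h : s ≤ 0
  · rw [eq_univ_of_forall (s := {v | s ≤ cdfOf g v}) fun v => h.trans (hg.cdf_mem_Icc v).1,
      Real.sInf_univ]
  · have h1 : 1 < s := by
      by_contra h1; exact hs ⟨not_le.1 h, not_lt.1 h1⟩
    rw [eq_empty_of_forall_notMem (s := {v | s ≤ cdfOf g v}) fun v hv =>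
      absurd (h1.trans_le hv) (not_lt.2 (hg.cdf_mem_Icc v).2), Real.sInf_empty]

theorem abs_quantile_le (hg : IsSmoothDensity R M L a b g) (hR : 0 ≤ R) (s : ℝ) :
    |quantile g s| ≤ R := by
  by_cases hs : s ∈ Ioc (0 : ℝ) 1
  · exact abs_le.2 (hg.subset (Ioc_subset_Icc_self (hg.quantile_spec hs).1))
  · rw [hg.quantile_of_notMem hs, abs_zero]; exact hR

theorem sub_le (hg : IsSmoothDensity R M L a b g) : b - a ≤ 2 * R := by
  have h1 := (hg.subset (left_mem_Icc.2 hg.lt.le)).1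
  have h2 := (hg.subset (right_mem_Icc.2 hg.lt.le)).2
  linarith

theorem le_sub (hg : IsSmoothDensity R M L a b g) : M⁻¹ ≤ b - a := by
  have := hg.cdf_sub_le hg.lt.le
  rw [hg.cdf_of_le le_rfl, hg.cdf_of_ge le_rfl, sub_zero] at this
  have hM := hg.M_pos
  rw [inv_le_iff_one_le_mul₀ hM]
  linarith

/-- The distribution function, recovered from the quantile function. -/
theorem cdf_eq_volume (hg : IsSmoothDensity R M L a b g) (u : ℝ) :
    cdfOf g u = (volume.restrict (Ioc (0 : ℝ) 1) {s | quantile g s ≤ u}).toReal := by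
  have : {s | quantile g s ≤ u} ∩ Ioc 0 1 = Ioc 0 (cdfOf g u) := by
    ext s
    constructor
    · rintro ⟨h, hs⟩
      exact ⟨hs.1, (hg.quantile_le_iff hs).1 h⟩
    · rintro hs
      have : s ∈ Ioc (0 : ℝ) 1 := ⟨hs.1, hs.2.trans (hg.cdf_mem_Icc u).2⟩
      exact ⟨(hg.quantile_le_iff this).2 hs.2, this⟩
  rw [Measure.restrict_apply' measurableSet_Ioc, this, Real.volume_Ioc, sub_zero,
    ENNReal.toReal_ofReal (hg.cdf_mem_Icc u).1]

theorem tendsto_slope_right (hg : IsSmoothDensity R M L a b g) (u : ℝ) :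
    Tendsto (slope (cdfOf g) u) (𝓝[>] u) (𝓝 (if u ∈ Ico a b then g u else 0)) := by
  suffices HasDerivWithinAt (cdfOf g) (if u ∈ Ico a b then g u else 0) (Ioi u) u by
    rwa [hasDerivWithinAt_iff_tendsto_slope' (by simp)] at this
  split_ifs with hu
  · refine (hg.hasDerivWithinAt_cdf (Ico_subset_Icc_self hu)).mono_of_mem_nhdsWithin ?_
    filter_upwards [Ioo_mem_nhdsGT hu.2] with v hv
    exact ⟨hu.1.trans hv.1.le, hv.2.le⟩
  · by_cases h : u < a
    · have : HasDerivWithinAt (fun _ : ℝ => (0 : ℝ)) 0 (Ioi u) u := hasDerivWithinAt_const _ _ _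
      refine this.congr_of_eventuallyEq ?_ (hg.cdf_of_le h.le)
      filter_upwards [Ioo_mem_nhdsGT h] with v hv using hg.cdf_of_le hv.2.le
    · have hb : b ≤ u := by
        by_contra hb; exact hu ⟨not_lt.1 h, not_le.1 hb⟩
      have : HasDerivWithinAt (fun _ : ℝ => (1 : ℝ)) 0 (Ioi u) u := hasDerivWithinAt_const _ _ _
      refine this.congr_of_eventuallyEq ?_ (hg.cdf_of_ge hb)
      filter_upwards [self_mem_nhdsWithin] with v hv
      exact hg.cdf_of_ge (hb.trans (le_of_lt hv))

theorem tendsto_slope_left (hg : IsSmoothDensity R M L a b g) (u : ℝ) :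
    Tendsto (slope (cdfOf g) u) (𝓝[<] u) (𝓝 (if u ∈ Ioc a b then g u else 0)) := by
  suffices HasDerivWithinAt (cdfOf g) (if u ∈ Ioc a b then g u else 0) (Iio u) u by
    rwa [hasDerivWithinAt_iff_tendsto_slope' (by simp)] at this
  split_ifs with hu
  · refine (hg.hasDerivWithinAt_cdf (Ioc_subset_Icc_self hu)).mono_of_mem_nhdsWithin ?_
    filter_upwards [Ioo_mem_nhdsLT hu.1] with v hv
    exact ⟨hv.1.le, hv.2.le.trans hu.2⟩
  · by_cases h : b < u
    · have : HasDerivWithinAt (fun _ : ℝ => (1 : ℝ)) 0 (Iio u) u := hasDerivWithinAt_const _ _ _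
      refine this.congr_of_eventuallyEq ?_ (hg.cdf_of_ge h.le)
      filter_upwards [Ioo_mem_nhdsLT h] with v hv using hg.cdf_of_ge hv.1.le
    · have hb : u ≤ a := by
        by_contra hb; exact hu ⟨not_le.1 hb, not_lt.1 h⟩
      have : HasDerivWithinAt (fun _ : ℝ => (0 : ℝ)) 0 (Iio u) u := hasDerivWithinAt_const _ _ _
      refine this.congr_of_eventuallyEq ?_ (hg.cdf_of_le hb)
      filter_upwards [self_mem_nhdsWithin] with v hv
      exact hg.cdf_of_le ((le_of_lt hv).trans hb)

/-- The density is the larger one of the two one-sided derivatives of the distribution function,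
also at the endpoints of the support. -/
theorem tendsto_max_slope (hg : IsSmoothDensity R M L a b g) (u : ℝ) :
    Tendsto (fun n : ℕ => max (slope (cdfOf g) u (u + 1 / ((n : ℝ) + 1)))
      (slope (cdfOf g) u (u - 1 / ((n : ℝ) + 1)))) atTop (𝓝 (g u)) := by
  have t0 : Tendsto (fun n : ℕ => 1 / ((n : ℝ) + 1)) atTop (𝓝 0) :=
    tendsto_one_div_add_atTop_nhds_zero_nat
  have tr : Tendsto (fun n : ℕ => u + 1 / ((n : ℝ) + 1)) atTop (𝓝[>] u) := by
    refine tendsto_nhdsWithin_iff.2 ⟨by simpa using tendsto_const_nhds.add t0,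
      .of_forall fun n => ?_⟩
    have : 0 < 1 / ((n : ℝ) + 1) := by positivity
    simp only [mem_Ioi]; linarith
  have tl : Tendsto (fun n : ℕ => u - 1 / ((n : ℝ) + 1)) atTop (𝓝[<] u) := by
    refine tendsto_nhdsWithin_iff.2 ⟨by simpa using tendsto_const_nhds.sub t0,
      .of_forall fun n => ?_⟩
    have : 0 < 1 / ((n : ℝ) + 1) := by positivity
    simp only [mem_Iio]; linarith
  have := ((hg.tendsto_slope_right u).comp tr).max ((hg.tendsto_slope_left u).comp tl)
  suffices e : max (if u ∈ Ico a b then g u else 0) (if u ∈ Ioc a b then g u else 0) = g u by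
    rwa [e] at this
  have h0 := hg.nonneg u
  by_cases hu : u ∈ Icc a b
  · by_cases hb : u < b
    · have m : u ∈ Ico a b := ⟨hu.1, hb⟩
      rw [if_pos m]
      split_ifs <;> simp [h0]
    · have m : u ∈ Ioc a b := ⟨hg.lt.trans_le (not_lt.1 hb), hu.2⟩
      rw [if_pos m]
      split_ifs <;> simp [h0]
  · rw [hg.eq_zero hu]; simp

end IsSmoothDensity

/-! ### Comparison of densities and quantile functions -/

section Comparison

variable {R M L a b : ℝ} {g₁ g₂ : ℝ → ℝ}

theorem enorm_sq_eq_ofReal (x : ℝ) : ‖x‖ₑ ^ 2 = ENNReal.ofReal (x ^ 2) := by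
  rw [← sq_abs, ENNReal.ofReal_pow (abs_nonneg _), Real.enorm_eq_ofReal_abs]

theorem lintegral_enorm_sq_Icc {f : ℝ → ℝ} (hab : a ≤ b) (hf : ContinuousOn f (Icc a b)) :
    ∫⁻ u in Icc a b, ‖f u‖ₑ ^ 2 = ENNReal.ofReal (∫ u in a..b, f u ^ 2) := by
  rw [intervalIntegral.integral_of_le hab, ← integral_Icc_eq_integral_Ioc,
    ofReal_integral_eq_lintegral_ofReal]
  · simp_rw [enorm_sq_eq_ofReal]
  · exact (hf.pow 2).integrableOn_Icc
  · exact .of_forall fun x => sq_nonneg _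

theorem lintegral_density_sub_sq (h₁ : IsSmoothDensity R M L a b g₁)
    (h₂ : IsSmoothDensity R M L a b g₂) :
    ∫⁻ u, ‖g₁ u - g₂ u‖ₑ ^ 2 = ENNReal.ofReal (∫ u in a..b, (g₁ u - g₂ u) ^ 2) := by
  rw [← lintegral_enorm_sq_Icc (f := fun u => g₁ u - g₂ u) h₁.lt.le
    (h₁.contDiffOn.continuousOn.sub h₂.contDiffOn.continuousOn)]
  refine (setLIntegral_eq_of_support_subset fun u hu => ?_).symm
  by_contra h
  simp [h₁.eq_zero h, h₂.eq_zero h] at hu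

/-- Quantile functions are Lipschitz in the density, in `L²`. -/
theorem enorm_quantile_sub_sq_le (h₁ : IsSmoothDensity R M L a b g₁)
    (h₂ : IsSmoothDensity R M L a b g₂) (s : ℝ) :
    ‖quantile g₁ s - quantile g₂ s‖ₑ ^ 2 ≤
      ENNReal.ofReal (M ^ 2 * (2 * R)) * ∫⁻ u, ‖g₁ u - g₂ u‖ₑ ^ 2 := by
  by_cases hs : s ∈ Ioc (0 : ℝ) 1
  swap
  · simp [h₁.quantile_of_notMem hs, h₂.quantile_of_notMem hs]
  have hR : 0 ≤ 2 * R := by have := h₁.sub_le; linarith [h₁.lt]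
  have hM := h₁.M_pos
  rw [lintegral_density_sub_sq h₁ h₂, enorm_sq_eq_ofReal, ← ENNReal.ofReal_mul (by positivity)]
  apply ENNReal.ofReal_le_ofReal
  obtain ⟨m₁, e₁⟩ := h₁.quantile_spec hs
  obtain ⟨m₂, e₂⟩ := h₂.quantile_spec hs
  set u₁ := quantile g₁ s
  set u₂ := quantile g₂ s
  have d := h₁.abs_sub_le_cdf (Ioc_subset_Icc_self m₂) (Ioc_subset_Icc_self m₁)
  have e : cdfOf g₁ u₁ - cdfOf g₁ u₂ = -∫ t in a..u₂, (g₁ t - g₂ t) := by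
    rw [intervalIntegral.integral_sub h₁.integrable.intervalIntegrable
      h₂.integrable.intervalIntegrable, ← h₁.cdf_sub, ← h₂.cdf_sub, h₁.cdf_of_le le_rfl,
      h₂.cdf_of_le le_rfl, e₁, e₂]
    ring
  rw [e, abs_neg] at d
  have hc : ContinuousOn (fun t => g₁ t - g₂ t) (Icc a b) :=
    h₁.contDiffOn.continuousOn.sub h₂.contDiffOn.continuousOn
  have cs := sq_intervalIntegral_mul_le m₂.1.le (f := fun _ => 1) (g := fun t => g₁ t - g₂ t)
    continuousOn_const (hc.mono (Icc_subset_Icc_right m₂.2))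
  simp only [one_mul, one_pow, intervalIntegral.integral_const, smul_eq_mul, mul_one] at cs
  have mono : ∫ t in a..u₂, (g₁ t - g₂ t) ^ 2 ≤ ∫ t in a..b, (g₁ t - g₂ t) ^ 2 :=
    intervalIntegral.integral_mono_interval le_rfl m₂.1.le m₂.2
      (.of_forall fun t => sq_nonneg _)
      (ContinuousOn.intervalIntegrable_Icc h₁.lt.le (hc.pow 2))
  have pos : 0 ≤ ∫ t in a..u₂, (g₁ t - g₂ t) ^ 2 :=
    intervalIntegral.integral_nonneg m₂.1.le fun t _ => sq_nonneg _
  calc (u₁ - u₂) ^ 2 = |u₁ - u₂| ^ 2 := (sq_abs _).symm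
    _ ≤ (M * |∫ t in a..u₂, (g₁ t - g₂ t)|) ^ 2 := pow_le_pow_left₀ (abs_nonneg _) d 2
    _ = M ^ 2 * (∫ t in a..u₂, (g₁ t - g₂ t)) ^ 2 := by rw [mul_pow, sq_abs]
    _ ≤ M ^ 2 * (2 * R * ∫ t in a..b, (g₁ t - g₂ t) ^ 2) := by
      gcongr
      refine cs.trans (mul_le_mul ?_ mono pos hR)
      linarith [m₂.2, h₁.sub_le]
    _ = _ := by ring

/-- Distribution functions are Lipschitz in the quantile function, in `L²`: substitute
`s = G₁ u` in the integral of the quantile functions. -/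
theorem integral_cdf_sub_sq_le (h₁ : IsSmoothDensity R M L a b g₁)
    (h₂ : IsSmoothDensity R M L a b g₂) :
    ENNReal.ofReal (∫ u in a..b, (cdfOf g₁ u - cdfOf g₂ u) ^ 2) ≤
      ENNReal.ofReal (M ^ 3) *
        ∫⁻ s in Icc (0 : ℝ) 1, ‖quantile g₁ s - quantile g₂ s‖ₑ ^ 2 := by
  have hM := h₁.M_pos
  rw [← lintegral_enorm_sq_Icc (f := fun u => cdfOf g₁ u - cdfOf g₂ u) h₁.lt.le
    (h₁.continuous_cdf.sub h₂.continuous_cdf).continuousOn]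
  have img : cdfOf g₁ '' Icc a b = Icc 0 1 := by
    refine Subset.antisymm (image_subset_iff.2 fun u _ => h₁.cdf_mem_Icc u) ?_
    have := intermediate_value_Icc h₁.lt.le h₁.continuous_cdf.continuousOn
    rwa [h₁.cdf_of_le le_rfl, h₁.cdf_of_ge le_rfl] at this
  rw [← img, lintegral_image_eq_lintegral_deriv_mul_of_monotoneOn measurableSet_Icc
    (fun u hu => h₁.hasDerivWithinAt_cdf hu) (h₁.cdf_mono.monotoneOn _),
    ← lintegral_const_mul' _ _ ENNReal.ofReal_ne_top]
  refine setLIntegral_mono' measurableSet_Icc fun u hu => ?_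
  rw [enorm_sq_eq_ofReal, enorm_sq_eq_ofReal, ← ENNReal.ofReal_mul (h₁.nonneg u),
    ← ENNReal.ofReal_mul (by positivity)]
  apply ENNReal.ofReal_le_ofReal
  rcases hu.1.eq_or_lt with rfl | hau
  · rw [h₁.cdf_of_le le_rfl, h₂.cdf_of_le le_rfl, sub_zero, zero_pow two_ne_zero]
    have := h₁.nonneg a
    positivity
  have hu' : u ∈ Ioc a b := ⟨hau, hu.2⟩
  rw [h₁.quantile_cdf hu']
  obtain ⟨m, e⟩ := h₂.quantile_spec (h₁.cdf_pos hu')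
  set v := quantile g₂ (cdfOf g₁ u)
  have d := h₂.abs_cdf_sub_le u v
  rw [e] at d
  have hge := h₁.ge u hu
  calc (cdfOf g₁ u - cdfOf g₂ u) ^ 2 = |cdfOf g₁ u - cdfOf g₂ u| ^ 2 := (sq_abs _).symm
    _ ≤ (M * |v - u|) ^ 2 := pow_le_pow_left₀ (abs_nonneg _) d 2
    _ = M ^ 3 * (M⁻¹ * (u - v) ^ 2) := by rw [mul_pow, sq_abs]; field_simp; ring
    _ ≤ M ^ 3 * (g₁ u * (u - v) ^ 2) := by gcongr

/-- The interpolation inequality behind the exponent `4/7`: the squared `L²` distance of two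
densities with the same support is at most a multiple of the power `4/7` of the squared `L²`
distance of their quantile functions. -/
theorem exists_density_le_quantile_const (R M L : ℝ) (hM : 0 < M) :
    ∃ C : ℝ, 0 ≤ C ∧ ∀ {a b : ℝ} {g₁ g₂ : ℝ → ℝ}, IsSmoothDensity R M L a b g₁ →
      IsSmoothDensity R M L a b g₂ →
      ∫⁻ u, ‖g₁ u - g₂ u‖ₑ ^ 2 ≤ ENNReal.ofReal C *
        (∫⁻ s in Icc (0 : ℝ) 1, ‖quantile g₁ s - quantile g₂ s‖ₑ ^ 2) ^ (4 / 7 : ℝ) ∧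
      ∀ u ∈ Icc a b, (g₁ u - g₂ u) ^ 4 ≤ C * ∫ x in a..b, (g₁ x - g₂ x) ^ 2 := by
  obtain ⟨C, hC, H⟩ := exists_interpolation_const M⁻¹ (2 * R) (2 * M) (2 * L) (by positivity)
  refine ⟨max C ((C * (M ^ 3) ^ 4) ^ (1 / 7 : ℝ)), by positivity, ?_⟩
  intro a b g₁ g₂ h₁ h₂
  have ud : UniqueDiffOn ℝ (Icc a b) := uniqueDiffOn_Icc h₁.lt
  have cd : ∀ {g : ℝ → ℝ}, IsSmoothDensity R M L a b g → ∀ j : ℕ, j < 2 → ∀ x ∈ Ioo a b,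
      HasDerivAt (iteratedDerivWithin j g (Icc a b))
        (iteratedDerivWithin (j + 1) g (Icc a b) x) x := by
    intro g hg j hj x hx
    have := hg.contDiffOn.differentiableOn_iteratedDerivWithin (m := j)
      (by exact_mod_cast hj) ud x (Ioo_subset_Icc_self hx)
    rw [iteratedDerivWithin_succ]
    exact this.hasDerivWithinAt.hasDerivAt (Icc_mem_nhds hx.1 hx.2)
  have cc : ∀ {g : ℝ → ℝ}, IsSmoothDensity R M L a b g → ∀ j : ℕ, j ≤ 2 →
      ContinuousOn (iteratedDerivWithin j g (Icc a b)) (Icc a b) := by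
    intro g hg j hj
    exact hg.contDiffOn.continuousOn_iteratedDerivWithin (m := j) (by exact_mod_cast hj) ud
  have bd : ∀ {x y c : ℝ}, |x| ≤ c → |y| ≤ c → |x - y| ≤ 2 * c := by
    intro x y c hx hy
    have := abs_le.1 hx; have := abs_le.1 hy
    exact abs_le.2 ⟨by linarith, by linarith⟩
  obtain ⟨I1, I2⟩ := H (a := a) (b := b) (E := fun u => cdfOf g₁ u - cdfOf g₂ u)
    (h := fun u => g₁ u - g₂ u)
    (h1 := fun u => iteratedDerivWithin 1 g₁ (Icc a b) u - iteratedDerivWithin 1 g₂ (Icc a b) u)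
    (h2 := fun u => iteratedDerivWithin 2 g₁ (Icc a b) u - iteratedDerivWithin 2 g₂ (Icc a b) u)
    h₁.le_sub h₁.sub_le (h₁.continuous_cdf.sub h₂.continuous_cdf).continuousOn
    (h₁.contDiffOn.continuousOn.sub h₂.contDiffOn.continuousOn)
    ((cc h₁ 1 (by norm_num)).sub (cc h₂ 1 (by norm_num)))
    ((cc h₁ 2 le_rfl).sub (cc h₂ 2 le_rfl))
    (fun x hx => (h₁.hasDerivAt_cdf hx).sub (h₂.hasDerivAt_cdf hx))
    (fun x hx => by simpa using (cd h₁ 0 (by norm_num) x hx).fun_sub (cd h₂ 0 (by norm_num) x hx))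
    (fun x hx => (cd h₁ 1 (by norm_num) x hx).sub (cd h₂ 1 (by norm_num) x hx))
    (fun x hx => bd (by rw [abs_of_nonneg (h₁.nonneg x)]; exact h₁.le x)
      (by rw [abs_of_nonneg (h₂.nonneg x)]; exact h₂.le x))
    (fun x hx => bd (h₁.deriv_le x hx) (h₂.deriv_le x hx))
    (fun x hx => bd (h₁.deriv2_le x hx) (h₂.deriv2_le x hx))
    (by simp [h₁.cdf_of_le le_rfl, h₂.cdf_of_le le_rfl])
    (by simp [h₁.cdf_of_ge le_rfl, h₂.cdf_of_ge le_rfl])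
  set A := ∫ x in a..b, (g₁ x - g₂ x) ^ 2
  set B := ∫ x in a..b, (cdfOf g₁ x - cdfOf g₂ x) ^ 2
  have A0 : 0 ≤ A := intervalIntegral.integral_nonneg h₁.lt.le fun _ _ => sq_nonneg _
  have B0 : 0 ≤ B := intervalIntegral.integral_nonneg h₁.lt.le fun _ _ => sq_nonneg _
  refine ⟨?_, fun u hu => (I2 u hu).trans (mul_le_mul_of_nonneg_right (le_max_left _ _) A0)⟩
  set W := ∫⁻ s in Icc (0 : ℝ) 1, ‖quantile g₁ s - quantile g₂ s‖ₑ ^ 2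
  have hB : ENNReal.ofReal B ≤ ENNReal.ofReal (M ^ 3) * W := integral_cdf_sub_sq_le h₁ h₂
  have hA : A ≤ (C * B ^ 4) ^ (1 / 7 : ℝ) := by
    calc A = (A ^ 7) ^ (1 / 7 : ℝ) := by
          rw [← Real.rpow_natCast, ← Real.rpow_mul A0]; norm_num
      _ ≤ _ := Real.rpow_le_rpow (by positivity) I1 (by norm_num)
  rw [lintegral_density_sub_sq h₁ h₂]
  calc ENNReal.ofReal A ≤ ENNReal.ofReal ((C * B ^ 4) ^ (1 / 7 : ℝ)) :=
        ENNReal.ofReal_le_ofReal hA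
    _ = (ENNReal.ofReal C * ENNReal.ofReal B ^ 4) ^ (1 / 7 : ℝ) := by
        rw [← ENNReal.ofReal_rpow_of_nonneg (by positivity) (by norm_num),
          ENNReal.ofReal_mul hC, ENNReal.ofReal_pow B0]
    _ ≤ (ENNReal.ofReal C * (ENNReal.ofReal (M ^ 3) * W) ^ 4) ^ (1 / 7 : ℝ) := by gcongr
    _ = ENNReal.ofReal ((C * (M ^ 3) ^ 4) ^ (1 / 7 : ℝ)) * W ^ (4 / 7 : ℝ) := by
        rw [mul_pow, ← mul_assoc, ENNReal.mul_rpow_of_nonneg _ _ (by norm_num),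
          ← ENNReal.ofReal_pow (by positivity), ← ENNReal.ofReal_mul hC,
          ENNReal.ofReal_rpow_of_nonneg (by positivity) (by norm_num), ← ENNReal.rpow_natCast,
          ← ENNReal.rpow_mul]
        norm_num
    _ ≤ _ := by gcongr; exact le_max_right _ _

/-- A density is determined by its quantile function. -/
theorem IsSmoothDensity.eq_of_quantile_eq {R M L a b a' b' : ℝ} {g g' : ℝ → ℝ}
    (h : IsSmoothDensity R M L a b g) (h' : IsSmoothDensity R M L a' b' g')
    (hq : quantile g = quantile g') : g = g' := by
  have img : ∀ {a b : ℝ} {g : ℝ → ℝ}, IsSmoothDensity R M L a b g →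
      quantile g '' Ioc 0 1 = Ioc a b := by
    intro a b g h
    refine Subset.antisymm (image_subset_iff.2 fun s hs => (h.quantile_spec hs).1) fun u hu => ?_
    exact ⟨_, h.cdf_pos hu, h.quantile_cdf hu⟩
  have e : Ioc a b = Ioc a' b' := by rw [← img h, hq, img h']
  obtain rfl : a = a' := by rw [← csInf_Ioc h.lt, e, csInf_Ioc h'.lt]
  obtain rfl : b = b' := by rw [← csSup_Ioc h.lt, e, csSup_Ioc h'.lt]
  obtain ⟨C, hC, H⟩ := exists_density_le_quantile_const R M L h.M_pos
  obtain ⟨H1, H2⟩ := H h h'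
  rw [hq] at H1
  simp only [sub_self, enorm_zero, ne_eq, OfNat.ofNat_ne_zero, not_false_eq_true, zero_pow,
    lintegral_zero] at H1
  rw [ENNReal.zero_rpow_of_pos (by norm_num), mul_zero, lintegral_density_sub_sq h h',
    nonpos_iff_eq_zero, ENNReal.ofReal_eq_zero] at H1
  ext u
  by_cases hu : u ∈ Icc a b
  · have h4 : (g u - g' u) ^ 4 ≤ 0 :=
      (H2 u hu).trans (mul_nonpos_of_nonneg_of_nonpos hC H1)
    have : (g u - g' u) ^ 4 = 0 := le_antisymm h4 (by positivity)
    exact sub_eq_zero.1 (pow_eq_zero_iff (by norm_num) |>.1 this)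
  · rw [h.eq_zero hu, h'.eq_zero hu]

end Comparison

/-! ### Density slices and quantile slices -/

section JointMeasurability

variable {Θ : Type*} [MeasurableSpace Θ] {R M L : ℝ} {l : Θ → ℝ → ℝ}

theorem measurable_cdfOf (hl : Measurable (Function.uncurry l)) :
    Measurable fun z : Θ × ℝ => cdfOf (l z.1) z.2 := by
  have : (fun z : Θ × ℝ => cdfOf (l z.1) z.2) =
      fun z => ∫ t, {w : (Θ × ℝ) × ℝ | w.2 ≤ w.1.2}.indicator
        (fun w => l w.1.1 w.2) (z, t) := by
    ext z
    rw [cdfOf, ← integral_indicator measurableSet_Iic]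
    rfl
  rw [this]
  refine StronglyMeasurable.measurable (StronglyMeasurable.integral_prod_right' (ν := volume)
    (f := {w : (Θ × ℝ) × ℝ | w.2 ≤ w.1.2}.indicator (fun w => l w.1.1 w.2)) ?_)
  refine (Measurable.indicator ?_ ?_).stronglyMeasurable
  · exact hl.comp (f := fun w : (Θ × ℝ) × ℝ => (w.1.1, w.2)) (by fun_prop)
  · exact measurableSet_le (by fun_prop) (by fun_prop)

theorem measurable_quantile (hs : ∀ θ, ∃ a b, IsSmoothDensity R M L a b (l θ))
    (hl : Measurable (Function.uncurry l)) :
    Measurable (Function.uncurry fun θ => quantile (l θ)) := by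
  refine measurable_of_Iic fun u => ?_
  have : Function.uncurry (fun θ => quantile (l θ)) ⁻¹' Iic u =
      ({z | z.2 ∈ Ioc (0 : ℝ) 1} ∩ {z | z.2 ≤ cdfOf (l z.1) u}) ∪
        ({z | z.2 ∉ Ioc (0 : ℝ) 1} ∩ {_z | 0 ≤ u}) := by
    ext ⟨θ, s⟩
    obtain ⟨a, b, h⟩ := hs θ
    by_cases hs' : s ∈ Ioc (0 : ℝ) 1
    · have h1 := h.quantile_le_iff hs' (u := u)
      simp only [mem_preimage, Function.uncurry_apply_pair, mem_Iic, h1, mem_union, mem_inter_iff,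
        mem_ofPred_eq, hs', true_and, not_true_eq_false, false_and, or_false]
    · have h1 := h.quantile_of_notMem hs'
      simp only [mem_preimage, Function.uncurry_apply_pair, mem_Iic, h1, mem_union, mem_inter_iff,
        mem_ofPred_eq, hs', true_and, false_and, false_or, not_false_eq_true]
  rw [this]
  have m1 : MeasurableSet {z : Θ × ℝ | z.2 ∈ Ioc (0 : ℝ) 1} := measurable_snd measurableSet_Ioc
  refine (m1.inter (measurableSet_le measurable_snd ?_)).union (m1.compl.inter (.const _))
  exact (measurable_cdfOf hl).comp (f := fun z : Θ × ℝ => (z.1, u)) (by fun_prop)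

/-- Densities depend measurably on the parameter if their quantile functions do: the distribution
function is a section of a measurable set of quantiles, and the density is a limit of its difference
quotients. -/
theorem measurable_of_measurable_quantile (hs : ∀ θ, ∃ a b, IsSmoothDensity R M L a b (l θ))
    (hq : Measurable (Function.uncurry fun θ => quantile (l θ))) :
    Measurable (Function.uncurry l) := by
  have mc : Measurable fun z : Θ × ℝ => cdfOf (l z.1) z.2 := by
    have : (fun z : Θ × ℝ => cdfOf (l z.1) z.2) = fun z =>
        (volume.restrict (Ioc (0 : ℝ) 1) (Prod.mk z ⁻¹'
          {w : (Θ × ℝ) × ℝ | quantile (l w.1.1) w.2 ≤ w.1.2})).toReal := by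
      ext z
      obtain ⟨a, b, h⟩ := hs z.1
      exact h.cdf_eq_volume z.2
    rw [this]
    refine (measurable_measure_prodMk_left (measurableSet_le ?_ (by fun_prop))).ennreal_toReal
    exact hq.comp (f := fun w : (Θ × ℝ) × ℝ => (w.1.1, w.2)) (by fun_prop)
  refine measurable_of_tendsto_metrizable (f := fun (n : ℕ) (z : Θ × ℝ) =>
    max (slope (cdfOf (l z.1)) z.2 (z.2 + 1 / ((n : ℝ) + 1)))
      (slope (cdfOf (l z.1)) z.2 (z.2 - 1 / ((n : ℝ) + 1)))) (fun n => ?_)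
    (tendsto_pi_nhds.2 fun z => ?_)
  · have key : ∀ c : ℝ, Measurable fun z : Θ × ℝ => slope (cdfOf (l z.1)) z.2 (z.2 + c) := by
      intro c
      simp only [slope_def_field]
      refine Measurable.div (Measurable.sub ?_ mc) (by fun_prop)
      exact mc.comp (f := fun z : Θ × ℝ => (z.1, z.2 + c)) (by fun_prop)
    simp only [sub_eq_add_neg]
    exact (key _).max (key _)
  · obtain ⟨a, b, h⟩ := hs z.1
    exact h.tendsto_max_slope z.2

end JointMeasurability

instance isFiniteMeasure_surf (p : ℕ) : IsFiniteMeasure (surf p) := by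
  unfold surf; infer_instance

/-- The measure on `Θ × [0, 1]` whose `L²` distance is the slicing Wasserstein distance. -/
abbrev quantMeasure (p : ℕ) : Measure (Sph p × ℝ) :=
  (surf p).prod (volume.restrict (Icc (0 : ℝ) 1))

theorem eLpNorm_two_sq {α : Type*} [MeasurableSpace α] (μ : Measure α) (f : α → ℝ) :
    eLpNorm f 2 μ ^ 2 = ∫⁻ x, ‖f x‖ₑ ^ 2 ∂μ := by
  have := eLpNorm_nnreal_pow_eq_lintegral (μ := μ) (f := f) (p := 2) (by norm_num)
  simpa using this

theorem wassDist_sq {p : ℕ} {γ₁ γ₂ : Sph p → ℝ → ℝ} (h₁ : Measurable (Function.uncurry γ₁))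
    (h₂ : Measurable (Function.uncurry γ₂)) :
    wassDist γ₁ γ₂ ^ 2 =
      ∫⁻ θ, (∫⁻ s in Icc (0 : ℝ) 1, ‖γ₁ θ s - γ₂ θ s‖ₑ ^ 2) ∂surf p := by
  rw [wassDist, eLpNorm_two_sq, lintegral_prod]
  exact ((h₁.sub h₂).enorm.pow_const 2).aemeasurable

theorem sliceDist_sq {p : ℕ} {l₁ l₂ : Sph p → ℝ → ℝ} (h₁ : Measurable (Function.uncurry l₁))
    (h₂ : Measurable (Function.uncurry l₂)) :
    sliceDist l₁ l₂ ^ 2 = ∫⁻ θ, (∫⁻ u, ‖l₁ θ u - l₂ θ u‖ₑ ^ 2) ∂surf p := by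
  rw [sliceDist, eLpNorm_two_sq, lintegral_prod]
  exact ((h₁.sub h₂).enorm.pow_const 2).aemeasurable

section Slices

variable {p : ℕ} {R M L : ℝ} {𝒢 : Set (ℝ → ℝ)} {I : Sph p → Set ℝ}

theorem toQuantiles_mem (hR : 0 < R) (h𝒢 : ∀ g ∈ 𝒢, ∃ a b, IsSmoothDensity R M L a b g)
    {l : Sph p → ℝ → ℝ} (hl : l ∈ densitySlices 𝒢 I) : toQuantiles l ∈ quantileSlices 𝒢 I := by
  have hs : ∀ θ, ∃ a b, IsSmoothDensity R M L a b (l θ) := fun θ => h𝒢 _ (hl.1 θ).1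
  have hm := measurable_quantile hs hl.2.1
  refine ⟨fun θ => ⟨l θ, (hl.1 θ).1, (hl.1 θ).2, rfl⟩, hm, ?_⟩
  refine MemLp.of_bound hm.aestronglyMeasurable R (.of_forall fun z => ?_)
  obtain ⟨a, b, h⟩ := hs z.1
  exact h.abs_quantile_le hR.le z.2

/-- `toDensities` inverts `toQuantiles`, as densities in `𝒢` are determined by their quantile
functions. -/
theorem toDensities_spec (h𝒢 : ∀ g ∈ 𝒢, ∃ a b, IsSmoothDensity R M L a b g)
    {γ : Sph p → ℝ → ℝ} (hγ : γ ∈ quantileSlices 𝒢 I) :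
    toDensities 𝒢 γ ∈ densitySlices 𝒢 I ∧ toQuantiles (toDensities 𝒢 γ) = γ := by
  have inv : ∀ θ, toDensities 𝒢 γ θ ∈ 𝒢 ∧ Function.support (toDensities 𝒢 γ θ) = I θ ∧
      quantile (toDensities 𝒢 γ θ) = γ θ := by
    intro θ
    obtain ⟨g, hg, hs, he⟩ := hγ.1 θ
    have ex : ∃ g ∈ 𝒢, quantile g = γ θ := ⟨g, hg, he.symm⟩
    have h1 : toDensities 𝒢 γ θ ∈ 𝒢 := Function.invFunOn_mem ex
    have h2 : quantile (toDensities 𝒢 γ θ) = γ θ := Function.invFunOn_eq ex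
    obtain ⟨a, b, hab⟩ := h𝒢 _ hg
    obtain ⟨a', b', hab'⟩ := h𝒢 _ h1
    have : toDensities 𝒢 γ θ = g := hab'.eq_of_quantile_eq hab (h2.trans he)
    exact ⟨h1, by rw [this, hs], h2⟩
  have hq : toQuantiles (toDensities 𝒢 γ) = γ := funext fun θ => (inv θ).2.2
  have hs : ∀ θ, ∃ a b, IsSmoothDensity R M L a b (toDensities 𝒢 γ θ) :=
    fun θ => h𝒢 _ (inv θ).1
  have hm : Measurable (Function.uncurry (toDensities 𝒢 γ)) := by
    refine measurable_of_measurable_quantile hs ?_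
    have : (fun θ => quantile (toDensities 𝒢 γ θ)) = γ := hq
    rw [this]
    exact hγ.2.1
  refine ⟨⟨fun θ => ⟨(inv θ).1, (inv θ).2.1⟩, hm, ?_⟩, hq⟩
  -- the map is bounded by `M` and vanishes off `Θ × [-R, R]`, a set of finite measure
  have hset : MeasurableSet (univ ×ˢ Icc (-R) R : Set (Sph p × ℝ)) :=
    MeasurableSet.univ.prod measurableSet_Icc
  have hind : Function.uncurry (toDensities 𝒢 γ) =
      (univ ×ˢ Icc (-R) R : Set (Sph p × ℝ)).indicator (Function.uncurry (toDensities 𝒢 γ)) := by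
    refine (indicator_eq_self.2 fun z hz => ?_).symm
    obtain ⟨a, b, h⟩ := hs z.1
    refine ⟨trivial, ?_⟩
    by_contra hc
    exact hz (h.eq_zero fun h' => hc (h.subset h'))
  rw [hind, memLp_indicator_iff_restrict hset]
  have : IsFiniteMeasure (((surf p).prod volume).restrict
      (univ ×ˢ Icc (-R) R : Set (Sph p × ℝ))) := by
    refine ⟨?_⟩
    rw [Measure.restrict_apply_univ, Measure.prod_prod]
    exact ENNReal.mul_lt_top (measure_lt_top _ _) (by simp)
  refine MemLp.of_bound hm.aestronglyMeasurable M (.of_forall fun z => ?_)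
  obtain ⟨a, b, h⟩ := hs z.1
  rw [Real.norm_eq_abs, Function.uncurry, abs_of_nonneg (h.nonneg _)]
  exact h.le _

/-- Hölder's inequality with exponents `7/4` and `7/3`. -/
theorem lintegral_rpow_le {α : Type*} [MeasurableSpace α] (μ : Measure α) {W : α → ℝ≥0∞}
    (hW : AEMeasurable W μ) :
    ∫⁻ θ, W θ ^ (4 / 7 : ℝ) ∂μ ≤ (∫⁻ θ, W θ ∂μ) ^ (4 / 7 : ℝ) * μ univ ^ (3 / 7 : ℝ) := by
  have := ENNReal.lintegral_mul_le_Lp_mul_Lq μ (p := 7 / 4) (q := 7 / 3)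
    (by constructor <;> norm_num) (hW.pow_const (4 / 7 : ℝ)) (aemeasurable_const (b := (1 : ℝ≥0∞)))
  simpa [← ENNReal.rpow_mul] using this

/-- The distance of two density slices with common supports is at most a multiple of the power
`4/7` of the Wasserstein distance. -/
theorem exists_sliceDist_le (h𝒢 : ∀ g ∈ 𝒢, ∃ a b, IsSmoothDensity R M L a b g) (hM : 0 < M)
    (I : Sph p → Set ℝ) :
    ∃ C : ℝ≥0, ∀ l₁ ∈ densitySlices 𝒢 I, ∀ l₂ ∈ densitySlices 𝒢 I,
      sliceDist l₁ l₂ ≤ C * wassDist (toQuantiles l₁) (toQuantiles l₂) ^ (4 / 7 : ℝ) := by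
  obtain ⟨C, hC, H⟩ := exists_density_le_quantile_const R M L hM
  set K : ℝ≥0∞ := (ENNReal.ofReal C * surf p univ ^ (3 / 7 : ℝ)) ^ (1 / 2 : ℝ) with hK
  have hKtop : K ≠ ∞ := by
    refine ENNReal.rpow_ne_top_of_nonneg (by norm_num) (ENNReal.mul_ne_top (by simp) ?_)
    exact ENNReal.rpow_ne_top_of_nonneg (by norm_num) (measure_ne_top _ _)
  refine ⟨K.toNNReal, fun l₁ hl₁ l₂ hl₂ => ?_⟩
  rw [ENNReal.coe_toNNReal hKtop]
  have m₁ : Measurable (Function.uncurry (toQuantiles l₁)) :=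
    measurable_quantile (fun θ => h𝒢 _ (hl₁.1 θ).1) hl₁.2.1
  have m₂ : Measurable (Function.uncurry (toQuantiles l₂)) :=
    measurable_quantile (fun θ => h𝒢 _ (hl₂.1 θ).1) hl₂.2.1
  have hle : sliceDist l₁ l₂ ^ 2 ≤ ENNReal.ofReal C *
      ((wassDist (toQuantiles l₁) (toQuantiles l₂) ^ 2) ^ (4 / 7 : ℝ) *
        surf p univ ^ (3 / 7 : ℝ)) := by
    rw [sliceDist_sq hl₁.2.1 hl₂.2.1, wassDist_sq m₁ m₂]
    refine le_trans ?_ (mul_le_mul_right (lintegral_rpow_le _ ?_) _)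
    · rw [← lintegral_const_mul' _ _ ENNReal.ofReal_ne_top]
      refine lintegral_mono fun θ => ?_
      obtain ⟨a, b, h₁⟩ := h𝒢 _ (hl₁.1 θ).1
      obtain ⟨a', b', h₂⟩ := h𝒢 _ (hl₂.1 θ).1
      have e : Icc a b = Icc a' b' := by
        rw [← h₁.support_eq, ← h₂.support_eq, (hl₁.1 θ).2, (hl₂.1 θ).2]
      obtain ⟨rfl, rfl⟩ := (Icc_eq_Icc_iff h₁.lt.le).1 e
      exact (H h₁ h₂).1
    · exact (((m₁.sub m₂).enorm.pow_const 2).lintegral_prod_right').aemeasurable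
  calc sliceDist l₁ l₂ = (sliceDist l₁ l₂ ^ 2) ^ (1 / 2 : ℝ) := by
        rw [← ENNReal.rpow_natCast, ← ENNReal.rpow_mul]; norm_num
    _ ≤ _ := ENNReal.rpow_le_rpow hle (by norm_num)
    _ = K * wassDist (toQuantiles l₁) (toQuantiles l₂) ^ (4 / 7 : ℝ) := by
        rw [mul_left_comm, mul_comm, ENNReal.mul_rpow_of_nonneg _ _ (by norm_num), ← hK,
          ← ENNReal.rpow_natCast, ← ENNReal.rpow_mul, ← ENNReal.rpow_mul]
        norm_num

/-- The map from densities to quantile slices is Lipschitz for the `L²` distance. -/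
theorem exists_wassDist_le {D : Set (Euc p)} {F : Set (Euc p → ℝ)}
    {ψ : (Euc p → ℝ) → Sph p → ℝ → ℝ} {ψinv : ℝ → (Sph p → ℝ → ℝ) → Euc p → ℝ}
    {C₁ C₂ δ : ℝ → ℝ} (hψ : IsSlicingTransform D F 𝒢 I ψ ψinv C₁ C₂ δ)
    (h𝒢 : ∀ g ∈ 𝒢, ∃ a b, IsSmoothDensity R M L a b g) :
    ∃ C : ℝ≥0, ∀ f₁ ∈ F, ∀ f₂ ∈ F,
      wassDist (toQuantiles (ψ f₁)) (toQuantiles (ψ f₂)) ≤ C * l2Dist f₁ f₂ := by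
  obtain ⟨C₀, hC₀⟩ := hψ.lipschitz
  set K : ℝ≥0∞ := (ENNReal.ofReal (M ^ 2 * (2 * R)) * surf p univ) ^ (1 / 2 : ℝ) * C₀ with hK
  have hKtop : K ≠ ∞ := by
    refine ENNReal.mul_ne_top (ENNReal.rpow_ne_top_of_nonneg (by norm_num)
      (ENNReal.mul_ne_top (by simp) (measure_ne_top _ _))) (by simp)
  refine ⟨K.toNNReal, fun f₁ hf₁ f₂ hf₂ => ?_⟩
  rw [ENNReal.coe_toNNReal hKtop]
  have d₁ := hψ.maps_to f₁ hf₁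
  have d₂ := hψ.maps_to f₂ hf₂
  have m₁ : Measurable (Function.uncurry (toQuantiles (ψ f₁))) :=
    measurable_quantile (fun θ => h𝒢 _ (d₁.1 θ).1) d₁.2.1
  have m₂ : Measurable (Function.uncurry (toQuantiles (ψ f₂))) :=
    measurable_quantile (fun θ => h𝒢 _ (d₂.1 θ).1) d₂.2.1
  have hle : wassDist (toQuantiles (ψ f₁)) (toQuantiles (ψ f₂)) ^ 2 ≤
      ENNReal.ofReal (M ^ 2 * (2 * R)) * surf p univ * (C₀ * l2Dist f₁ f₂) ^ 2 := by
    rw [wassDist_sq m₁ m₂]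
    have pt : ∀ θ, ∫⁻ s in Icc (0 : ℝ) 1, ‖toQuantiles (ψ f₁) θ s - toQuantiles (ψ f₂) θ s‖ₑ ^ 2 ≤
        ENNReal.ofReal (M ^ 2 * (2 * R)) * (C₀ * l2Dist f₁ f₂) ^ 2 := by
      intro θ
      obtain ⟨a, b, h₁⟩ := h𝒢 _ (d₁.1 θ).1
      obtain ⟨a', b', h₂⟩ := h𝒢 _ (d₂.1 θ).1
      have e : Icc a b = Icc a' b' := by
        rw [← h₁.support_eq, ← h₂.support_eq, (d₁.1 θ).2, (d₂.1 θ).2]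
      obtain ⟨rfl, rfl⟩ := (Icc_eq_Icc_iff h₁.lt.le).1 e
      refine (lintegral_mono fun s => enorm_quantile_sub_sq_le h₁ h₂ s).trans ?_
      rw [lintegral_const, Measure.restrict_apply_univ, Real.volume_Icc, sub_zero,
        ENNReal.ofReal_one, mul_one]
      gcongr
      rw [← eLpNorm_two_sq volume fun u => ψ f₁ θ u - ψ f₂ θ u]
      gcongr
      exact hC₀ f₁ hf₁ f₂ hf₂ θ
    refine (lintegral_mono pt).trans (le_of_eq ?_)
    rw [lintegral_const]
    ring
  calc wassDist (toQuantiles (ψ f₁)) (toQuantiles (ψ f₂))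
      = (wassDist (toQuantiles (ψ f₁)) (toQuantiles (ψ f₂)) ^ 2) ^ (1 / 2 : ℝ) := by
        rw [← ENNReal.rpow_natCast, ← ENNReal.rpow_mul]; norm_num
    _ ≤ _ := ENNReal.rpow_le_rpow hle (by norm_num)
    _ = K * l2Dist f₁ f₂ := by
        rw [ENNReal.mul_rpow_of_nonneg _ _ (by norm_num), ← ENNReal.rpow_natCast (_ * _),
          ← ENNReal.rpow_mul, hK]
        norm_num
        ring

end Slices

/-! ### Minimizers as metric projections in a Hilbert space -/

section Hilbert

variable {p : ℕ}

/-- The Hilbert space `L²(Θ × [0, 1])` that contains the quantile slices. -/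
abbrev QSpace (p : ℕ) := Lp ℝ 2 (quantMeasure p)

open Classical in
/-- The class of `γ` in `L²(Θ × [0, 1])`, and `0` if `γ` is not square integrable. -/
def cls (γ : Sph p → ℝ → ℝ) : QSpace p :=
  if h : MemLp (Function.uncurry γ) 2 (quantMeasure p) then h.toLp else 0

theorem coeFn_cls {γ : Sph p → ℝ → ℝ} (h : MemLp (Function.uncurry γ) 2 (quantMeasure p)) :
    cls γ =ᵐ[quantMeasure p] Function.uncurry γ := by
  rw [cls, dif_pos h]
  exact h.coeFn_toLp

theorem wassDist_eq {γ₁ γ₂ : Sph p → ℝ → ℝ}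
    (h₁ : MemLp (Function.uncurry γ₁) 2 (quantMeasure p))
    (h₂ : MemLp (Function.uncurry γ₂) 2 (quantMeasure p)) :
    wassDist γ₁ γ₂ = ‖cls γ₁ - cls γ₂‖ₑ := by
  rw [cls, cls, dif_pos h₁, dif_pos h₂, ← MemLp.toLp_sub, Lp.enorm_toLp]
  rfl

theorem wassDist_toReal {γ₁ γ₂ : Sph p → ℝ → ℝ}
    (h₁ : MemLp (Function.uncurry γ₁) 2 (quantMeasure p))
    (h₂ : MemLp (Function.uncurry γ₂) 2 (quantMeasure p)) :
    (wassDist γ₁ γ₂).toReal = ‖cls γ₁ - cls γ₂‖ := by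
  rw [wassDist_eq h₁ h₂, toReal_enorm]

variable {S : Set (Sph p → ℝ → ℝ)}

theorem convex_cls_image
    (hmem : ∀ γ ∈ S, MemLp (Function.uncurry γ) 2 (quantMeasure p)) (hS : Convex ℝ S) :
    Convex ℝ (cls '' S) := by
  rintro _ ⟨γ₁, h₁, rfl⟩ _ ⟨γ₂, h₂, rfl⟩ a b ha hb hab
  refine ⟨a • γ₁ + b • γ₂, hS h₁ h₂ ha hb hab, ?_⟩
  have m := hmem _ (hS h₁ h₂ ha hb hab)
  have m₁ := hmem _ h₁
  have m₂ := hmem _ h₂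
  rw [cls, cls, cls, dif_pos m₁, dif_pos m₂, dif_pos m, ← MemLp.toLp_const_smul,
    ← MemLp.toLp_const_smul, ← MemLp.toLp_add]
  rfl

theorem isClosed_cls_image
    (hmem : ∀ γ ∈ S, MemLp (Function.uncurry γ) 2 (quantMeasure p)) (hS : IsClosedSlices S) :
    IsClosed (cls '' S) := by
  refine IsSeqClosed.isClosed fun v y hv hy => ?_
  choose γ hγ he using hv
  have sm : StronglyMeasurable (y : Sph p × ℝ → ℝ) := Lp.stronglyMeasurable y
  set γ' : Sph p → ℝ → ℝ := Function.curry y with hγ'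
  have hu : Function.uncurry γ' = y := Function.uncurry_curry _
  have mem' : MemLp (Function.uncurry γ') 2 (quantMeasure p) := by rw [hu]; exact Lp.memLp y
  have cy : cls γ' = y := by
    rw [cls, dif_pos mem']
    refine Lp.ext (mem'.coeFn_toLp.trans ?_)
    rw [hu]
  have lim : Tendsto (fun n => wassDist (γ n) γ') atTop (𝓝 0) := by
    have : ∀ n, wassDist (γ n) γ' = edist (v n) y := fun n => by
      rw [wassDist_eq (hmem _ (hγ n)) mem', he, cy, edist_eq_enorm_sub]
    simp_rw [this]
    exact tendsto_iff_edist_tendsto_0.1 hy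
  obtain ⟨γ'', h'', h0⟩ := hS γ γ' hγ (by rw [hu]; exact sm.measurable) lim
  refine ⟨γ'', h'', ?_⟩
  rw [wassDist_eq (hmem _ h'') mem', cy, enorm_eq_zero, sub_eq_zero] at h0
  exact h0

/-- The variational inequality for a minimizer of the distance to `u`. -/
theorem IsArgmin.inner_le_zero
    (hmem : ∀ γ ∈ S, MemLp (Function.uncurry γ) 2 (quantMeasure p)) (hS : Convex ℝ S)
    {M : (Sph p → ℝ → ℝ) → ℝ} {u : QSpace p} {c : ℝ}
    (hM : ∀ γ ∈ S, M γ = ‖cls γ - u‖ ^ 2 + c) {γ : Sph p → ℝ → ℝ} (hγ : IsArgmin S M γ) :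
    ∀ w ∈ cls '' S, inner ℝ (u - cls γ) (w - cls γ) ≤ 0 := by
  refine (norm_eq_iInf_iff_real_inner_le_zero (convex_cls_image hmem hS) ⟨γ, hγ.1, rfl⟩).1 ?_
  have : Nonempty (cls '' S) := ⟨_, γ, hγ.1, rfl⟩
  refine le_antisymm (le_ciInf ?_) ?_
  · rintro ⟨_, γ', h', rfl⟩
    have := hγ.2 h'
    simp only [mem_ofPred_eq] at this
    rw [hM _ hγ.1, hM _ h'] at this
    rw [norm_sub_rev, norm_sub_rev u]
    exact (sq_le_sq₀ (norm_nonneg _) (norm_nonneg _)).1 (by linarith)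
  · exact ciInf_le (f := fun w : cls '' S => ‖u - w‖) ⟨0, by rintro _ ⟨w, rfl⟩; positivity⟩
      ⟨_, γ, hγ.1, rfl⟩

/-- Metric projections to a convex set are nonexpansive. -/
theorem IsArgmin.wassDist_le
    (hmem : ∀ γ ∈ S, MemLp (Function.uncurry γ) 2 (quantMeasure p)) (hS : Convex ℝ S)
    {M₁ M₂ : (Sph p → ℝ → ℝ) → ℝ} {u₁ u₂ : QSpace p} {c₁ c₂ : ℝ}
    (hM₁ : ∀ γ ∈ S, M₁ γ = ‖cls γ - u₁‖ ^ 2 + c₁) (hM₂ : ∀ γ ∈ S, M₂ γ = ‖cls γ - u₂‖ ^ 2 + c₂)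
    {γ₁ γ₂ : Sph p → ℝ → ℝ} (h₁ : IsArgmin S M₁ γ₁) (h₂ : IsArgmin S M₂ γ₂) :
    wassDist γ₁ γ₂ ≤ ‖u₁ - u₂‖ₑ := by
  rw [wassDist_eq (hmem _ h₁.1) (hmem _ h₂.1), ← ofReal_norm, ← ofReal_norm]
  apply ENNReal.ofReal_le_ofReal
  have i₁ := h₁.inner_le_zero hmem hS hM₁ _ ⟨γ₂, h₂.1, rfl⟩
  have i₂ := h₂.inner_le_zero hmem hS hM₂ _ ⟨γ₁, h₁.1, rfl⟩
  set v₁ := cls γ₁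
  set v₂ := cls γ₂
  have e : ‖v₁ - v₂‖ ^ 2 = inner ℝ (u₁ - u₂) (v₁ - v₂) + inner ℝ (u₁ - v₁) (v₂ - v₁)
      + inner ℝ (u₂ - v₂) (v₁ - v₂) := by
    rw [← real_inner_self_eq_norm_sq]
    simp only [inner_sub_left, inner_sub_right]
    ring
  have cs := real_inner_le_norm (u₁ - u₂) (v₁ - v₂)
  by_contra hc
  have hc := not_le.1 hc
  nlinarith [norm_nonneg (v₁ - v₂), norm_nonneg (u₁ - u₂)]

/-- The squared distance to a point has a minimizer over a closed convex set, which is unique. -/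
theorem hasUniqueArgmin
    (hmem : ∀ γ ∈ S, MemLp (Function.uncurry γ) 2 (quantMeasure p)) (hS : Convex ℝ S)
    (hcl : IsClosedSlices S) (hne : S.Nonempty)
    {M : (Sph p → ℝ → ℝ) → ℝ} {u : QSpace p} {c : ℝ}
    (hM : ∀ γ ∈ S, M γ = ‖cls γ - u‖ ^ 2 + c) : HasUniqueArgmin S M := by
  constructor
  · obtain ⟨_, ⟨γ, hγ, rfl⟩, hmin⟩ := exists_norm_eq_iInf_of_complete_convex (hne.image cls)
      (isClosed_cls_image hmem hcl).isComplete (convex_cls_image hmem hS) u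
    refine ⟨γ, hγ, fun γ' h' => ?_⟩
    simp only [mem_ofPred_eq]
    rw [hM _ hγ, hM _ h', norm_sub_rev, norm_sub_rev (cls γ')]
    have : ‖u - cls γ‖ ≤ ‖u - cls γ'‖ := by
      rw [hmin]
      exact ciInf_le (f := fun w : cls '' S => ‖u - w‖) ⟨0, by rintro _ ⟨w, rfl⟩; positivity⟩
        ⟨_, γ', h', rfl⟩
    gcongr
  · intro γ γ' h h'
    have := IsArgmin.wassDist_le hmem hS hM hM h h'
    rwa [sub_self, enorm_zero, nonpos_iff_eq_zero] at this

end Hilbert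

section Quadratic

variable {H : Type*} [NormedAddCommGroup H] [InnerProductSpace ℝ H]

/-- Completing the square. The weights may be negative, but they have mean one. -/
theorem mean_sq_dist_eq {n : ℕ} {w : ℕ → ℝ} (hw : (n : ℝ)⁻¹ * ∑ i ∈ Finset.range n, w i = 1)
    (Y : ℕ → H) : ∃ c : ℝ, ∀ v : H,
      (n : ℝ)⁻¹ * ∑ i ∈ Finset.range n, w i * ‖Y i - v‖ ^ 2 =
        ‖v - (n : ℝ)⁻¹ • ∑ i ∈ Finset.range n, w i • Y i‖ ^ 2 + c := by
  set u := (n : ℝ)⁻¹ • ∑ i ∈ Finset.range n, w i • Y i with hu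
  refine ⟨(n : ℝ)⁻¹ * ∑ i ∈ Finset.range n, w i * ‖Y i‖ ^ 2 - ‖u‖ ^ 2, fun v => ?_⟩
  have e : inner ℝ v u = (n : ℝ)⁻¹ * ∑ i ∈ Finset.range n, w i * inner ℝ v (Y i) := by
    simp only [hu, inner_smul_right, inner_sum]
  have : ∑ i ∈ Finset.range n, w i * ‖Y i - v‖ ^ 2 = ∑ i ∈ Finset.range n, w i * ‖Y i‖ ^ 2
      - 2 * ∑ i ∈ Finset.range n, w i * inner ℝ v (Y i)
      + (∑ i ∈ Finset.range n, w i) * ‖v‖ ^ 2 := by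
    rw [Finset.mul_sum, Finset.sum_mul, ← Finset.sum_sub_distrib, ← Finset.sum_add_distrib]
    refine Finset.sum_congr rfl fun i _ => ?_
    rw [norm_sub_sq_real, real_inner_comm]
    ring
  rw [this, norm_sub_sq_real, e]
  linear_combination ‖v‖ ^ 2 * hw

/-- Completing the square, for a random point. -/
theorem integral_sq_dist_eq [CompleteSpace H] {Ω : Type*} [MeasurableSpace Ω] {P : Measure Ω}
    {w : Ω → ℝ} {Y : Ω → H} (hw : Integrable w P) (hw1 : ∫ ω, w ω ∂P = 1)
    (hwY : Integrable (fun ω => w ω • Y ω) P)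
    (hwY2 : Integrable (fun ω => w ω * ‖Y ω‖ ^ 2) P) : ∃ c : ℝ, ∀ v : H,
      ∫ ω, w ω * ‖Y ω - v‖ ^ 2 ∂P = ‖v - ∫ ω, w ω • Y ω ∂P‖ ^ 2 + c := by
  set u := ∫ ω, w ω • Y ω ∂P with hu
  refine ⟨∫ ω, w ω * ‖Y ω‖ ^ 2 ∂P - ‖u‖ ^ 2, fun v => ?_⟩
  have e : ∫ ω, w ω * inner ℝ v (Y ω) ∂P = inner ℝ v u := by
    rw [hu, ← integral_inner hwY]
    simp only [inner_smul_right]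
  have hi : Integrable (fun ω => w ω * inner ℝ v (Y ω)) P := by
    have := hwY.const_inner (𝕜 := ℝ) v
    simpa only [inner_smul_right] using this
  have : ∀ ω, w ω * ‖Y ω - v‖ ^ 2 = w ω * ‖Y ω‖ ^ 2 - 2 * (w ω * inner ℝ v (Y ω))
      + w ω * ‖v‖ ^ 2 := by
    intro ω
    rw [norm_sub_sq_real, real_inner_comm]
    ring
  simp_rw [this]
  rw [integral_add (f := fun ω => w ω * ‖Y ω‖ ^ 2 - 2 * (w ω * inner ℝ v (Y ω)))
    (hwY2.sub (hi.const_mul 2)) (hw.mul_const _), integral_sub hwY2 (hi.const_mul 2),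
    integral_const_mul, integral_mul_const, e, hw1, norm_sub_sq_real]
  ring

end Quadratic

/-! ### Stochastic orders of magnitude -/

section BigOp

variable {Ω : Type*} [MeasurableSpace Ω] {P : Measure Ω}

/-- `V n = O_p(r n)` for real random variables (of interest for nonnegative ones), where `P` is
read as an outer probability. -/
def IsOp (P : Measure Ω) (V : ℕ → Ω → ℝ) (r : ℕ → ℝ) : Prop :=
  ∀ η : ℝ, 0 < η → ∃ M : ℝ, 0 < M ∧
    ∀ᶠ n in atTop, P {ω | M * r n < V n ω} ≤ ENNReal.ofReal η

variable {V W : ℕ → Ω → ℝ} {r s : ℕ → ℝ}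

theorem IsOp.mono (h : IsOp P W r) (hVW : ∀ᶠ n in atTop, ∀ ω, V n ω ≤ W n ω) : IsOp P V r := by
  intro η hη
  obtain ⟨M, hM, h⟩ := h η hη
  refine ⟨M, hM, ?_⟩
  filter_upwards [h, hVW] with n hn hn'
  exact (measure_mono fun ω hω => lt_of_lt_of_le hω (hn' ω)).trans hn

/-- The common pattern of the calculus of `O_p`: if `V n ≤ M₁ r n` and `W n ≤ M₂ s n` entail
`U n ≤ M₃ t n` for large `n`, with `M₃` depending on `M₁` and `M₂`, then `U = O_p(t)`. -/
theorem IsOp.combine (hV : IsOp P V r) (hW : IsOp P W s) {U : ℕ → Ω → ℝ} {t : ℕ → ℝ}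
    (H : ∀ M₁ M₂ : ℝ, 0 < M₁ → 0 < M₂ → ∃ M₃ : ℝ, 0 < M₃ ∧ ∀ᶠ n in atTop, ∀ ω,
      V n ω ≤ M₁ * r n → W n ω ≤ M₂ * s n → U n ω ≤ M₃ * t n) : IsOp P U t := by
  intro η hη
  obtain ⟨M₁, hM₁, h₁⟩ := hV (η / 2) (by positivity)
  obtain ⟨M₂, hM₂, h₂⟩ := hW (η / 2) (by positivity)
  obtain ⟨M₃, hM₃, h₃⟩ := H M₁ M₂ hM₁ hM₂
  refine ⟨M₃, hM₃, ?_⟩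
  filter_upwards [h₁, h₂, h₃] with n e₁ e₂ e₃
  have : {ω | M₃ * t n < U n ω} ⊆ {ω | M₁ * r n < V n ω} ∪ {ω | M₂ * s n < W n ω} := by
    intro ω hω
    by_contra hc
    simp only [mem_union, mem_ofPred_eq, not_or, not_lt] at hc
    exact absurd (e₃ ω hc.1 hc.2) (not_le.2 hω)
  calc P {ω | M₃ * t n < U n ω} ≤ _ := measure_mono this
    _ ≤ _ := measure_union_le _ _
    _ ≤ ENNReal.ofReal (η / 2) + ENNReal.ofReal (η / 2) := add_le_add e₁ e₂
    _ = ENNReal.ofReal η := by rw [← ENNReal.ofReal_add (by positivity) (by positivity)]; simp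

theorem IsOp.add (hV : IsOp P V r) (hW : IsOp P W r) :
    IsOp P (fun n ω => V n ω + W n ω) r :=
  hV.combine hW fun M₁ M₂ h₁ h₂ => ⟨M₁ + M₂, by positivity, .of_forall fun _ _ e₁ e₂ => by
    linarith⟩

theorem IsOp.mul (hV : IsOp P V r) (hW : IsOp P W s) (hr : ∀ n, 0 ≤ r n)
    (hW0 : ∀ n ω, 0 ≤ W n ω) :
    IsOp P (fun n ω => V n ω * W n ω) (fun n => r n * s n) :=
  hV.combine hW fun M₁ M₂ h₁ h₂ => ⟨M₁ * M₂, by positivity, .of_forall fun n ω e₁ e₂ => by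
    calc V n ω * W n ω ≤ (M₁ * r n) * (M₂ * s n) :=
          mul_le_mul e₁ e₂ (hW0 n ω) (mul_nonneg h₁.le (hr n))
      _ = _ := by ring⟩

theorem IsOp.const_mul (hV : IsOp P V r) (hr : ∀ n, 0 ≤ r n) {c : ℝ} (hc : 0 ≤ c) :
    IsOp P (fun n ω => c * V n ω) r :=
  hV.combine hV fun M₁ _ h₁ _ => ⟨c * M₁ + 1, by positivity, .of_forall fun n ω e₁ _ => by
    have := mul_le_mul_of_nonneg_left e₁ hc
    have := hr n
    nlinarith⟩

theorem isOp_const (hr : ∀ n, 0 ≤ r n) {c : ℝ} : IsOp P (fun n _ => c * r n) r := by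
  intro η _
  refine ⟨|c| + 1, by positivity, .of_forall fun n => ?_⟩
  have : {ω : Ω | (|c| + 1) * r n < c * r n} = ∅ := by
    refine eq_empty_of_forall_notMem fun ω hω => ?_
    rw [mem_ofPred_eq] at hω
    nlinarith [le_abs_self c, hr n]
  rw [this]; simp

theorem IsOp.sum {ι : Type*} (A : Finset ι) {V : ι → ℕ → Ω → ℝ}
    (hr : ∀ n, 0 ≤ r n) (hV : ∀ i ∈ A, IsOp P (V i) r) :
    IsOp P (fun n ω => ∑ i ∈ A, V i n ω) r := by
  classical
  induction A using Finset.induction_on with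
  | empty => simpa using isOp_const (P := P) hr (c := 0)
  | insert i A hi ih =>
    simp only [Finset.sum_insert hi]
    exact (hV i (Finset.mem_insert_self _ _)).add
      (ih fun j hj => hV j (Finset.mem_insert_of_mem hj))

theorem IsOp.rate_mono (hV : IsOp P V r) (hrs : ∀ᶠ n in atTop, r n ≤ s n) : IsOp P V s :=
  hV.combine hV fun M₁ _ h₁ _ => ⟨M₁, h₁, hrs.mono fun _ hn _ e _ =>
    e.trans (mul_le_mul_of_nonneg_left hn h₁.le)⟩

/-- A bound that holds locally, near zero, is enough if the rate tends to zero. -/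
theorem IsOp.of_local (hV : IsOp P V r) (hr0 : Tendsto r atTop (𝓝 0)) {ε C : ℝ} (hε : 0 < ε)
    (hr : ∀ n, 0 ≤ r n) (hVW : ∀ n ω, V n ω ≤ ε → W n ω ≤ C * V n ω) (hC : 0 ≤ C) :
    IsOp P W r :=
  hV.combine hV fun M₁ _ h₁ _ => ⟨C * M₁ + 1, by positivity, by
    have : Tendsto (fun n => M₁ * r n) atTop (𝓝 0) := by simpa using hr0.const_mul M₁
    filter_upwards [this.eventually (gt_mem_nhds hε)] with n hn ω e _
    have e1 := hVW n ω (e.trans hn.le)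
    have e2 := mul_le_mul_of_nonneg_left e hC
    have := hr n
    nlinarith⟩

theorem IsOp.sqrt (hV : IsOp P (fun n ω => V n ω ^ 2) (fun n => r n ^ 2)) (hr : ∀ n, 0 ≤ r n) :
    IsOp P V r :=
  hV.combine hV fun M₁ _ h₁ _ => ⟨√M₁, Real.sqrt_pos.2 h₁, .of_forall fun n ω e _ => by
    refine (abs_le_of_sq_le_sq' ?_ (mul_nonneg (Real.sqrt_nonneg _) (hr n))).2
    rw [mul_pow, Real.sq_sqrt h₁.le]
    exact e⟩

/-- Markov's inequality. -/
theorem IsOp.of_lintegral_le {U : ℕ → Ω → ℝ≥0∞} (hU : ∀ n, AEMeasurable (U n) P) {C : ℝ}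
    (hr : ∀ᶠ n in atTop, 0 < r n)
    (hint : ∀ᶠ n in atTop, ∫⁻ ω, U n ω ∂P ≤ ENNReal.ofReal (C * r n))
    (hV : ∀ᶠ n in atTop, ∀ ω, ENNReal.ofReal (V n ω) ≤ U n ω) : IsOp P V r := by
  intro η hη
  refine ⟨(|C| + 1) / η, by positivity, ?_⟩
  filter_upwards [hr, hint, hV] with n hr hint hV
  have ht : 0 < (|C| + 1) / η * r n := by positivity
  have sub : {ω | (|C| + 1) / η * r n < V n ω} ⊆
      {ω | ENNReal.ofReal ((|C| + 1) / η * r n) ≤ U n ω} := fun ω hω =>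
    (ENNReal.ofReal_le_ofReal (le_of_lt hω)).trans (hV ω)
  refine (measure_mono sub).trans ((meas_ge_le_lintegral_div (hU n) ?_ (by simp)).trans ?_)
  · simpa using ht
  · refine ENNReal.div_le_of_le_mul (hint.trans ?_)
    rw [← ENNReal.ofReal_mul hη.le]
    apply ENNReal.ofReal_le_ofReal
    have : η * ((|C| + 1) / η * r n) = (|C| + 1) * r n := by field_simp
    rw [this]
    gcongr
    linarith [le_abs_self C]

end BigOp

/-! ### Root-n consistency -/

section RootN

variable {Ω : Type*} [MeasurableSpace Ω] {P : Measure Ω}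

/-- The rate `n^{-1/2}`. -/
def rootRate (n : ℕ) : ℝ := (n : ℝ) ^ (-(1 / 2) : ℝ)

theorem rootRate_nonneg (n : ℕ) : 0 ≤ rootRate n := Real.rpow_nonneg (by positivity) _

theorem rootRate_sq (n : ℕ) : rootRate n ^ 2 = (n : ℝ)⁻¹ := by
  rw [rootRate, ← Real.rpow_natCast, ← Real.rpow_mul (by positivity), ← Real.rpow_neg_one]
  norm_num

theorem rootRate_pos {n : ℕ} (hn : 1 ≤ n) : 0 < rootRate n :=
  Real.rpow_pos_of_pos (by exact_mod_cast hn) _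

theorem tendsto_rootRate : Tendsto rootRate atTop (𝓝 0) :=
  (tendsto_rpow_neg_atTop (by norm_num : (0 : ℝ) < 1 / 2)).comp tendsto_natCast_atTop_atTop

theorem eventually_rootRate_le_one : ∀ᶠ n in atTop, rootRate n ≤ 1 :=
  (tendsto_rootRate.eventually (gt_mem_nhds one_pos)).mono fun _ h => le_of_lt h

variable {E : Type*} [NormedAddCommGroup E]

/-- `V n` is a root-`n` consistent estimator of `v`. -/
def RootN (P : Measure Ω) (V : ℕ → Ω → E) (v : E) : Prop :=
  IsOp P (fun n ω => ‖V n ω - v‖) rootRate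

variable {V W : ℕ → Ω → E} {v w : E}

theorem RootN.add (hV : RootN P V v) (hW : RootN P W w) :
    RootN P (fun n ω => V n ω + W n ω) (v + w) :=
  (IsOp.add hV hW).mono <| .of_forall fun n ω => by
    rw [add_sub_add_comm]; exact norm_add_le _ _

theorem RootN.neg (hV : RootN P V v) : RootN P (fun n ω => -V n ω) (-v) :=
  IsOp.mono hV <| .of_forall fun n ω => by
    rw [neg_sub_neg, norm_sub_rev]

theorem RootN.sub (hV : RootN P V v) (hW : RootN P W w) :
    RootN P (fun n ω => V n ω - W n ω) (v - w) := by
  simp only [sub_eq_add_neg]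
  exact hV.add hW.neg

theorem RootN.bounded (hV : RootN P V v) : IsOp P (fun n ω => ‖V n ω‖) fun _ => 1 := by
  refine ((IsOp.rate_mono hV eventually_rootRate_le_one).add
    (isOp_const (r := fun _ => 1) (c := ‖v‖) fun _ => zero_le_one)).mono ?_
  refine .of_forall fun n ω => ?_
  rw [mul_one]
  calc ‖V n ω‖ = ‖(V n ω - v) + v‖ := by rw [sub_add_cancel]
    _ ≤ _ := norm_add_le _ _

theorem RootN.smul [NormedSpace ℝ E] {a : ℕ → Ω → ℝ} {α : ℝ} (ha : RootN P a α)
    (hV : RootN P V v) :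
    RootN P (fun n ω => a n ω • V n ω) (α • v) := by
  have h1 : IsOp P (fun n ω => ‖a n ω - α‖ * ‖V n ω‖) rootRate := by
    simpa using IsOp.mul ha hV.bounded rootRate_nonneg fun _ _ => norm_nonneg _
  have h2 := IsOp.const_mul hV rootRate_nonneg (norm_nonneg α)
  refine (h1.add h2).mono (.of_forall fun n ω => ?_)
  have : a n ω • V n ω - α • v = (a n ω - α) • V n ω + α • (V n ω - v) := by
    rw [sub_smul, smul_sub]; abel
  rw [this, ← norm_smul, ← norm_smul]
  exact norm_add_le _ _

theorem RootN.sum {ι : Type*} (A : Finset ι) {V : ι → ℕ → Ω → E} {v : ι → E}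
    (hV : ∀ i ∈ A, RootN P (V i) (v i)) :
    RootN P (fun n ω => ∑ i ∈ A, V i n ω) (∑ i ∈ A, v i) :=
  (IsOp.sum A (V := fun i n ω => ‖V i n ω - v i‖) rootRate_nonneg hV).mono <|
    .of_forall fun n ω => by
      rw [← Finset.sum_sub_distrib]; exact norm_sum_le _ _

theorem RootN.congr (hV : RootN P V v) (h : ∀ᶠ n in atTop, ∀ ω, W n ω = V n ω) :
    RootN P W v :=
  IsOp.mono hV (h.mono fun n hn ω => by rw [hn])

attribute [local instance] Matrix.linftyOpNormedRing Matrix.linftyOpNormedAlgebra in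
/-- Matrix inversion is Lipschitz at an invertible matrix `S`. Singular matrices, whose inverse is
read as `0`, do not occur near `S`. -/
theorem exists_matrix_inv_bound {q : ℕ} {S : Matrix (Fin q) (Fin q) ℝ} (hS : IsUnit S) :
    ∃ ε C : ℝ, 0 < ε ∧ 0 ≤ C ∧ ∀ A : Matrix (Fin q) (Fin q) ℝ,
      (∑ a, ∑ b, |A a b - S a b|) ≤ ε → ∀ a b,
        |A⁻¹ a b - S⁻¹ a b| ≤ C * ∑ a, ∑ b, |A a b - S a b| := by
  have le1 : ∀ (A : Matrix (Fin q) (Fin q) ℝ) (a b), |A a b| ≤ ‖A‖ := by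
    intro A a b
    rw [Matrix.linfty_opNorm_def]
    have h1 : ‖A a b‖₊ ≤ ∑ j, ‖A a j‖₊ :=
      Finset.single_le_sum (f := fun j => ‖A a j‖₊) (fun _ _ => zero_le) (Finset.mem_univ b)
    have h2 : ∑ j, ‖A a j‖₊ ≤ Finset.univ.sup fun i => ∑ j, ‖A i j‖₊ :=
      Finset.le_sup (f := fun i => ∑ j, ‖A i j‖₊) (Finset.mem_univ a)
    exact_mod_cast h1.trans h2
  have le2 : ∀ A : Matrix (Fin q) (Fin q) ℝ, ‖A‖ ≤ ∑ a, ∑ b, |A a b| := by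
    intro A
    rw [Matrix.linfty_opNorm_def]
    have : (Finset.univ.sup fun i => ∑ j, ‖A i j‖₊) ≤ ∑ i, ∑ j, ‖A i j‖₊ :=
      Finset.sup_le fun i _ => Finset.single_le_sum (f := fun i => ∑ j, ‖A i j‖₊)
        (fun _ _ => zero_le) (Finset.mem_univ i)
    have := NNReal.coe_le_coe.2 this
    simpa using this
  obtain ⟨u, rfl⟩ := hS
  have hO := (differentiableAt_inverse (𝕜 := ℝ) u.isUnit).isBigO_sub
  obtain ⟨C, hC⟩ := hO.bound
  obtain ⟨ε, hε, H⟩ := Metric.eventually_nhds_iff.1 hC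
  refine ⟨ε / 2, |C|, by positivity, abs_nonneg _, fun A hA a b => ?_⟩
  have hd : ‖A - u‖ ≤ ∑ a, ∑ b, |A a b - (u : Matrix (Fin q) (Fin q) ℝ) a b| := le2 (A - u)
  have := H (y := A) (by rw [dist_eq_norm]; linarith)
  rw [Matrix.nonsing_inv_eq_ringInverse, Matrix.nonsing_inv_eq_ringInverse]
  calc _ ≤ ‖Ring.inverse A - Ring.inverse (u : Matrix (Fin q) (Fin q) ℝ)‖ :=
        le1 (Ring.inverse A - Ring.inverse (u : Matrix (Fin q) (Fin q) ℝ)) a b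
    _ ≤ C * ‖A - u‖ := this
    _ ≤ |C| * ‖A - u‖ := by gcongr; exact le_abs_self C
    _ ≤ _ := by gcongr

theorem RootN.matrix_inv {q : ℕ} {A : ℕ → Ω → Matrix (Fin q) (Fin q) ℝ}
    {S : Matrix (Fin q) (Fin q) ℝ} (hS : IsUnit S)
    (hA : ∀ a b, RootN P (fun n ω => A n ω a b) (S a b)) (a b : Fin q) :
    RootN P (fun n ω => (A n ω)⁻¹ a b) (S⁻¹ a b) := by
  obtain ⟨ε, C, hε, hC, H⟩ := exists_matrix_inv_bound hS
  have : IsOp P (fun n ω => ∑ a, ∑ b, |A n ω a b - S a b|) rootRate :=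
    IsOp.sum _ rootRate_nonneg fun a _ => IsOp.sum _ rootRate_nonneg fun b _ => hA a b
  exact this.of_local tendsto_rootRate hε rootRate_nonneg (fun n ω h => H _ h a b) hC

end RootN

section Averages

theorem integral_inner_eq_zero {Ω : Type*} [MeasurableSpace Ω] {P : Measure Ω}
    {E : Type*} [NormedAddCommGroup E] [InnerProductSpace ℝ E] [CompleteSpace E]
    [MeasurableSpace E] [BorelSpace E] {V W : Ω → E}
    (hVW : IndepFun V W P) (hV : Integrable V P)
    (hW : Integrable W P) (h0 : ∫ ω, V ω ∂P = 0) : ∫ ω, inner ℝ (V ω) (W ω) ∂P = 0 := by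
  have := hVW.integral_bilin hV hW (innerSL ℝ)
  rw [h0, map_zero] at this
  exact this

variable {Ω : Type*} [MeasurableSpace Ω] {P : Measure Ω} [IsProbabilityMeasure P]
  {E : Type*} [NormedAddCommGroup E] [InnerProductSpace ℝ E] [CompleteSpace E]
  [MeasurableSpace E] [BorelSpace E]

/-- Averages of independent, identically distributed, square integrable Hilbert space valued
random elements are root-`n` consistent, as the variance of a sum is the sum of the variances. -/
theorem rootN_average {V : ℕ → Ω → E} (hindep : Pairwise fun i j => IndepFun (V i) (V j) P)
    (hident : ∀ i, IdentDistrib (V i) (V 0) P P) (hV : MemLp (V 0) 2 P) :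
    RootN P (fun n ω => (n : ℝ)⁻¹ • ∑ i ∈ Finset.range n, V i ω) (∫ ω, V 0 ω ∂P) := by
  set v := ∫ ω, V 0 ω ∂P with hv
  set W : ℕ → Ω → E := fun i ω => V i ω - v with hWdef
  have hVi : ∀ i, MemLp (V i) 2 P := fun i => (hident i).memLp_iff.2 hV
  have hWi : ∀ i, MemLp (W i) 2 P := fun i => (hVi i).sub (memLp_const v)
  have hW1 : ∀ i, Integrable (W i) P := fun i => (hWi i).integrable one_le_two
  have hW0 : ∀ i, ∫ ω, W i ω ∂P = 0 := by
    intro i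
    rw [integral_sub ((hVi i).integrable one_le_two) (integrable_const _), integral_const,
      (hident i).integral_eq]
    simp [hv]
  have hI : ∀ i j, Integrable (fun ω => inner ℝ (W i ω) (W j ω)) P :=
    fun i j => ((hWi i).norm.integrable_mul (hWi j).norm).mono'
      ((hWi i).aestronglyMeasurable.inner (hWi j).aestronglyMeasurable)
      (.of_forall fun ω => norm_inner_le_norm _ _)
  have hWW : ∀ i j, i ≠ j → ∫ ω, inner ℝ (W i ω) (W j ω) ∂P = 0 := by
    intro i j hij
    refine integral_inner_eq_zero ?_ (hW1 i) (hW1 j) (hW0 i)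
    exact (hindep hij).comp (measurable_id.sub_const v) (measurable_id.sub_const v)
  set c := ∫ ω, ‖W 0 ω‖ ^ 2 ∂P with hc
  have hWc : ∀ i, ∫ ω, inner ℝ (W i ω) (W i ω) ∂P = c := by
    intro i
    have := (hident i).comp (u := fun z => ‖z - v‖ ^ 2) (by fun_prop)
    have := this.integral_eq
    simp only [real_inner_self_eq_norm_sq]
    exact this
  have hsum : ∀ n : ℕ, ∫ ω, ‖∑ i ∈ Finset.range n, W i ω‖ ^ 2 ∂P = n * c := by
    intro n
    simp only [← real_inner_self_eq_norm_sq, sum_inner, inner_sum]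
    rw [integral_finsetSum _ fun i _ => integrable_finsetSum _ fun j _ => hI j i]
    calc _ = ∑ i ∈ Finset.range n, c := by
          refine Finset.sum_congr rfl fun i hi => ?_
          rw [integral_finsetSum _ fun j _ => hI j i,
            Finset.sum_eq_single_of_mem i hi fun j _ hj => hWW j i hj, hWc]
      _ = _ := by simp
  have hsumI : ∀ n : ℕ, Integrable (fun ω => ‖∑ i ∈ Finset.range n, W i ω‖ ^ 2) P := by
    intro n
    simp only [← real_inner_self_eq_norm_sq, sum_inner, inner_sum]
    exact integrable_finsetSum _ fun i _ => integrable_finsetSum _ fun j _ => hI j i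
  refine IsOp.sqrt ?_ rootRate_nonneg
  refine IsOp.of_lintegral_le (C := c)
    (U := fun n ω => ENNReal.ofReal (((n : ℝ)⁻¹) ^ 2 * ‖∑ i ∈ Finset.range n, W i ω‖ ^ 2))
    (fun n => ?_) ?_ ?_ ?_
  · exact ((hsumI n).aestronglyMeasurable.aemeasurable.const_mul _).ennreal_ofReal
  · filter_upwards [eventually_ge_atTop 1] with n hn using pow_pos (rootRate_pos hn) 2
  · filter_upwards [eventually_ge_atTop 1] with n hn
    rw [← ofReal_integral_eq_lintegral_ofReal ((hsumI n).const_mul _)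
      (.of_forall fun ω => by positivity), integral_const_mul, hsum, rootRate_sq]
    apply ENNReal.ofReal_le_ofReal
    have : (n : ℝ) ≠ 0 := by positivity
    field_simp
    rfl
  · filter_upwards [eventually_ge_atTop 1] with n hn ω
    have hn0 : (n : ℝ) ≠ 0 := by positivity
    have : (n : ℝ)⁻¹ • ∑ i ∈ Finset.range n, V i ω - v =
        (n : ℝ)⁻¹ • ∑ i ∈ Finset.range n, W i ω := by
      simp only [hWdef, Finset.sum_sub_distrib, Finset.sum_const, Finset.card_range, smul_sub]
      rw [← Nat.cast_smul_eq_nsmul ℝ, smul_smul, inv_mul_cancel₀ hn0, one_smul]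
    rw [this, norm_smul, mul_pow, Real.norm_eq_abs, sq_abs]

end Averages

/-! ### Random densities as random elements of a Hilbert space -/

/-- A map is measurable if it is Lipschitz for a second countable distance all of whose distance
functions are measurable. -/
theorem measurable_of_edist_le {T A B : Type*} [MeasurableSpace T] [PseudoEMetricSpace A]
    [SecondCountableTopology A] [PseudoEMetricSpace B] [MeasurableSpace B] [BorelSpace B]
    {J : T → A} {Y : T → B} {K : ℝ≥0} (hJ : ∀ t₀, Measurable fun t => edist (J t) (J t₀))
    (hY : ∀ s t, edist (Y s) (Y t) ≤ K * edist (J s) (J t)) : Measurable Y := by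
  refine measurable_of_isOpen fun U hU => ?_
  have ex : ∀ t : Y ⁻¹' U, ∃ r : ℝ≥0∞, 0 < r ∧ ∀ s, edist (J s) (J t) < r → Y s ∈ U := by
    rintro ⟨t, ht⟩
    obtain ⟨ε, hε, hball⟩ := EMetric.isOpen_iff.1 hU (Y t) ht
    refine ⟨ε / (K + 1), ENNReal.div_pos hε.ne' (by simp), fun s hs => hball ?_⟩
    rw [Metric.mem_eball]
    have h1 : edist (J s) (J t) * (K + 1) < ε := ENNReal.mul_lt_of_lt_div hs
    refine ((hY s t).trans ?_).trans_lt h1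
    rw [mul_comm]
    gcongr
    exact le_self_add
  choose r hr hU' using ex
  obtain ⟨C, hC, e⟩ := TopologicalSpace.isOpen_iUnion_countable
    (fun t : Y ⁻¹' U => Metric.eball (J t) (r t)) fun _ => Metric.isOpen_eball
  have : Y ⁻¹' U = ⋃ t ∈ C, {s | edist (J s) (J t) < r t} := by
    ext s
    simp only [mem_iUnion, mem_ofPred_eq, exists_prop]
    constructor
    · intro hs
      have : J s ∈ ⋃ t : Y ⁻¹' U, Metric.eball (J t) (r t) :=
        mem_iUnion.2 ⟨⟨s, hs⟩, Metric.mem_eball_self (hr _)⟩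
      rw [← e] at this
      simpa [Metric.mem_eball] using this
    · rintro ⟨t, _, h⟩
      exact hU' t s h
  rw [this]
  exact .biUnion hC fun t _ => measurableSet_lt (hJ t) measurable_const

instance fact_two_ne_top : Fact ((2 : ℝ≥0∞) ≠ ∞) := ⟨by simp⟩

instance measurableSpace_QSpace (p : ℕ) : MeasurableSpace (QSpace p) := borel _

instance borelSpace_QSpace (p : ℕ) : BorelSpace (QSpace p) := ⟨rfl⟩

section DensityClass

variable {p k : ℕ} {D : Set (Euc p)} {M₀ L₀ : ℝ}

theorem density_eq_zero {f : Euc p → ℝ} (hf : f ∈ densityClass D k M₀ L₀) {z : Euc p}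
    (hz : z ∉ D) : f z = 0 := by
  by_contra h
  exact hz (hf.2.2.2.1 ▸ h)

theorem density_abs_le {f : Euc p → ℝ} (hf : f ∈ densityClass D k M₀ L₀) {z : Euc p}
    (hz : z ∈ D) : |f z| ≤ M₀ := by
  rw [abs_of_nonneg (hf.1 z)]
  exact (hf.2.2.2.2.1 z hz).1

/-- Evaluation is jointly measurable on a class of functions that are continuous on `D` and
vanish elsewhere. -/
theorem density_measurable_eval {T : Type*} [MeasurableSpace T] (hD : IsCompact D)
    {φ : T → Euc p → ℝ} (hφ : ∀ z, Measurable fun t => φ t z)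
    (hF : ∀ t, φ t ∈ densityClass D k M₀ L₀) : Measurable fun w : T × Euc p => φ w.1 w.2 := by
  have h1 : Measurable (Function.uncurry fun (z : D) (t : T) => φ t z) := by
    refine measurable_uncurry_of_continuous_of_measurable (fun t => ?_) fun z => hφ z
    exact (hF t).2.2.2.2.2.1.continuousOn.domRestrict
  have hDm : MeasurableSet {w : T × Euc p | w.2 ∈ D} := measurable_snd hD.measurableSet
  refine measurable_of_restrict_of_restrict_compl hDm ?_ ?_
  · exact h1.comp (f := fun w : {w : T × Euc p | w.2 ∈ D} =>
      ((⟨w.1.2, w.2⟩ : D), w.1.1)) (by fun_prop)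
  · convert measurable_const (a := (0 : ℝ)) using 1
    exact funext fun w => density_eq_zero (hF w.1.1) w.2

theorem measurable_density (hD : IsCompact D) {f : Euc p → ℝ}
    (hf : f ∈ densityClass D k M₀ L₀) : Measurable f :=
  (density_measurable_eval (T := Unit) hD (φ := fun _ => f) (fun _ => measurable_const)
    fun _ => hf).comp (f := fun z => ((), z)) (by fun_prop)

theorem density_eq_indicator {f : Euc p → ℝ} (hf : f ∈ densityClass D k M₀ L₀) :
    f = D.indicator f :=
  (indicator_eq_self.2 fun _ hz => by_contra fun h => hz (density_eq_zero hf h)).symm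

theorem density_memLp (hD : IsCompact D) {f : Euc p → ℝ}
    (hf : f ∈ densityClass D k M₀ L₀) : MemLp f 2 volume := by
  rw [density_eq_indicator hf, memLp_indicator_iff_restrict hD.measurableSet]
  have : IsFiniteMeasure (volume.restrict D) := ⟨by
    rw [Measure.restrict_apply_univ]; exact hD.measure_lt_top⟩
  refine MemLp.of_bound (measurable_density hD hf).aestronglyMeasurable M₀ ?_
  exact (ae_restrict_iff' hD.measurableSet).2 (.of_forall fun z hz => density_abs_le hf hz)

/-- The quantile slices of the density `f`, as a point of `L²(Θ × [0, 1])`. -/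
def slicePoint {p : ℕ} (ψ : (Euc p → ℝ) → Sph p → ℝ → ℝ) (f : Euc p → ℝ) : QSpace p :=
  cls (toQuantiles (ψ f))

/-- The slice point of a random density is measurable. The σ-algebra on densities is that of point
evaluations, for which the `L²` distance is measurable, and slice points are Lipschitz for it. -/
theorem measurable_slicePoint {T : Type*} [MeasurableSpace T] (hD : IsCompact D)
    {ψ : (Euc p → ℝ) → Sph p → ℝ → ℝ} {C : ℝ≥0}
    (hmem : ∀ f ∈ densityClass D k M₀ L₀,
      MemLp (Function.uncurry (toQuantiles (ψ f))) 2 (quantMeasure p))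
    (hψ : ∀ f₁ ∈ densityClass D k M₀ L₀, ∀ f₂ ∈ densityClass D k M₀ L₀,
      wassDist (toQuantiles (ψ f₁)) (toQuantiles (ψ f₂)) ≤ C * l2Dist f₁ f₂)
    {φ : T → Euc p → ℝ} (hφ : ∀ z, Measurable fun t => φ t z)
    (hF : ∀ t, φ t ∈ densityClass D k M₀ L₀) : Measurable fun t => slicePoint ψ (φ t) := by
  have ed : ∀ s t, edist (density_memLp hD (hF s)).toLp (density_memLp hD (hF t)).toLp =
      l2Dist (φ s) (φ t) := by
    intro s t
    rw [Lp.edist_toLp_toLp]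
    rfl
  refine measurable_of_edist_le (A := Lp ℝ 2 (volume : Measure (Euc p)))
    (J := fun t => (density_memLp hD (hF t)).toLp) (K := C) (fun t₀ => ?_) fun s t => ?_
  · simp_rw [ed]
    have : ∀ t, l2Dist (φ t) (φ t₀) = (∫⁻ z, ‖φ t z - φ t₀ z‖ₑ ^ 2) ^ (1 / 2 : ℝ) := by
      intro t
      rw [l2Dist, ← eLpNorm_two_sq, ← ENNReal.rpow_natCast, ← ENNReal.rpow_mul]
      norm_num
    simp_rw [this]
    refine (Measurable.lintegral_prod_right' (f := fun w : T × Euc p =>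
      ‖φ w.1 w.2 - φ t₀ w.2‖ₑ ^ 2) ?_).pow_const _
    exact (((density_measurable_eval hD hφ hF).sub
      ((measurable_density hD (hF t₀)).comp measurable_snd)).enorm).pow_const _
  · rw [ed, edist_eq_enorm_sub, slicePoint, slicePoint,
      ← wassDist_eq (hmem _ (hF s)) (hmem _ (hF t))]
    exact hψ _ (hF s) _ (hF t)

end DensityClass

section Lifting

variable {Ω : Type*} [MeasurableSpace Ω] {P : Measure Ω} {A : Type*} [MeasurableSpace A]
  {s : Set A}

/-- Independence persists when the random elements are regarded as elements of a subset of their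
space, even if that subset is not measurable. -/
theorem iIndepFun_codRestrict {V : ℕ → Ω → A} (hV : iIndepFun V P)
    (hs : ∀ i ω, V i ω ∈ s) : iIndepFun (fun i ω => (⟨V i ω, hs i ω⟩ : s)) P := by
  have h : iIndep (fun i => MeasurableSpace.comap (V i) inferInstance) P := hV
  have e : (fun i => MeasurableSpace.comap (fun ω => (⟨V i ω, hs i ω⟩ : s)) inferInstance) =
      fun i => MeasurableSpace.comap (V i) inferInstance := by
    funext i
    exact MeasurableSpace.comap_comp
  have h' : iIndep (fun i => MeasurableSpace.comap (fun ω => (⟨V i ω, hs i ω⟩ : s))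
      inferInstance) P := by rw [e]; exact h
  exact h'

theorem identDistrib_codRestrict {V W : Ω → A} (hVm : Measurable V) (hWm : Measurable W)
    (h : IdentDistrib V W P P) (hV : ∀ ω, V ω ∈ s) (hW : ∀ ω, W ω ∈ s) :
    IdentDistrib (fun ω => (⟨V ω, hV ω⟩ : s)) (fun ω => (⟨W ω, hW ω⟩ : s)) P P := by
  refine ⟨(hVm.subtype_mk).aemeasurable, (hWm.subtype_mk).aemeasurable, ?_⟩
  ext t ht
  obtain ⟨t', ht', rfl⟩ := ht
  rw [Measure.map_apply hVm.subtype_mk ⟨t', ht', rfl⟩,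
    Measure.map_apply hWm.subtype_mk ⟨t', ht', rfl⟩]
  have := congrArg (fun μ => μ t') h.map_eq
  rw [Measure.map_apply hVm ht', Measure.map_apply hWm ht'] at this
  exact this

end Lifting

/-! ### The weights of global Fréchet regression -/

section WeightAlgebra

variable {q : ℕ} {H : Type*} [NormedAddCommGroup H] [NormedSpace ℝ H]

/-- The vector `S⁻¹ (x - m)`, with which the weight at `x` is an affine function of the
predictor. -/
def weightDir (m : Euc q) (S : Matrix (Fin q) (Fin q) ℝ) (x : Euc q) (a : Fin q) : ℝ :=
  ∑ b, S⁻¹ a b * (x b - m b)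

theorem weight_eq (m : Euc q) (S : Matrix (Fin q) (Fin q) ℝ) (y x : Euc q) :
    weight m S y x = 1 + ∑ a, (y a - m a) * weightDir m S x a := rfl

theorem sampleMean_apply (n : ℕ) (X : ℕ → Euc q) (a : Fin q) :
    sampleMean n X a = (n : ℝ)⁻¹ * ∑ i ∈ Finset.range n, X i a := by
  simp [sampleMean]

theorem sum_sub_sampleMean {n : ℕ} (hn : 1 ≤ n) (X : ℕ → Euc q) (a : Fin q) :
    ∑ i ∈ Finset.range n, (X i a - sampleMean n X a) = 0 := by
  have : (n : ℝ) ≠ 0 := by positivity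
  rw [Finset.sum_sub_distrib, Finset.sum_const, Finset.card_range, nsmul_eq_mul, sampleMean_apply]
  field_simp
  ring

theorem mean_weight {n : ℕ} (hn : 1 ≤ n) (X : ℕ → Euc q) (S : Matrix (Fin q) (Fin q) ℝ)
    (x : Euc q) :
    (n : ℝ)⁻¹ * ∑ i ∈ Finset.range n, weight (sampleMean n X) S (X i) x = 1 := by
  have hn0 : (n : ℝ) ≠ 0 := by positivity
  have : ∑ i ∈ Finset.range n, ∑ a, (X i a - sampleMean n X a) *
      weightDir (sampleMean n X) S x a = 0 := by
    rw [Finset.sum_comm]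
    refine Finset.sum_eq_zero fun a _ => ?_
    rw [← Finset.sum_mul, sum_sub_sampleMean hn, zero_mul]
  simp only [weight_eq, Finset.sum_add_distrib, this, Finset.sum_const, Finset.card_range,
    nsmul_eq_mul]
  field_simp
  ring

theorem sampleCov_apply {n : ℕ} (hn : 1 ≤ n) (X : ℕ → Euc q) (a b : Fin q) :
    sampleCov n X a b = (n : ℝ)⁻¹ * (∑ i ∈ Finset.range n, X i a * X i b)
      - sampleMean n X a * sampleMean n X b := by
  have hn0 : (n : ℝ) ≠ 0 := by positivity
  have h1 : ∑ i ∈ Finset.range n, (X i a - sampleMean n X a) * (X i b - sampleMean n X b) =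
      (∑ i ∈ Finset.range n, X i a * X i b)
        - sampleMean n X b * (∑ i ∈ Finset.range n, X i a)
        - sampleMean n X a * ∑ i ∈ Finset.range n, (X i b - sampleMean n X b) := by
    rw [Finset.mul_sum, Finset.mul_sum, ← Finset.sum_sub_distrib, ← Finset.sum_sub_distrib]
    exact Finset.sum_congr rfl fun i _ => by ring
  rw [sampleCov, Matrix.of_apply, h1, sum_sub_sampleMean hn, sampleMean_apply n X a]
  ring

/-- The coefficient of `x b` in the global linear regression with covariances `c` of predictors
and responses. -/
def regSlope (S : Matrix (Fin q) (Fin q) ℝ) (c : Fin q → H) (b : Fin q) : H :=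
  ∑ a, S⁻¹ a b • c a

/-- The intercept of the global linear regression. -/
def regIntercept (m : Euc q) (S : Matrix (Fin q) (Fin q) ℝ) (y : H) (c : Fin q → H) : H :=
  y - ∑ b, m b • regSlope S c b

/-- A weighted mean of the responses is affine in `x`. This makes consistency at every `x` uniform
over bounded sets. -/
theorem regression_eq_affine (m : Euc q) (S : Matrix (Fin q) (Fin q) ℝ) (y : H) (c : Fin q → H)
    (x : Euc q) :
    y + ∑ a, weightDir m S x a • c a = regIntercept m S y c + ∑ b, x b • regSlope S c b := by
  have : ∑ a, weightDir m S x a • c a = ∑ b, (x b - m b) • regSlope S c b := by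
    simp only [weightDir, regSlope, Finset.sum_smul, Finset.smul_sum, smul_smul]
    rw [Finset.sum_comm]
    simp only [mul_comm]
  rw [this, regIntercept]
  simp only [sub_smul, Finset.sum_sub_distrib]
  abel

theorem mean_weight_smul (n : ℕ) (X : ℕ → Euc q) (Y : ℕ → H) (m : Euc q)
    (S : Matrix (Fin q) (Fin q) ℝ) (x : Euc q) :
    (n : ℝ)⁻¹ • ∑ i ∈ Finset.range n, weight m S (X i) x • Y i =
      (n : ℝ)⁻¹ • (∑ i ∈ Finset.range n, Y i) + ∑ a, weightDir m S x a •
        ((n : ℝ)⁻¹ • (∑ i ∈ Finset.range n, X i a • Y i)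
          - m a • (n : ℝ)⁻¹ • (∑ i ∈ Finset.range n, Y i)) := by
  have : ∀ i, weight m S (X i) x • Y i =
      Y i + ∑ a, weightDir m S x a • (X i a • Y i - m a • Y i) := by
    intro i
    rw [weight_eq, add_smul, one_smul, Finset.sum_smul]
    congr 1
    refine Finset.sum_congr rfl fun a _ => ?_
    rw [mul_comm, mul_smul, sub_smul]
  simp only [this, Finset.sum_add_distrib, smul_add]
  congr 1
  rw [Finset.sum_comm, Finset.smul_sum]
  refine Finset.sum_congr rfl fun a _ => ?_
  rw [← Finset.smul_sum, Finset.sum_sub_distrib, ← Finset.smul_sum, smul_comm, smul_sub,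
    smul_comm (n : ℝ)⁻¹ (m a)]

variable {Ω : Type*} [MeasurableSpace Ω] {P : Measure Ω}

theorem integrable_apply {X : Ω → Euc q} (hX : Integrable X P) (a : Fin q) :
    Integrable (fun ω => X ω a) P :=
  (EuclideanSpace.proj (𝕜 := ℝ) a).integrable_comp hX

theorem memLp_apply {X : Ω → Euc q} {r : ℝ≥0∞} (hX : MemLp X r P) (a : Fin q) :
    MemLp (fun ω => X ω a) r P :=
  (EuclideanSpace.proj (𝕜 := ℝ) a).comp_memLp' hX

theorem integral_apply {X : Ω → Euc q} (hX : Integrable X P) (a : Fin q) :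
    (∫ ω, X ω ∂P) a = ∫ ω, X ω a ∂P :=
  ((EuclideanSpace.proj (𝕜 := ℝ) a).integral_comp_comm hX).symm

theorem integral_weight_smul [CompleteSpace H] {X : Ω → Euc q} {Y : Ω → H} (hY : Integrable Y P)
    (hXY : ∀ a, Integrable (fun ω => X ω a • Y ω) P) (m : Euc q)
    (S : Matrix (Fin q) (Fin q) ℝ) (x : Euc q) :
    Integrable (fun ω => weight m S (X ω) x • Y ω) P ∧
    ∫ ω, weight m S (X ω) x • Y ω ∂P =
      ∫ ω, Y ω ∂P + ∑ a, weightDir m S x a •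
        (∫ ω, X ω a • Y ω ∂P - m a • ∫ ω, Y ω ∂P) := by
  have : ∀ ω, weight m S (X ω) x • Y ω =
      Y ω + ∑ a, weightDir m S x a • (X ω a • Y ω - m a • Y ω) := by
    intro i
    rw [weight_eq, add_smul, one_smul, Finset.sum_smul]
    congr 1
    refine Finset.sum_congr rfl fun a _ => ?_
    rw [mul_comm, mul_smul, sub_smul]
  simp only [this]
  have hs : ∀ a, Integrable (fun ω => weightDir m S x a • (X ω a • Y ω - m a • Y ω)) P :=
    fun a => ((hXY a).sub (hY.smul (m a))).smul _
  refine ⟨hY.add (integrable_finsetSum _ fun a _ => hs a), ?_⟩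
  rw [integral_add hY (integrable_finsetSum _ fun a _ => hs a),
    integral_finsetSum _ fun a _ => hs a]
  congr 1
  refine Finset.sum_congr rfl fun a _ => ?_
  rw [integral_smul, integral_sub (g := fun ω => m a • Y ω) (hXY a) (hY.smul (m a)),
    integral_smul]

theorem integral_weight [IsProbabilityMeasure P] {X : Ω → Euc q} (hX : Integrable X P)
    (S : Matrix (Fin q) (Fin q) ℝ) (x : Euc q) :
    Integrable (fun ω => weight (∫ ω, X ω ∂P) S (X ω) x) P ∧
    ∫ ω, weight (∫ ω, X ω ∂P) S (X ω) x ∂P = 1 := by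
  have h := integral_weight_smul (P := P) (X := X) (Y := fun _ => (1 : ℝ)) (integrable_const _)
    (fun a => by simpa using integrable_apply hX a) (∫ ω, X ω ∂P) S x
  simp only [smul_eq_mul, mul_one] at h
  refine ⟨h.1, h.2.trans ?_⟩
  simp [integral_apply hX]

theorem abs_weightDir_le {m : Euc q} (S : Matrix (Fin q) (Fin q) ℝ) {x : Euc q} {B : ℝ}
    (hx : ‖x‖ ≤ B) (a : Fin q) :
    |weightDir m S x a| ≤ ∑ b, |S⁻¹ a b| * (B + |m b|) := by
  refine (Finset.abs_sum_le_sum_abs _ _).trans (Finset.sum_le_sum fun b _ => ?_)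
  rw [abs_mul]
  refine mul_le_mul_of_nonneg_left ?_ (abs_nonneg _)
  have h1 : |x b| ≤ ‖x‖ := PiLp.norm_apply_le x b
  exact (abs_sub _ _).trans (by linarith)

theorem mean_weight_sq_le {n : ℕ} (hn : 1 ≤ n) (X : ℕ → Euc q) {x : Euc q} {B : ℝ}
    (hx : ‖x‖ ≤ B) :
    (n : ℝ)⁻¹ * ∑ i ∈ Finset.range n,
      weight (sampleMean n X) (sampleCov n X) (X i) x ^ 2 ≤
      2 + 2 * q * ∑ a, (∑ b, |(sampleCov n X)⁻¹ a b| * (B + |sampleMean n X b|)) ^ 2 *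
        |sampleCov n X a a| := by
  have hn0 : (n : ℝ) ≠ 0 := by positivity
  set m := sampleMean n X
  set S := sampleCov n X with hS
  set v := weightDir m S x
  have pt : ∀ i, weight m S (X i) x ^ 2 ≤
      2 + 2 * q * ∑ a, v a ^ 2 * ((X i a - m a) * (X i a - m a)) := by
    intro i
    rw [weight_eq]
    have h1 := sq_sum_le_card_mul_sum_sq (s := Finset.univ) (f := fun a => (X i a - m a) * v a)
    rw [Finset.card_univ, Fintype.card_fin] at h1
    have h2 : ∑ a, ((X i a - m a) * v a) ^ 2 = ∑ a, v a ^ 2 * ((X i a - m a) * (X i a - m a)) :=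
      Finset.sum_congr rfl fun a _ => by ring
    rw [h2] at h1
    nlinarith [sq_nonneg (1 - ∑ a, (X i a - m a) * v a)]
  have hsum := Finset.sum_le_sum fun i (_ : i ∈ Finset.range n) => pt i
  have hSa : ∀ a, ∑ i ∈ Finset.range n, (X i a - m a) * (X i a - m a) = n * S a a := by
    intro a
    rw [hS, sampleCov, Matrix.of_apply, ← mul_assoc, mul_inv_cancel₀ hn0, one_mul]
  have e : ∑ i ∈ Finset.range n, (2 + 2 * q * ∑ a, v a ^ 2 * ((X i a - m a) * (X i a - m a))) =
      n * (2 + 2 * q * ∑ a, v a ^ 2 * S a a) := by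
    rw [Finset.sum_add_distrib, ← Finset.mul_sum, Finset.sum_comm]
    simp only [← Finset.mul_sum, hSa]
    simp only [Finset.sum_const, Finset.card_range, nsmul_eq_mul, mul_left_comm _ (n : ℝ),
      ← Finset.mul_sum]
    ring
  rw [e] at hsum
  calc _ ≤ (n : ℝ)⁻¹ * (n * (2 + 2 * q * ∑ a, v a ^ 2 * S a a)) := by gcongr
    _ = 2 + 2 * q * ∑ a, v a ^ 2 * S a a := by field_simp
    _ ≤ _ := by
      refine add_le_add_right (mul_le_mul_of_nonneg_left (Finset.sum_le_sum fun a _ => ?_)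
        (by positivity)) _
      have h1 : |v a| ≤ ∑ b, |S⁻¹ a b| * (B + |m b|) := abs_weightDir_le S hx a
      rw [← sq_abs (v a)]
      exact (mul_le_mul_of_nonneg_left (le_abs_self _) (sq_nonneg _)).trans
        (mul_le_mul_of_nonneg_right (pow_le_pow_left₀ (abs_nonneg _) h1 2) (abs_nonneg _))

end WeightAlgebra

/-! ### Consistency of weighted averages -/

section Consistency

variable {Ω : Type*} [MeasurableSpace Ω] {P : Measure Ω} [IsProbabilityMeasure P]
  {T : Type*} [MeasurableSpace T] {V : ℕ → Ω → T} {q : ℕ} {ξ : T → Euc q}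

theorem rootN_average_comp {E : Type*} [NormedAddCommGroup E] [InnerProductSpace ℝ E]
    [CompleteSpace E] [MeasurableSpace E] [BorelSpace E]
    (hindep : Pairwise fun i j => IndepFun (V i) (V j) P)
    (hident : ∀ i, IdentDistrib (V i) (V 0) P P) {h : T → E} (hh : Measurable h)
    (hL2 : MemLp (fun ω => h (V 0 ω)) 2 P) :
    RootN P (fun n ω => (n : ℝ)⁻¹ • ∑ i ∈ Finset.range n, h (V i ω)) (∫ ω, h (V 0 ω) ∂P) :=
  rootN_average (V := fun i ω => h (V i ω)) (fun _ _ hij => (hindep hij).comp hh hh)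
    (fun i => (hident i).comp hh) hL2

instance holderTriple_four : ENNReal.HolderTriple 4 4 2 := ⟨by
  rw [← two_mul, show (4 : ℝ≥0∞) = 2 * 2 by norm_num,
    ENNReal.mul_inv (by simp) (by simp), ← mul_assoc, ENNReal.mul_inv_cancel (by simp) (by simp),
    one_mul]⟩

theorem popCov_apply {X : Ω → Euc q} (hX : MemLp X 2 P) (a b : Fin q) :
    popCov P X a b = ∫ ω, X ω a * X ω b ∂P - (∫ ω, X ω ∂P) a * (∫ ω, X ω ∂P) b := by
  have hX1 := hX.integrable one_le_two
  rw [popCov, Matrix.of_apply]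
  have ha := integrable_apply hX1 a
  have hb := integrable_apply hX1 b
  have hab : Integrable (fun ω => X ω a * X ω b) P :=
    (memLp_apply hX a).integrable_mul (memLp_apply hX b)
  set m := ∫ ω, X ω ∂P with hm
  have : ∀ ω, (X ω a - m a) * (X ω b - m b) =
      X ω a * X ω b - m b * X ω a - (m a * X ω b - m a * m b) := fun ω => by ring
  simp_rw [this]
  rw [integral_sub (f := fun ω => X ω a * X ω b - m b * X ω a)
      (g := fun ω => m a * X ω b - m a * m b) (hab.sub (ha.const_mul _))
      ((hb.const_mul _).sub (integrable_const _)),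
    integral_sub hab (ha.const_mul _), integral_sub (hb.const_mul _) (integrable_const _),
    integral_const_mul, integral_const_mul, ← integral_apply hX1, ← integral_apply hX1, ← hm]
  simp [mul_comm]

theorem rootN_sampleMean (hindep : Pairwise fun i j => IndepFun (V i) (V j) P)
    (hident : ∀ i, IdentDistrib (V i) (V 0) P P) (hξ : Measurable ξ)
    (hL4 : MemLp (fun ω => ξ (V 0 ω)) 4 P) (a : Fin q) :
    RootN P (fun n ω => sampleMean n (fun i => ξ (V i ω)) a) ((∫ ω, ξ (V 0 ω) ∂P) a) := by
  have hX2 : MemLp (fun ω => ξ (V 0 ω)) 2 P := hL4.mono_exponent (by norm_num)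
  simp only [sampleMean_apply]
  rw [integral_apply (hX2.integrable one_le_two)]
  exact rootN_average_comp hindep hident (h := fun t => ξ t a) (by fun_prop) (memLp_apply hX2 a)

theorem rootN_sampleCov (hindep : Pairwise fun i j => IndepFun (V i) (V j) P)
    (hident : ∀ i, IdentDistrib (V i) (V 0) P P) (hξ : Measurable ξ)
    (hL4 : MemLp (fun ω => ξ (V 0 ω)) 4 P) (a b : Fin q) :
    RootN P (fun n ω => sampleCov n (fun i => ξ (V i ω)) a b)
      (popCov P (fun ω => ξ (V 0 ω)) a b) := by
  have hX2 : MemLp (fun ω => ξ (V 0 ω)) 2 P := hL4.mono_exponent (by norm_num)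
  rw [popCov_apply hX2]
  have h2 : MemLp (fun ω => ξ (V 0 ω) a * ξ (V 0 ω) b) 2 P :=
    (memLp_apply hL4 b).mul (memLp_apply hL4 a)
  have h1 := rootN_average_comp hindep hident (h := fun t => ξ t a * ξ t b) (by fun_prop) h2
  have hm := rootN_sampleMean hindep hident hξ hL4
  refine (h1.sub ((hm a).smul (hm b))).congr ?_
  filter_upwards [eventually_ge_atTop 1] with n hn ω
  rw [sampleCov_apply hn]
  rfl

theorem rootN_sampleCov_inv (hindep : Pairwise fun i j => IndepFun (V i) (V j) P)
    (hident : ∀ i, IdentDistrib (V i) (V 0) P P) (hξ : Measurable ξ)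
    (hL4 : MemLp (fun ω => ξ (V 0 ω)) 4 P) (hcov : (popCov P fun ω => ξ (V 0 ω)).PosDef)
    (a b : Fin q) :
    RootN P (fun n ω => (sampleCov n (fun i => ξ (V i ω)))⁻¹ a b)
      ((popCov P (fun ω => ξ (V 0 ω)))⁻¹ a b) :=
  RootN.matrix_inv hcov.isUnit (rootN_sampleCov hindep hident hξ hL4) a b

/-- Weighted averages of Hilbert space valued responses with the weights of global Fréchet
regression are root-`n` consistent, uniformly over bounded sets of `x`. -/
theorem exists_regression_rate {H : Type*} [NormedAddCommGroup H] [InnerProductSpace ℝ H]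
    [CompleteSpace H] [MeasurableSpace H] [BorelSpace H] [SecondCountableTopology H]
    (hindep : Pairwise fun i j => IndepFun (V i) (V j) P)
    (hident : ∀ i, IdentDistrib (V i) (V 0) P P) (hξ : Measurable ξ)
    (hL4 : MemLp (fun ω => ξ (V 0 ω)) 4 P) (hcov : (popCov P fun ω => ξ (V 0 ω)).PosDef)
    {y : T → H} (hy : Measurable y) {K : ℝ} (hK : ∀ t, ‖y t‖ ≤ K) {B : ℝ} (hB : 0 ≤ B) :
    ∃ ρ : ℕ → Ω → ℝ, IsOp P ρ rootRate ∧ ∀ (n : ℕ) ω x, ‖x‖ ≤ B →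
      ‖((n : ℝ)⁻¹ • ∑ i ∈ Finset.range n, weight (sampleMean n fun i => ξ (V i ω))
        (sampleCov n fun i => ξ (V i ω)) (ξ (V i ω)) x • y (V i ω)) -
        ∫ ω, weight (∫ ω, ξ (V 0 ω) ∂P) (popCov P fun ω => ξ (V 0 ω)) (ξ (V 0 ω)) x •
          y (V 0 ω) ∂P‖ ≤ ρ n ω := by
  have hX2 : MemLp (fun ω => ξ (V 0 ω)) 2 P := hL4.mono_exponent (by norm_num)
  have hV0 : AEMeasurable (V 0) P := (hident 0).aemeasurable_fst
  have hY2 : MemLp (fun ω => y (V 0 ω)) 2 P :=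
    MemLp.of_bound (hy.comp_aemeasurable hV0).aestronglyMeasurable K (.of_forall fun _ => hK _)
  have hXY2 : ∀ a, MemLp (fun ω => ξ (V 0 ω) a • y (V 0 ω)) 2 P := by
    intro a
    refine MemLp.of_le_mul (memLp_apply hX2 a) (c := K) ?_ (.of_forall fun ω => ?_)
    · have : Measurable fun t => ξ t a • y t := by fun_prop
      exact (this.comp_aemeasurable hV0).aestronglyMeasurable
    · rw [norm_smul, mul_comm]
      exact mul_le_mul_of_nonneg_right (hK _) (norm_nonneg _)
  set mN : ℕ → Ω → Euc q := fun n ω => sampleMean n fun i => ξ (V i ω) with hmN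
  set SN : ℕ → Ω → Matrix (Fin q) (Fin q) ℝ := fun n ω => sampleCov n fun i => ξ (V i ω) with hSN
  set m := ∫ ω, ξ (V 0 ω) ∂P with hm
  set S := popCov P fun ω => ξ (V 0 ω) with hS
  set yN : ℕ → Ω → H := fun n ω => (n : ℝ)⁻¹ • ∑ i ∈ Finset.range n, y (V i ω) with hyN
  set cN : Fin q → ℕ → Ω → H := fun a n ω =>
    (n : ℝ)⁻¹ • (∑ i ∈ Finset.range n, ξ (V i ω) a • y (V i ω)) - mN n ω a • yN n ω with hcN
  set y0 := ∫ ω, y (V 0 ω) ∂P with hy0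
  set c : Fin q → H := fun a => (∫ ω, ξ (V 0 ω) a • y (V 0 ω) ∂P) - m a • y0 with hc
  have rm := rootN_sampleMean hindep hident hξ hL4
  have rS := rootN_sampleCov_inv hindep hident hξ hL4 hcov
  have ry : RootN P yN y0 := rootN_average_comp hindep hident hy hY2
  have rc : ∀ a, RootN P (cN a) (c a) := fun a =>
    (rootN_average_comp hindep hident (h := fun t => ξ t a • y t) (by fun_prop) (hXY2 a)).sub
      ((rm a).smul ry)
  have rW : ∀ b, RootN P (fun n ω => regSlope (SN n ω) (fun a => cN a n ω) b)
      (regSlope S c b) := fun b => RootN.sum _ fun a _ => (rS a b).smul (rc a)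
  have rU : RootN P (fun n ω => regIntercept (mN n ω) (SN n ω) (yN n ω) fun a => cN a n ω)
      (regIntercept m S y0 c) := ry.sub (RootN.sum _ fun b _ => (rm b).smul (rW b))
  refine ⟨fun n ω => ‖regIntercept (mN n ω) (SN n ω) (yN n ω) (fun a => cN a n ω) -
      regIntercept m S y0 c‖ + ∑ b, B * ‖regSlope (SN n ω) (fun a => cN a n ω) b -
      regSlope S c b‖,
    IsOp.add rU (IsOp.sum (V := fun b n ω => B * ‖regSlope (SN n ω) (fun a => cN a n ω) b -
      regSlope S c b‖) _ rootRate_nonneg fun b _ => IsOp.const_mul (rW b) rootRate_nonneg hB), ?_⟩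
  intro n ω x hx
  rw [mean_weight_smul n (fun i => ξ (V i ω)) (fun i => y (V i ω)) (mN n ω) (SN n ω) x,
    (integral_weight_smul (hY2.integrable one_le_two)
      (fun a => (hXY2 a).integrable one_le_two) m S x).2]
  change ‖yN n ω + ∑ a, weightDir (mN n ω) (SN n ω) x a • cN a n ω -
    (y0 + ∑ a, weightDir m S x a • c a)‖ ≤ _
  rw [regression_eq_affine, regression_eq_affine, add_sub_add_comm, ← Finset.sum_sub_distrib]
  refine (norm_add_le _ _).trans (add_le_add_right ((norm_sum_le _ _).trans
    (Finset.sum_le_sum fun b _ => ?_)) _)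
  rw [← smul_sub, norm_smul]
  refine mul_le_mul_of_nonneg_right ((PiLp.norm_apply_le x b).trans hx) (norm_nonneg _)

/-- The mean squared weights are bounded in probability, uniformly over bounded sets of `x`. -/
theorem exists_weight_sq_bound (hindep : Pairwise fun i j => IndepFun (V i) (V j) P)
    (hident : ∀ i, IdentDistrib (V i) (V 0) P P) (hξ : Measurable ξ)
    (hL4 : MemLp (fun ω => ξ (V 0 ω)) 4 P) (hcov : (popCov P fun ω => ξ (V 0 ω)).PosDef)
    {B : ℝ} (hB : 0 ≤ B) :
    ∃ β : ℕ → Ω → ℝ, IsOp P β (fun _ => 1) ∧ ∀ (n : ℕ) ω x, 1 ≤ n → ‖x‖ ≤ B →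
      (n : ℝ)⁻¹ * ∑ i ∈ Finset.range n, weight (sampleMean n fun i => ξ (V i ω))
        (sampleCov n fun i => ξ (V i ω)) (ξ (V i ω)) x ^ 2 ≤ β n ω := by
  refine ⟨_, ?_, fun n ω x hn hx => mean_weight_sq_le hn (fun i => ξ (V i ω)) hx⟩
  have one : ∀ _ : ℕ, (0 : ℝ) ≤ 1 := fun _ => zero_le_one
  have bm := fun a => (rootN_sampleMean hindep hident hξ hL4 a).bounded
  have bS := fun a => (rootN_sampleCov hindep hident hξ hL4 a a).bounded
  have bSi := fun a b => (rootN_sampleCov_inv hindep hident hξ hL4 hcov a b).bounded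
  have cst : ∀ c : ℝ, IsOp P (fun _ _ => c) fun _ => 1 := fun c => by
    simpa using isOp_const (P := P) one (c := c)
  have b1 : ∀ a, IsOp P (fun n ω => ∑ b, |(sampleCov n fun i => ξ (V i ω))⁻¹ a b| *
      (B + |sampleMean n (fun i => ξ (V i ω)) b|)) fun _ => 1 := fun a =>
    IsOp.sum _ one fun b _ => by
      simpa using (bSi a b).mul ((cst B).add (bm b)) one fun n ω => by positivity
  have b2 : ∀ a, IsOp P (fun n ω => (∑ b, |(sampleCov n fun i => ξ (V i ω))⁻¹ a b| *
      (B + |sampleMean n (fun i => ξ (V i ω)) b|)) ^ 2 *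
        |sampleCov n (fun i => ξ (V i ω)) a a|) fun _ => 1 := fun a => by
    have := ((b1 a).mul (b1 a) one fun n ω => Finset.sum_nonneg fun b _ => by positivity).mul
      (bS a) (fun _ => by norm_num) fun n ω => norm_nonneg _
    simpa [pow_two] using this
  exact (cst 2).add (IsOp.const_mul (IsOp.sum _ one fun a _ => b2 a) one (by positivity))

end Consistency

/-! ### The objectives as squared distances -/

section Objectives

variable {p q : ℕ} {ψ : (Euc p → ℝ) → Sph p → ℝ → ℝ} {S : Set (Sph p → ℝ → ℝ)}

/-- The sample objective is, up to a constant, the squared distance to the weighted mean of the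
responses in `L²(Θ × [0, 1])`, as the weights have mean one. -/
theorem sampleObjective_eq (hS : ∀ γ ∈ S, MemLp (Function.uncurry γ) 2 (quantMeasure p))
    {n : ℕ} (hn : 1 ≤ n) (X : ℕ → Euc q) {f : ℕ → Euc p → ℝ}
    (hf : ∀ i, toQuantiles (ψ (f i)) ∈ S) (x : Euc q) :
    ∃ c : ℝ, ∀ γ ∈ S, sampleObjective ψ n X f x γ =
      ‖cls γ - (n : ℝ)⁻¹ • ∑ i ∈ Finset.range n,
        weight (sampleMean n X) (sampleCov n X) (X i) x • slicePoint ψ (f i)‖ ^ 2 + c := by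
  obtain ⟨c, hc⟩ := mean_sq_dist_eq (mean_weight hn X (sampleCov n X) x)
    fun i => slicePoint ψ (f i)
  refine ⟨c, fun γ hγ => ?_⟩
  rw [← hc, sampleObjective]
  simp only [wassDist_toReal (hS _ (hf _)) (hS _ hγ), slicePoint]

theorem popObjective_eq {Ω : Type*} [MeasurableSpace Ω] {P : Measure Ω} [IsProbabilityMeasure P]
    (hS : ∀ γ ∈ S, MemLp (Function.uncurry γ) 2 (quantMeasure p))
    {X : Ω → Euc q} (hX : Integrable X P) {f : Ω → Euc p → ℝ}
    (hf : ∀ ω, toQuantiles (ψ (f ω)) ∈ S)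
    (hm : AEStronglyMeasurable (fun ω => slicePoint ψ (f ω)) P) {K : ℝ}
    (hK : ∀ ω, ‖slicePoint ψ (f ω)‖ ≤ K) (x : Euc q) :
    ∃ c : ℝ, ∀ γ ∈ S, popObjective P ψ X f x γ =
      ‖cls γ - ∫ ω, weight (∫ ω, X ω ∂P) (popCov P X) (X ω) x • slicePoint ψ (f ω) ∂P‖ ^ 2
        + c := by
  obtain ⟨hw, hw1⟩ := integral_weight hX (popCov P X) x
  obtain ⟨c, hc⟩ := integral_sq_dist_eq hw hw1 (Y := fun ω => slicePoint ψ (f ω))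
    (hw.smul_of_top_left (memLp_top_of_bound hm K (.of_forall hK)))
    (hw.mul_bdd (c := K ^ 2) (hm.norm.pow 2) (.of_forall fun ω => by
      rw [norm_pow, norm_norm]; exact pow_le_pow_left₀ (norm_nonneg _) (hK ω) 2))
  refine ⟨c, fun γ hγ => ?_⟩
  rw [← hc, popObjective]
  simp only [wassDist_toReal (hS _ (hf _)) (hS _ hγ), slicePoint]

end Objectives

/-! ### From Wasserstein errors to density errors -/

section Rates

variable {p : ℕ} {D : Set (Euc p)}

theorem supDist_triangle (f g h : Euc p → ℝ) : supDist D f h ≤ supDist D f g + supDist D g h := by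
  refine iSup₂_le fun z hz => ?_
  have h1 : ‖f z - g z‖ₑ ≤ supDist D f g := le_iSup₂ (f := fun z _ => ‖f z - g z‖ₑ) z hz
  have h2 : ‖g z - h z‖ₑ ≤ supDist D g h := le_iSup₂ (f := fun z _ => ‖g z - h z‖ₑ) z hz
  calc ‖f z - h z‖ₑ = ‖(f z - g z) + (g z - h z)‖ₑ := by rw [sub_add_sub_cancel]
    _ ≤ _ := (enorm_add_le _ _).trans (add_le_add h1 h2)

theorem supDist_comm (f g : Euc p → ℝ) : supDist D f g = supDist D g f := by
  unfold supDist
  simp only [← edist_eq_enorm_sub, edist_comm]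

variable {q : ℕ} {Ω : Type*} [MeasurableSpace Ω] {P : Measure Ω} {R M L : ℝ}
  {F : Set (Euc p → ℝ)} {𝒢 : Set (ℝ → ℝ)} {I : Sph p → Set ℝ}
  {ψ : (Euc p → ℝ) → Sph p → ℝ → ℝ} {ψinv : ℝ → (Sph p → ℝ → ℝ) → Euc p → ℝ}
  {C₁ C₂ δ : ℝ → ℝ} {isT : Euc q → (Euc p → ℝ) → Prop} {γ : ℕ → Euc q → Ω → Sph p → ℝ → ℝ}

theorem IsSlicingTransform.bias_nonneg (hψ : IsSlicingTransform D F 𝒢 I ψ ψinv C₁ C₂ δ) {τ : ℝ}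
    (hτ : 0 < τ) : 0 ≤ C₁ τ := by
  refine le_of_tendsto hψ.bias_tendsto ?_
  filter_upwards [eventually_ge_atTop τ] with t ht
  exact hψ.bias_antitone hτ (hτ.trans_le ht) ht

/-- The bias and stability bounds of the approximating inverse: below the threshold, the error is
at most `C₁ τ` plus `C₂ τ` times the distance of the slices. -/
theorem IsSlicingTransform.supDist_le (hψ : IsSlicingTransform D F 𝒢 I ψ ψinv C₁ C₂ δ) {τ : ℝ}
    (hτ : 0 < τ) {m : Euc p → ℝ} (hm : m ∈ F) {l : Sph p → ℝ → ℝ} (hl : l ∈ densitySlices 𝒢 I)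
    {t : ℝ} (ht0 : 0 ≤ t) (hd : sliceDist (ψ m) l ≤ ENNReal.ofReal t) (ht : t < δ τ) :
    supDist D m (ψinv τ l) ≤ ENNReal.ofReal (C₁ τ + C₂ τ * t) := by
  have h2 := hψ.stable_nonneg τ hτ
  rw [ENNReal.ofReal_add (hψ.bias_nonneg hτ) (by positivity), ENNReal.ofReal_mul h2]
  refine (supDist_triangle _ (ψinv τ (ψ m)) _).trans (add_le_add ?_ ?_)
  · rw [supDist_comm]
    exact hψ.bias τ hτ m hm
  · refine (hψ.stable τ hτ m hm l hl (hd.trans_lt ?_)).trans (by gcongr)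
    exact (ENNReal.ofReal_lt_ofReal_iff (hψ.threshold_pos τ hτ)).2 ht

/-- If the Wasserstein error is at most `ρ = O_p(n^{-1/2})`, then with probability close to one the
error of the densities is of order `C₁ + C₂ n^{-a}` for every `a ≤ 2/7 = 1/2 · 4/7`. -/
theorem exists_supDist_rate (hψ : IsSlicingTransform D F 𝒢 I ψ ψinv C₁ C₂ δ)
    (h𝒢 : ∀ g ∈ 𝒢, ∃ a b, IsSmoothDensity R M L a b g) (hM : 0 < M)
    (hT : ∀ x m, isT x m → m ∈ F)
    (hγ : ∀ n x ω, 1 ≤ n → γ n x ω ∈ quantileSlices 𝒢 I)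
    {B : ℝ} {ρ : ℕ → Ω → ℝ} (hρ : IsOp P ρ rootRate)
    (hb : ∀ n ω x m, 1 ≤ n → ‖x‖ ≤ B → isT x m →
      wassDist (toQuantiles (ψ m)) (γ n x ω) ≤ ENNReal.ofReal (ρ n ω))
    {a : ℝ} (ha : a ≤ 2 / 7) {τ : ℕ → ℝ} (hτ : ∀ n, 0 < τ n)
    (hδ : (fun n : ℕ => (n : ℝ) ^ (-a)) =o[atTop] fun n => δ (τ n)) (η : ℝ) (hη : 0 < η) :
    ∃ M : ℝ, 0 < M ∧ ∀ᶠ n in atTop, P {ω | ¬ ∀ x m, ‖x‖ ≤ B → isT x m →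
      supDist D m (ψinv (τ n) (toDensities 𝒢 (γ n x ω))) ≤
        ENNReal.ofReal (M * (C₁ (τ n) + C₂ (τ n) * (n : ℝ) ^ (-a)))} ≤ ENNReal.ofReal η := by
  obtain ⟨K, hK⟩ := exists_sliceDist_le h𝒢 hM I
  obtain ⟨M₁, hM₁, hρ⟩ := hρ η hη
  set M₂ : ℝ := K * M₁ ^ (4 / 7 : ℝ) + 1 with hM₂
  have hM₂1 : 1 ≤ M₂ := by
    have : 0 ≤ (K : ℝ) * M₁ ^ (4 / 7 : ℝ) := by positivity
    linarith
  have hM₂0 : 0 < M₂ := by linarith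
  refine ⟨M₂, hM₂0, ?_⟩
  filter_upwards [hρ, eventually_ge_atTop 1,
    hδ.def (show 0 < 1 / (2 * M₂) by positivity)] with n hn hn1 hδn
  refine (measure_mono fun ω hω => ?_).trans hn
  by_contra hc
  rw [mem_ofPred_eq, not_lt] at hc
  refine hω fun x m hx hm => ?_
  have hn1' : (1 : ℝ) ≤ n := by exact_mod_cast hn1
  have hna : 0 < (n : ℝ) ^ (-a) := Real.rpow_pos_of_pos (by linarith) _
  have hδ0 := hψ.threshold_pos _ (hτ n)
  obtain ⟨hd, hq⟩ := toDensities_spec h𝒢 (hγ n x ω hn1)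
  have hs : sliceDist (ψ m) (toDensities 𝒢 (γ n x ω)) ≤
      ENNReal.ofReal (M₂ * (n : ℝ) ^ (-a)) := by
    have h1 := hK _ (hψ.maps_to m (hT x m hm)) _ hd
    rw [hq] at h1
    have h2 : wassDist (toQuantiles (ψ m)) (γ n x ω) ≤ ENNReal.ofReal (M₁ * rootRate n) :=
      (hb n ω x m hn1 hx hm).trans (ENNReal.ofReal_le_ofReal hc)
    calc _ ≤ _ := h1
      _ ≤ K * ENNReal.ofReal (M₁ * rootRate n) ^ (4 / 7 : ℝ) := by gcongr
      _ = ENNReal.ofReal (K * (M₁ * rootRate n) ^ (4 / 7 : ℝ)) := by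
        rw [ENNReal.ofReal_rpow_of_nonneg (mul_nonneg hM₁.le (rootRate_nonneg n)) (by norm_num),
          ENNReal.ofReal_mul (NNReal.coe_nonneg K), ENNReal.ofReal_coe_nnreal]
      _ ≤ _ := by
        apply ENNReal.ofReal_le_ofReal
        rw [Real.mul_rpow hM₁.le (rootRate_nonneg n), rootRate, ← Real.rpow_mul (by positivity),
          ← mul_assoc]
        refine mul_le_mul (by linarith) ?_ (by positivity) hM₂0.le
        refine Real.rpow_le_rpow_of_exponent_le hn1' ?_
        norm_num
        linarith
  have ht : M₂ * (n : ℝ) ^ (-a) < δ (τ n) := by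
    rw [Real.norm_of_nonneg hna.le, Real.norm_of_nonneg hδ0.le] at hδn
    have := mul_le_mul_of_nonneg_left hδn hM₂0.le
    have e : M₂ * (1 / (2 * M₂) * δ (τ n)) = δ (τ n) / 2 := by field_simp
    rw [e] at this
    linarith
  refine (hψ.supDist_le (hτ n) (hT x m hm) hd (by positivity) hs ht).trans
    (ENNReal.ofReal_le_ofReal ?_)
  have c1 := hψ.bias_nonneg (hτ n)
  nlinarith

/-- Wasserstein errors of order `n^{-1/2}`, uniformly over bounded sets of `x`, give the rates of
the densities. -/
theorem hasRates_of_wassDist_le (hψ : IsSlicingTransform D F 𝒢 I ψ ψinv C₁ C₂ δ)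
    (h𝒢 : ∀ g ∈ 𝒢, ∃ a b, IsSmoothDensity R M L a b g) (hM : 0 < M)
    (hT : ∀ x m, isT x m → m ∈ F)
    (hγ : ∀ n x ω, 1 ≤ n → γ n x ω ∈ quantileSlices 𝒢 I)
    (hρ : ∀ B : ℝ, 0 ≤ B → ∃ ρ : ℕ → Ω → ℝ, IsOp P ρ rootRate ∧
      ∀ n ω x m, 1 ≤ n → ‖x‖ ≤ B → isT x m →
        wassDist (toQuantiles (ψ m)) (γ n x ω) ≤ ENNReal.ofReal (ρ n ω)) :
    HasRates P D C₁ C₂ δ isT fun n τ x ω => ψinv τ (toDensities 𝒢 (γ n x ω)) := by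
  constructor
  · intro x m hm τ hτ hδ η hη
    obtain ⟨ρ, hρ, hb⟩ := hρ ‖x‖ (norm_nonneg x)
    obtain ⟨M', hM', h⟩ := exists_supDist_rate hψ h𝒢 hM hT hγ hρ hb (a := 2 / 7) le_rfl hτ hδ η hη
    refine ⟨M', hM', ?_⟩
    filter_upwards [h] with n hn
    refine (measure_mono fun ω hω hc => ?_).trans hn
    exact absurd (hc x m le_rfl hm) (not_le.2 hω)
  · intro B ε m hB hε hm τ hτ hδ η hη
    obtain ⟨ρ, hρ, hb⟩ := hρ B hB.le
    have ha : 2 / (7 + ε) ≤ 2 / 7 := by gcongr; linarith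
    obtain ⟨M', hM', h⟩ := exists_supDist_rate hψ h𝒢 hM hT hγ hρ hb ha hτ hδ η hη
    refine ⟨M', hM', ?_⟩
    filter_upwards [h] with n hn
    refine (measure_mono fun ω hω hc => ?_).trans hn
    exact absurd (iSup₂_le fun x hx => hc x (m x) hx (hm x hx)) (not_le.2 hω)

end Rates

/-! ### Regression with surrogate densities -/

theorem isSeparable_of_sFinite {X : Type*} [MeasurableSpace X]
    [MeasurableSpace.CountablyGenerated X] (μ : Measure X) [SFinite μ] : MeasureTheory.IsSeparable μ :=
  inferInstance

instance secondCountableTopology_QSpace (p : ℕ) : SecondCountableTopology (QSpace p) :=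
  haveI := isSeparable_of_sFinite (quantMeasure p)
  inferInstance

section Regression

variable {p q k : ℕ} {Ω : Type*} [MeasurableSpace Ω] {P : Measure Ω} [IsProbabilityMeasure P]
  {D : Set (Euc p)} {M₀ L₀ : ℝ} {𝒢 : Set (ℝ → ℝ)} {I : Sph p → Set ℝ}
  {ψ : (Euc p → ℝ) → Sph p → ℝ → ℝ} {ψinv : ℝ → (Sph p → ℝ → ℝ) → Euc p → ℝ}
  {C₁ C₂ δ : ℝ → ℝ} {X : ℕ → Ω → Euc q} {f : ℕ → Ω → Euc p → ℝ}

theorem norm_slicePoint_le {R M L : ℝ} (hR : 0 < R)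
    (h𝒢 : ∀ g ∈ 𝒢, ∃ a b, IsSmoothDensity R M L a b g) {l : Euc p → ℝ}
    (hl : ψ l ∈ densitySlices 𝒢 I) :
    ‖slicePoint ψ l‖ ≤ (measureUnivNNReal (quantMeasure p) : ℝ) ^ (2⁻¹ : ℝ) * R := by
  have hm := (toQuantiles_mem hR h𝒢 hl).2.2
  have := Lp.norm_le_of_ae_bound (p := 2) (f := slicePoint ψ l) hR.le ?_
  · simpa using this
  · filter_upwards [coeFn_cls hm] with z hz
    obtain ⟨a, b, h⟩ := h𝒢 _ (hl.1 z.1).1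
    rw [slicePoint, hz]
    exact h.abs_quantile_le hR.le z.2

/-- Cauchy–Schwarz for the effect of a change of the responses on their weighted mean. -/
theorem mean_weighted_norm_sub_le {H : Type*} [NormedAddCommGroup H] [NormedSpace ℝ H] (n : ℕ)
    (w : ℕ → ℝ) (Y Y' : ℕ → H) :
    ‖(n : ℝ)⁻¹ • ∑ i ∈ Finset.range n, w i • Y' i -
        (n : ℝ)⁻¹ • ∑ i ∈ Finset.range n, w i • Y i‖ ≤
      √((n : ℝ)⁻¹ * ∑ i ∈ Finset.range n, w i ^ 2) *
        √((n : ℝ)⁻¹ * ∑ i ∈ Finset.range n, ‖Y' i - Y i‖ ^ 2) := by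
  rw [← smul_sub, ← Finset.sum_sub_distrib, norm_smul, Real.norm_of_nonneg (by positivity)]
  have h1 : ‖∑ i ∈ Finset.range n, (w i • Y' i - w i • Y i)‖ ≤
      ∑ i ∈ Finset.range n, |w i| * ‖Y' i - Y i‖ := by
    refine (norm_sum_le _ _).trans (le_of_eq (Finset.sum_congr rfl fun i _ => ?_))
    rw [← smul_sub, norm_smul, Real.norm_eq_abs]
  have h2 := Real.sum_mul_le_sqrt_mul_sqrt (Finset.range n) (fun i => |w i|)
    fun i => ‖Y' i - Y i‖
  simp only [sq_abs] at h2
  rw [Real.sqrt_mul (by positivity), Real.sqrt_mul (by positivity)]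
  calc _ ≤ (n : ℝ)⁻¹ * (√(∑ i ∈ Finset.range n, w i ^ 2) *
        √(∑ i ∈ Finset.range n, ‖Y' i - Y i‖ ^ 2)) := by gcongr; exact h1.trans h2
    _ = √(n : ℝ)⁻¹ * √(n : ℝ)⁻¹ * (√(∑ i ∈ Finset.range n, w i ^ 2) *
        √(∑ i ∈ Finset.range n, ‖Y' i - Y i‖ ^ 2)) := by
      rw [Real.mul_self_sqrt (by positivity)]
    _ = _ := by ring

/-- Existence, uniqueness and rates when the densities are replaced by surrogates whose mean
squared `L²` error is `O_p(n⁻¹)`. -/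
theorem hasRates_of_surrogates (hk : 2 ≤ k) (hD : IsCompact D) (h𝒢 : IsUnivariateClass k 𝒢)
    (hΓconv : Convex ℝ (quantileSlices 𝒢 I)) (hΓclosed : IsClosedSlices (quantileSlices 𝒢 I))
    (hψ : IsSlicingTransform D (densityClass D k M₀ L₀) 𝒢 I ψ ψinv C₁ C₂ δ)
    (hf : ∀ i ω, f i ω ∈ densityClass D k M₀ L₀)
    (hmeas : ∀ i, Measurable fun ω => (X i ω, f i ω))
    (hindep : iIndepFun (fun i ω => (X i ω, f i ω)) P)
    (hident : ∀ i, IdentDistrib (fun ω => (X i ω, f i ω)) (fun ω => (X 0 ω, f 0 ω)) P P)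
    (hmoment : MemLp (X 0) 4 P) (hcov : (popCov P (X 0)).PosDef) :
    (∀ x m m',
      IsTarget (densityClass D k M₀ L₀) ψ (quantileSlices 𝒢 I)
        (popObjective P ψ (X 0) (f 0) x) m →
      IsTarget (densityClass D k M₀ L₀) ψ (quantileSlices 𝒢 I)
        (popObjective P ψ (X 0) (f 0) x) m' → m = m') ∧
    (∀ x, HasUniqueArgmin (quantileSlices 𝒢 I) (popObjective P ψ (X 0) (f 0) x)) ∧
    ∀ f' : ℕ → ℕ → Ω → Euc p → ℝ, (∀ n i ω, f' n i ω ∈ densityClass D k M₀ L₀) →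
      IsOp P (fun n ω => (n : ℝ)⁻¹ * ∑ i ∈ Finset.range n,
        (l2Dist (f' n i ω) (f i ω)).toReal ^ 2) (fun n => (n : ℝ)⁻¹) →
      (∀ n x ω, 1 ≤ n → HasUniqueArgmin (quantileSlices 𝒢 I)
        (sampleObjective ψ n (fun i => X i ω) (fun i => f' n i ω) x)) ∧
      ∀ γ : ℕ → Euc q → Ω → Sph p → ℝ → ℝ,
        (∀ n x ω, 1 ≤ n → IsArgmin (quantileSlices 𝒢 I)
          (sampleObjective ψ n (fun i => X i ω) (fun i => f' n i ω) x) (γ n x ω)) →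
        HasRates P D C₁ C₂ δ
          (fun x => IsTarget (densityClass D k M₀ L₀) ψ (quantileSlices 𝒢 I)
            (popObjective P ψ (X 0) (f 0) x))
          (fun n τ x ω => ψinv τ (toDensities 𝒢 (γ n x ω))) := by
  obtain ⟨R, M, L, hR, hM, hG⟩ := h𝒢.exists_isSmoothDensity hk
  obtain ⟨C, hC⟩ := exists_wassDist_le hψ hG
  have hmem : ∀ γ ∈ quantileSlices 𝒢 I, MemLp (Function.uncurry γ) 2 (quantMeasure p) :=
    fun γ hγ => hγ.2.2
  have hF : ∀ l ∈ densityClass D k M₀ L₀, toQuantiles (ψ l) ∈ quantileSlices 𝒢 I :=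
    fun l hl => toQuantiles_mem hR hG (hψ.maps_to l hl)
  -- the data, as elements of a space on which the response is measurable in `L²(Θ × [0, 1])`
  let A : Set (Euc q × (Euc p → ℝ)) := {v | v.2 ∈ densityClass D k M₀ L₀}
  let V : ℕ → Ω → A := fun i ω => ⟨(X i ω, f i ω), hf i ω⟩
  let ξ : A → Euc q := fun v => v.1.1
  let y : A → QSpace p := fun v => slicePoint ψ v.1.2
  have hVm : ∀ i, Measurable (V i) := fun i => (hmeas i).subtype_mk
  have hVi : Pairwise fun i j => IndepFun (V i) (V j) P := fun i j hij =>
    (iIndepFun_codRestrict hindep hf).indepFun hij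
  have hVd : ∀ i, IdentDistrib (V i) (V 0) P P := fun i =>
    identDistrib_codRestrict (hmeas i) (hmeas 0) (hident i) (hf i) (hf 0)
  have hξ : Measurable ξ := measurable_fst.comp measurable_subtype_coe
  have hy : Measurable y := by
    refine measurable_slicePoint hD (fun l hl => hmem _ (hF l hl)) hC (fun z => ?_) fun v => v.2
    exact (measurable_pi_apply z).comp (measurable_snd.comp measurable_subtype_coe)
  set K := (measureUnivNNReal (quantMeasure p) : ℝ) ^ (2⁻¹ : ℝ) * R
  have hK : ∀ v, ‖y v‖ ≤ K := fun v => norm_slicePoint_le hR hG (hψ.maps_to _ v.2)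
  have hX1 : Integrable (X 0) P := hmoment.integrable (by norm_num)
  have pop := popObjective_eq (ψ := ψ) hmem hX1 (fun ω => hF _ (hf 0 ω))
    (hy.comp (hVm 0)).aestronglyMeasurable fun ω => hK (V 0 ω)
  obtain ⟨ω₀⟩ : Nonempty Ω := nonempty_of_isProbabilityMeasure P
  have hne : (quantileSlices 𝒢 I).Nonempty := ⟨_, hF _ (hf 0 ω₀)⟩
  refine ⟨fun x m m' hm hm' => ?_, fun x => ?_, fun f' hf' hop => ⟨fun n x ω hn => ?_, ?_⟩⟩
  · obtain ⟨c, hc⟩ := pop x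
    obtain ⟨K', hK'⟩ := exists_sliceDist_le hG hM I
    have h0 := (hasUniqueArgmin hmem hΓconv hΓclosed hne hc).2 _ _ hm.2 hm'.2
    have h1 := hK' _ (hψ.maps_to m hm.1) _ (hψ.maps_to m' hm'.1)
    rw [h0, ENNReal.zero_rpow_of_pos (by norm_num), mul_zero, nonpos_iff_eq_zero] at h1
    exact hψ.injective m hm.1 m' hm'.1 h1
  · obtain ⟨c, hc⟩ := pop x
    exact hasUniqueArgmin hmem hΓconv hΓclosed hne hc
  · obtain ⟨c, hc⟩ := sampleObjective_eq (ψ := ψ) hmem hn (fun i => X i ω)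
      (f := fun i => f' n i ω) (fun i => hF _ (hf' n i ω)) x
    exact hasUniqueArgmin hmem hΓconv hΓclosed hne hc
  intro γ hγ
  refine hasRates_of_wassDist_le hψ hG hM (fun x m h => h.1) (fun n x ω hn => (hγ n x ω hn).1) ?_
  intro B hB
  obtain ⟨ρ, hρ, hρb⟩ := exists_regression_rate hVi hVd hξ hmoment hcov hy hK hB
  obtain ⟨β, hβ, hβb⟩ := exists_weight_sq_bound hVi hVd hξ hmoment hcov hB
  -- the error caused by the surrogates
  set e : ℕ → Ω → ℝ := fun n ω => √((n : ℝ)⁻¹ * ∑ i ∈ Finset.range n,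
    (l2Dist (f' n i ω) (f i ω)).toReal ^ 2) with he
  have hop' : IsOp P e rootRate := by
    refine IsOp.sqrt ?_ rootRate_nonneg
    simp only [rootRate_sq, he]
    refine hop.mono (.of_forall fun n ω => le_of_eq (Real.sq_sqrt ?_))
    positivity
  have hβ' : IsOp P (fun n ω => √(max (β n ω) 0)) fun _ => 1 := by
    refine IsOp.sqrt ?_ fun _ => zero_le_one
    have h0 : IsOp P (fun _ _ => (0 : ℝ)) fun _ : ℕ => (1 : ℝ) := by
      simpa using isOp_const (P := P) (r := fun _ => 1) (c := 0) fun _ => zero_le_one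
    refine IsOp.combine hβ h0 fun M₁ M₂ h₁ _ => ⟨M₁, h₁, .of_forall fun n ω e₁ _ => ?_⟩
    rw [Real.sq_sqrt (le_max_right _ _)]
    simp only [one_pow]
    exact max_le e₁ (by linarith)
  have herr : IsOp P (fun n ω => √(max (β n ω) 0) * (C * e n ω)) rootRate := by
    have := hβ'.mul (hop'.const_mul rootRate_nonneg C.2) (fun _ => zero_le_one)
      fun n ω => mul_nonneg C.2 (Real.sqrt_nonneg _)
    simpa using this
  refine ⟨_, hρ.add herr, fun n ω x m hn hx hm => ?_⟩
  obtain ⟨c, hc⟩ := pop x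
  obtain ⟨c', hc'⟩ := sampleObjective_eq (ψ := ψ) hmem hn (fun i => X i ω)
    (f := fun i => f' n i ω) (fun i => hF _ (hf' n i ω)) x
  refine (IsArgmin.wassDist_le hmem hΓconv hc hc' hm.2 (hγ n x ω hn)).trans ?_
  rw [← ofReal_norm, norm_sub_rev]
  apply ENNReal.ofReal_le_ofReal
  set w : ℕ → ℝ := fun i => weight (sampleMean n fun i => X i ω) (sampleCov n fun i => X i ω)
    (X i ω) x
  set u := ∫ ω, weight (∫ ω, X 0 ω ∂P) (popCov P (X 0)) (X 0 ω) x • slicePoint ψ (f 0 ω) ∂P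
  have b1 : ‖(n : ℝ)⁻¹ • ∑ i ∈ Finset.range n, w i • slicePoint ψ (f i ω) - u‖ ≤ ρ n ω :=
    hρb n ω x hx
  have b2 := mean_weighted_norm_sub_le n w (fun i => slicePoint ψ (f i ω))
    fun i => slicePoint ψ (f' n i ω)
  have b3 : √((n : ℝ)⁻¹ * ∑ i ∈ Finset.range n, w i ^ 2) ≤ √(max (β n ω) 0) :=
    Real.sqrt_le_sqrt ((hβb n ω x hn hx).trans (le_max_left _ _))
  have b4 : √((n : ℝ)⁻¹ * ∑ i ∈ Finset.range n,
      ‖slicePoint ψ (f' n i ω) - slicePoint ψ (f i ω)‖ ^ 2) ≤ C * e n ω := by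
    refine Real.sqrt_le_iff.2 ⟨mul_nonneg C.2 (Real.sqrt_nonneg _), ?_⟩
    rw [mul_pow, he, Real.sq_sqrt (by positivity), mul_left_comm,
      Finset.mul_sum (a := (C : ℝ) ^ 2)]
    refine mul_le_mul_of_nonneg_left (Finset.sum_le_sum fun i _ => ?_) (by positivity)
    have fin : l2Dist (f' n i ω) (f i ω) ≠ ∞ :=
      ((density_memLp hD (hf' n i ω)).sub (density_memLp hD (hf i ω))).2.ne
    have h1 := hC _ (hf' n i ω) _ (hf i ω)
    rw [slicePoint, slicePoint, ← wassDist_toReal (hmem _ (hF _ (hf' n i ω)))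
      (hmem _ (hF _ (hf i ω))), ← mul_pow]
    refine pow_le_pow_left₀ ENNReal.toReal_nonneg ?_ 2
    have := ENNReal.toReal_mono (ENNReal.mul_ne_top (by simp) fin) h1
    simpa using this
  calc _ = ‖((n : ℝ)⁻¹ • ∑ i ∈ Finset.range n, w i • slicePoint ψ (f i ω) - u) +
        ((n : ℝ)⁻¹ • ∑ i ∈ Finset.range n, w i • slicePoint ψ (f' n i ω) -
          (n : ℝ)⁻¹ • ∑ i ∈ Finset.range n, w i • slicePoint ψ (f i ω))‖ := by
        congr 1; abel
    _ ≤ _ := (norm_add_le _ _).trans (add_le_add b1 (b2.trans (mul_le_mul b3 b4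
      (Real.sqrt_nonneg _) (Real.sqrt_nonneg _))))

end Regression

/-! ### Averages of conditionally independent observations -/

section ConditionalVariance

variable {Ω S E : Type*} [MeasurableSpace Ω] [MeasurableSpace S] [MeasurableSpace E]
  {P : Measure Ω} [IsProbabilityMeasure P] {T : Ω → S} {Q : Kernel S E} [IsMarkovKernel Q]

/-- `Y₁` and `Y₂` are independent with distribution `Q t`, given `T = t`. -/
def IsCondPair (P : Measure Ω) (T : Ω → S) (Q : Kernel S E) (Y₁ Y₂ : Ω → E) : Prop :=
  ∀ B A₁ A₂, MeasurableSet B → MeasurableSet A₁ → MeasurableSet A₂ →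
    P (T ⁻¹' B ∩ (Y₁ ⁻¹' A₁ ∩ Y₂ ⁻¹' A₂)) = ∫⁻ ω in T ⁻¹' B, Q (T ω) A₁ * Q (T ω) A₂ ∂P

/-- Pairs that are conditionally independent have the joint law given by the kernel. -/
theorem IsCondPair.map_eq {Y₁ Y₂ : Ω → E} (h : IsCondPair P T Q Y₁ Y₂) (hT : Measurable T)
    (h₁ : Measurable Y₁) (h₂ : Measurable Y₂) :
    P.map (fun ω => (T ω, Y₁ ω, Y₂ ω)) = (P.map T) ⊗ₘ (Q ×ₖ Q) := by
  have : IsProbabilityMeasure (P.map T) := Measure.isProbabilityMeasure_map hT.aemeasurable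
  have hm : Measurable fun ω => (T ω, Y₁ ω, Y₂ ω) := hT.prodMk (h₁.prodMk h₂)
  have : IsProbabilityMeasure (P.map fun ω => (T ω, Y₁ ω, Y₂ ω)) :=
    Measure.isProbabilityMeasure_map hm.aemeasurable
  refine Measure.ext_prod₃ fun {B A₁ A₂} hB hA₁ hA₂ => ?_
  rw [Measure.map_apply hm (hB.prod (hA₁.prod hA₂)),
    Measure.compProd_apply_prod hB (hA₁.prod hA₂), setLIntegral_map hB _ hT]
  · simp only [Kernel.prod_apply_prod]
    exact h B A₁ A₂ hB hA₁ hA₂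
  · exact Kernel.measurable_coe _ (hA₁.prod hA₂)

theorem IsCondPair.integral_eq {Y₁ Y₂ : Ω → E} (h : IsCondPair P T Q Y₁ Y₂) (hT : Measurable T)
    (h₁ : Measurable Y₁) (h₂ : Measurable Y₂) {F : S × E × E → ℝ} (hF : Measurable F) {K : ℝ}
    (hK : ∀ v, |F v| ≤ K) :
    ∫ ω, F (T ω, Y₁ ω, Y₂ ω) ∂P = ∫ ω, ∫ y₁, ∫ y₂, F (T ω, y₁, y₂) ∂Q (T ω) ∂Q (T ω) ∂P := by
  have : IsProbabilityMeasure (P.map T) := Measure.isProbabilityMeasure_map hT.aemeasurable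
  have hm : Measurable fun ω => (T ω, Y₁ ω, Y₂ ω) := hT.prodMk (h₁.prodMk h₂)
  rw [← integral_map hm.aemeasurable hF.aestronglyMeasurable (f := F), h.map_eq hT h₁ h₂,
    Measure.integral_compProd, integral_map hT.aemeasurable]
  · refine integral_congr_ae (.of_forall fun ω => ?_)
    dsimp only
    rw [Kernel.prod_apply, integral_prod]
    exact Integrable.of_bound (hF.comp measurable_prodMk_left).aestronglyMeasurable K
      (.of_forall fun v => hK _)
  · exact (hF.stronglyMeasurable.integral_kernel_prod_right'
      (κ := Q ×ₖ Q)).aestronglyMeasurable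
  · exact Integrable.of_bound hF.aestronglyMeasurable K (.of_forall hK)

/-- The variance of a mean of conditionally independent variables `G (Y j)` with values in
`[0, K]` and conditional mean at most `M`. -/
theorem lintegral_sq_average_sub_le (hT : Measurable T) {Y : ℕ → Ω → E}
    (hY : ∀ j, Measurable (Y j)) (h : ∀ j l, j ≠ l → IsCondPair P T Q (Y j) (Y l)) {G : E → ℝ}
    (hG : Measurable G) {K M : ℝ} (h0 : ∀ y, 0 ≤ G y) (hK : ∀ y, G y ≤ K)
    (hM : ∀ ω, ∫ y, G y ∂Q (T ω) ≤ M) {N : ℕ} (hN : 0 < N) :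
    ∫⁻ ω, ENNReal.ofReal
      (((N : ℝ)⁻¹ * ∑ j ∈ Finset.range N, G (Y j ω) - ∫ y, G y ∂Q (T ω)) ^ 2) ∂P ≤
      ENNReal.ofReal (K * M / N) := by
  set μ : S → ℝ := fun s => ∫ y, G y ∂Q s with hμ
  have hμm : Measurable μ :=
    (StronglyMeasurable.integral_kernel (hG.stronglyMeasurable) (κ := Q)).measurable
  have hGi : ∀ s, Integrable G (Q s) := fun s =>
    Integrable.of_bound hG.aestronglyMeasurable K (.of_forall fun y => by
      rw [Real.norm_of_nonneg (h0 y)]; exact hK y)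
  have hμ0 : ∀ s, 0 ≤ μ s := fun s => integral_nonneg h0
  have hμK : ∀ s, μ s ≤ K := fun s => by
    have := integral_mono (hGi s) (integrable_const K) hK
    simpa using this
  obtain ⟨ω₀⟩ : Nonempty Ω := nonempty_of_isProbabilityMeasure P
  have hK0 : 0 ≤ K := (h0 (Y 0 ω₀)).trans (hK _)
  have hd : ∀ s y, |G y - μ s| ≤ K := fun s y => by
    rw [abs_sub_le_iff]
    exact ⟨by linarith [hK y, hμ0 s], by linarith [h0 y, hμK s]⟩
  have hb : ∀ s y y', |(G y - μ s) * (G y' - μ s)| ≤ K * K := fun s y y' => by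
    rw [abs_mul]
    exact mul_le_mul (hd _ _) (hd _ _) (abs_nonneg _) hK0
  have hint : ∀ j l, Integrable (fun ω => (G (Y j ω) - μ (T ω)) * (G (Y l ω) - μ (T ω))) P :=
    fun j l => Integrable.of_bound (by fun_prop) (K * K) (.of_forall fun ω => hb _ _ _)
  have hcross : ∀ j l, j ≠ l →
      ∫ ω, (G (Y j ω) - μ (T ω)) * (G (Y l ω) - μ (T ω)) ∂P = 0 := by
    intro j l hjl
    have := (h j l hjl).integral_eq hT (hY j) (hY l)
      (F := fun v => (G v.2.1 - μ v.1) * (G v.2.2 - μ v.1)) (by fun_prop) (fun v => hb _ _ _)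
    refine this.trans ?_
    refine integral_eq_zero_of_ae (.of_forall fun ω => ?_)
    refine integral_eq_zero_of_ae (.of_forall fun y => ?_)
    dsimp only
    rw [integral_const_mul, integral_sub (hGi _) (integrable_const _)]
    simp [hμ]
  have hdiag : ∀ j, ∫ ω, (G (Y j ω) - μ (T ω)) * (G (Y j ω) - μ (T ω)) ∂P ≤ K * M := by
    intro j
    have := (h j (j + 1) (by simp)).integral_eq hT (hY j) (hY (j + 1))
      (F := fun v => (G v.2.1 - μ v.1) * (G v.2.1 - μ v.1)) (by fun_prop) (fun v => hb _ _ _)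
    refine this.le.trans ?_
    have hle : ∀ ω, ∫ y, ∫ _, (G y - μ (T ω)) * (G y - μ (T ω)) ∂Q (T ω) ∂Q (T ω) ≤ K * M := by
      intro ω
      simp only [integral_const, probReal_univ, one_smul]
      -- `(G - μ)² ≤ K G - 2 μ G + μ²`, and the integral of `G` is `μ`
      have hle' : ∀ y, (G y - μ (T ω)) * (G y - μ (T ω)) ≤
          (K - 2 * μ (T ω)) * G y + μ (T ω) ^ 2 := fun y => by
        nlinarith [h0 y, hK y, mul_nonneg (h0 y) (sub_nonneg.2 (hK y))]
      have hi : Integrable (fun y => (K - 2 * μ (T ω)) * G y + μ (T ω) ^ 2) (Q (T ω)) :=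
        ((hGi _).const_mul _).add (integrable_const _)
      refine (integral_mono (Integrable.of_bound (by fun_prop) (K * K)
        (.of_forall fun y => hb _ _ _)) hi hle').trans ?_
      rw [integral_add ((hGi _).const_mul _) (integrable_const _), integral_const_mul]
      have e : ∫ y, G y ∂Q (T ω) = μ (T ω) := rfl
      rw [e]
      simp only [integral_const, probReal_univ, one_smul]
      nlinarith [mul_le_mul_of_nonneg_left (hM ω) hK0, hμ0 (T ω), e]
    have hmono := integral_mono_of_nonneg (μ := P)
      (f := fun ω => ∫ y, ∫ _, (G y - μ (T ω)) * (G y - μ (T ω)) ∂Q (T ω) ∂Q (T ω))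
      (.of_forall fun ω => integral_nonneg fun y => integral_nonneg fun _ => mul_self_nonneg _)
      (integrable_const (K * M)) (.of_forall hle)
    simpa using hmono
  have hN' : (N : ℝ) ≠ 0 := by positivity
  have hexp : ∀ ω, ((N : ℝ)⁻¹ * ∑ j ∈ Finset.range N, G (Y j ω) - μ (T ω)) ^ 2 =
      (N : ℝ)⁻¹ ^ 2 * ∑ j ∈ Finset.range N, ∑ l ∈ Finset.range N,
        (G (Y j ω) - μ (T ω)) * (G (Y l ω) - μ (T ω)) := by
    intro ω
    rw [← Finset.sum_mul_sum, ← sq, ← mul_pow, Finset.sum_sub_distrib]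
    congr 1
    simp only [Finset.sum_const, Finset.card_range, nsmul_eq_mul]
    field_simp
  have hsumi : Integrable (fun ω => ∑ j ∈ Finset.range N, ∑ l ∈ Finset.range N,
      (G (Y j ω) - μ (T ω)) * (G (Y l ω) - μ (T ω))) P :=
    integrable_finsetSum _ fun j _ => integrable_finsetSum _ fun l _ => hint j l
  rw [← ofReal_integral_eq_lintegral_ofReal
    ((hsumi.const_mul _).congr (.of_forall fun ω => (hexp ω).symm))
    (.of_forall fun ω => sq_nonneg _)]
  apply ENNReal.ofReal_le_ofReal
  refine (integral_congr_ae (.of_forall hexp)).le.trans ?_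
  rw [integral_const_mul,
    integral_finsetSum _ fun j _ => integrable_finsetSum _ fun l _ => hint j l]
  have hsum : ∀ j ∈ Finset.range N, ∫ ω, ∑ l ∈ Finset.range N,
      (G (Y j ω) - μ (T ω)) * (G (Y l ω) - μ (T ω)) ∂P ≤ K * M := by
    intro j hj
    rw [integral_finsetSum _ fun l _ => hint j l, Finset.sum_eq_single j
      (fun l _ hl => hcross j l hl.symm) (fun h => absurd hj h)]
    exact hdiag j
  calc _ ≤ (N : ℝ)⁻¹ ^ 2 * ∑ _j ∈ Finset.range N, K * M := by gcongr with j hj; exact hsum j hj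
    _ = K * M / N := by
      simp only [Finset.sum_const, Finset.card_range, nsmul_eq_mul]
      field_simp

end ConditionalVariance

/-! ### Mean and bias of kernel density estimators -/

section Bias

variable {p : ℕ}

/-- The mean `b^{-p} ∫ κ((z - y) / b) dν(y)` of a kernel estimator of `ν`. -/
def kernelMean (κ : Euc p → ℝ) (b : ℝ) (ν : Measure (Euc p)) (z : Euc p) : ℝ :=
  ∫ y, (b ^ p)⁻¹ * κ (b⁻¹ • (z - y)) ∂ν

/-- Second order Taylor bound, for a function whose second derivative is bounded by `L` on a
ball. -/
theorem abs_second_difference_le {h : Euc p → ℝ} {U : Set (Euc p)} (hU : IsOpen U) {k : ℕ}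
    (hk : 2 ≤ k) (hh : ContDiffOn ℝ k h U) {L : ℝ}
    (hL : ∀ z ∈ U, ‖iteratedFDerivWithin ℝ 2 h U z‖ ≤ L) {z v : Euc p}
    (hz : Metric.closedBall z ‖v‖ ⊆ U) : |h (z - v) + h (z + v) - 2 * h z| ≤ 2 * L * ‖v‖ ^ 2 := by
  have hzU : z ∈ U := hz (Metric.mem_closedBall_self (norm_nonneg v))
  have hh2 : ContDiffOn ℝ 2 h U := hh.of_le (by exact_mod_cast hk)
  have hd : DifferentiableOn ℝ h U := hh2.differentiableOn (by norm_num)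
  have hd1 : DifferentiableOn ℝ (fderivWithin ℝ h U) U :=
    (hh2.fderivWithin hU.uniqueDiffOn (m := 1) (by norm_num)).differentiableOn (by norm_num)
  have hb : ∀ y ∈ U, ‖fderivWithin ℝ (fderivWithin ℝ h U) U y‖ ≤ L := by
    intro y hy
    refine le_trans (le_of_eq ?_) (hL y hy)
    rw [← norm_iteratedFDerivWithin_fderivWithin hU.uniqueDiffOn hy,
      ← norm_iteratedFDerivWithin_fderivWithin hU.uniqueDiffOn hy, norm_iteratedFDerivWithin_zero]
  set B := Metric.closedBall z ‖v‖
  have hBc : Convex ℝ B := convex_closedBall z ‖v‖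
  have hzB : z ∈ B := Metric.mem_closedBall_self (norm_nonneg v)
  have hL0 : 0 ≤ L := (norm_nonneg _).trans (hL z hzU)
  have hlip : ∀ y ∈ B, ‖fderivWithin ℝ h U y - fderivWithin ℝ h U z‖ ≤ L * ‖v‖ := by
    intro y hy
    have := hBc.norm_image_sub_le_of_norm_hasFDerivWithin_le
      (fun x hx => ((hd1 x (hz hx)).hasFDerivWithinAt).mono hz) (fun x hx => hb x (hz hx)) hzB hy
    refine this.trans (mul_le_mul_of_nonneg_left ?_ hL0)
    simpa [B, dist_eq_norm] using hy
  have key : ∀ y ∈ B, ‖h y - h z - fderivWithin ℝ h U z (y - z)‖ ≤ L * ‖v‖ * ‖y - z‖ :=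
    fun y hy => hBc.norm_image_sub_le_of_norm_hasFDerivWithin_le'
      (fun x hx => ((hd x (hz hx)).hasFDerivWithinAt).mono hz) hlip hzB hy
  have h1 := key (z - v) (by simp [B])
  have h2 := key (z + v) (by simp [B])
  simp only [sub_sub_cancel_left, map_neg, norm_neg, add_sub_cancel_left, Real.norm_eq_abs,
    abs_le] at h1 h2
  rw [abs_le]
  constructor <;> nlinarith

variable {k : ℕ} {κ : Euc p → ℝ}

theorem IsKernel.continuous (hκ : IsKernel k κ) : Continuous κ := hκ.contDiff.continuous

theorem IsKernel.integrable (hκ : IsKernel k κ) : Integrable κ :=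
  hκ.continuous.integrable_of_hasCompactSupport hκ.compactSupport

theorem IsKernel.exists_radius (hκ : IsKernel k κ) : ∃ r : ℝ, 0 < r ∧ ∀ u, r < ‖u‖ → κ u = 0 := by
  obtain ⟨r, hr⟩ := hκ.compactSupport.isBounded.exists_pos_norm_le
  refine ⟨r, hr.1, fun u hu => by_contra fun h => ?_⟩
  exact absurd (hr.2 u (subset_tsupport _ h)) (not_le.2 hu)

variable {D : Set (Euc p)} {ε M L : ℝ} {h : Euc p → ℝ} {b r : ℝ} {z : Euc p}

/-- Substitute `y = z + b u`; the kernel is symmetric. -/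
theorem kernelMean_withDensity (hκ : IsKernel k κ) (hhm : Measurable h) (h0 : ∀ z, 0 ≤ h z)
    (hb : 0 < b) :
    kernelMean κ b (volume.withDensity fun z => ENNReal.ofReal (h z)) z =
      ∫ u, κ u * h (z + b • u) := by
  have e1 : kernelMean κ b (volume.withDensity fun z => ENNReal.ofReal (h z)) z =
      ∫ y, (b ^ p)⁻¹ * κ (b⁻¹ • (z - y)) * h y := by
    rw [kernelMean, integral_withDensity_eq_integral_toReal_smul hhm.ennreal_ofReal (by simp)]
    refine integral_congr_ae (.of_forall fun y => ?_)
    simp only [ENNReal.toReal_ofReal (h0 y), smul_eq_mul]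
    ring
  have e2 : ∫ y, (b ^ p)⁻¹ * κ (b⁻¹ • (z - y)) * h y =
      ∫ y, (b ^ p)⁻¹ * (κ (b⁻¹ • y) * h (z + y)) := by
    rw [← integral_add_left_eq_self _ z]
    refine integral_congr_ae (.of_forall fun y => ?_)
    simp only [sub_add_cancel_left, smul_neg, hκ.symmetric]
    ring
  have e3 := Measure.integral_comp_inv_smul_of_nonneg (volume : Measure (Euc p))
    (fun u => κ u * h (z + b • u)) hb.le
  simp only [smul_inv_smul₀ hb.ne', finrank_euclideanSpace, Fintype.card_fin, smul_eq_mul] at e3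
  rw [e1, e2, integral_const_mul, e3, inv_mul_cancel_left₀ (pow_ne_zero p hb.ne')]

theorem kernelMean_le (hκ : IsKernel k κ) (hhm : Measurable h) (h0 : ∀ z, 0 ≤ h z)
    (hr : ∀ u, r < ‖u‖ → κ u = 0) (hb : 0 < b) (hbr : b * r < ε) (hz : z ∈ D)
    (hM : ∀ y ∈ Metric.thickening ε D, h y ≤ M) :
    kernelMean κ b (volume.withDensity fun z => ENNReal.ofReal (h z)) z ≤ M := by
  rw [kernelMean_withDensity hκ hhm h0 hb]
  have hle : ∀ u, κ u * h (z + b • u) ≤ κ u * M := by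
    intro u
    by_cases hu : r < ‖u‖
    · simp [hr u hu]
    · refine mul_le_mul_of_nonneg_left (hM _ ?_) (hκ.nonneg u)
      refine Metric.mem_thickening_iff.2 ⟨z, hz, ?_⟩
      rw [dist_eq_norm, add_sub_cancel_left, norm_smul, Real.norm_of_nonneg hb.le]
      exact (mul_le_mul_of_nonneg_left (not_lt.1 hu) hb.le).trans_lt hbr
  refine (integral_mono_of_nonneg (.of_forall fun u => mul_nonneg (hκ.nonneg u) (h0 _))
    (hκ.integrable.mul_const M) (.of_forall hle)).trans ?_
  rw [integral_mul_const, hκ.integral_eq_one, one_mul]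

/-- The bias of a kernel estimator at a point of `D` is of order `b²`, as the kernel is
symmetric. -/
theorem abs_kernelMean_sub_le (hk : 2 ≤ k) (hκ : IsKernel k κ) (hhm : Measurable h)
    (h0 : ∀ z, 0 ≤ h z) (hhi : Integrable h) (hr : ∀ u, r < ‖u‖ → κ u = 0) (hb : 0 < b)
    (hbr : b * r < ε) (hz : z ∈ D) (hh : ContDiffOn ℝ k h (Metric.thickening ε D))
    (hL : ∀ y ∈ Metric.thickening ε D,
      ‖iteratedFDerivWithin ℝ 2 h (Metric.thickening ε D) y‖ ≤ L) :
    |kernelMean κ b (volume.withDensity fun z => ENNReal.ofReal (h z)) z - h z| ≤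
      L * r ^ 2 * b ^ 2 := by
  rw [kernelMean_withDensity hκ hhm h0 hb]
  obtain ⟨K, hK⟩ := hκ.bounded
  have hi : Integrable fun u => κ u * h (z + b • u) := by
    refine Integrable.bdd_mul (c := K) ?_ hκ.continuous.aestronglyMeasurable
      (.of_forall fun u => ?_)
    · exact (hhi.comp_add_left z).comp_smul hb.ne'
    · rw [Real.norm_of_nonneg (hκ.nonneg u)]
      exact hK u
  have hi' : Integrable fun u => κ u * h (z - b • u) := by
    refine (hi.comp_neg).congr (.of_forall fun u => ?_)
    simp only [hκ.symmetric, smul_neg, ← sub_eq_add_neg]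
  have e : ∫ u, κ u * h (z - b • u) = ∫ u, κ u * h (z + b • u) := by
    rw [← integral_neg_eq_self]
    simp only [hκ.symmetric, smul_neg, sub_neg_eq_add]
  have e2 : 2 * ((∫ u, κ u * h (z + b • u)) - h z) =
      ∫ u, κ u * (h (z - b • u) + h (z + b • u) - 2 * h z) := by
    have : ∀ u, κ u * (h (z - b • u) + h (z + b • u) - 2 * h z) =
        κ u * h (z - b • u) + κ u * h (z + b • u) - κ u * (2 * h z) := fun u => by ring
    simp_rw [this]
    have hadd : Integrable fun u => κ u * h (z - b • u) + κ u * h (z + b • u) := hi'.add hi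
    rw [integral_sub hadd (hκ.integrable.mul_const _), integral_add hi' hi, e,
      integral_mul_const, hκ.integral_eq_one]
    ring
  have hle : ∀ u, ‖κ u * (h (z - b • u) + h (z + b • u) - 2 * h z)‖ ≤
      κ u * (2 * (L * r ^ 2 * b ^ 2)) := by
    intro u
    rw [norm_mul, Real.norm_of_nonneg (hκ.nonneg u), Real.norm_eq_abs]
    by_cases hu : r < ‖u‖
    · simp [hr u hu]
    have hv : ‖b • u‖ ≤ b * r := by
      rw [norm_smul, Real.norm_of_nonneg hb.le]
      exact mul_le_mul_of_nonneg_left (not_lt.1 hu) hb.le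
    refine mul_le_mul_of_nonneg_left ?_ (hκ.nonneg u)
    have hsub : Metric.closedBall z ‖b • u‖ ⊆ Metric.thickening ε D := fun y hy =>
      Metric.mem_thickening_iff.2 ⟨z, hz, (Metric.mem_closedBall.1 hy).trans_lt (hv.trans_lt hbr)⟩
    have hL0 : 0 ≤ L := (norm_nonneg _).trans
      (hL z (hsub (Metric.mem_closedBall_self (norm_nonneg _))))
    refine (abs_second_difference_le Metric.isOpen_thickening hk hh hL hsub).trans ?_
    have : ‖b • u‖ ^ 2 ≤ (b * r) ^ 2 := pow_le_pow_left₀ (norm_nonneg _) hv 2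
    nlinarith
  have hbound := norm_integral_le_of_norm_le (hκ.integrable.mul_const _) (.of_forall hle)
  rw [← e2, integral_mul_const, hκ.integral_eq_one, one_mul, Real.norm_eq_abs, abs_mul,
    abs_two] at hbound
  linarith

end Bias

/-! ### Truncation, normalization and projection -/

section Projection

variable {p k : ℕ} {D : Set (Euc p)} {M₀ L₀ : ℝ}

theorem l2Dist_sq_eq (hD : IsCompact D) {u w : Euc p → ℝ} (hu : ∀ z, z ∉ D → u z = 0)
    (hw : ∀ z, z ∉ D → w z = 0) (hi : IntegrableOn (fun z => (u z - w z) ^ 2) D) :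
    l2Dist u w ^ 2 = ENNReal.ofReal (∫ z in D, (u z - w z) ^ 2) := by
  rw [l2Dist, eLpNorm_two_sq, ofReal_integral_eq_lintegral_ofReal hi
    (.of_forall fun z => sq_nonneg _), ← lintegral_indicator hD.measurableSet]
  refine lintegral_congr fun z => ?_
  by_cases hz : z ∈ D
  · rw [indicator_of_mem hz, enorm_sq_eq_ofReal]
  · rw [indicator_of_notMem hz, hu z hz, hw z hz]
    simp

theorem volume_pos_of_density (hD : IsCompact D) {f : Euc p → ℝ}
    (hf : f ∈ densityClass D k M₀ L₀) : 0 < volume.real D := by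
  refine (measureReal_nonneg).lt_of_ne' fun h => ?_
  have h0 : volume D = 0 := by
    simpa [Measure.real, ENNReal.toReal_eq_zero_iff, hD.measure_lt_top.ne] using h
  have := hf.2.2.1
  rw [density_eq_indicator hf, integral_indicator hD.measurableSet,
    Measure.restrict_eq_zero.2 h0, integral_zero_measure] at this
  exact zero_ne_one this

/-- Truncation to `D`, normalization and projection to the density class enlarge the squared `L²`
error of an estimator of `h` on `D` by at most a constant factor: this is clear if the estimator
has mass close to the mass of `h` on `D`, and otherwise its error is bounded away from zero. -/
theorem exists_sq_l2Dist_projection_le (hD : IsCompact D) {M : ℝ} (hM : 0 < M) :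
    ∃ C : ℝ, 0 ≤ C ∧ ∀ h g f f' : Euc p → ℝ, Measurable h →
      (∀ z ∈ D, h z ≤ M ∧ 1 / M ≤ h z) → Continuous g → f ∈ densityClass D k M₀ L₀ →
      (∀ z ∈ D, f z = h z / ∫ u in D, h u) →
      IsProjectionTo (densityClass D k M₀ L₀) (D.indicator fun z => g z / ∫ u in D, g u) f' →
      (l2Dist f' f).toReal ^ 2 ≤ C * ∫ z in D, (g z - h z) ^ 2 := by
  set v := volume.real D with hv
  set a₀ := v / M with ha₀
  refine ⟨72 / a₀ ^ 2 + 72 * M ^ 2 * v ^ 2 / a₀ ^ 4 + 4 * M₀ ^ 2 * v ^ 2 / a₀ ^ 2,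
    by positivity, ?_⟩
  intro h g f f' hhm hhb hg hf hfh hf'
  have hv0 : 0 < v := volume_pos_of_density hD hf
  have ha₀0 : 0 < a₀ := by positivity
  have hDm := hD.measurableSet
  have : IsFiniteMeasure (volume.restrict D) := ⟨by
    rw [Measure.restrict_apply_univ]; exact hD.measure_lt_top⟩
  -- integrability of bounded functions on `D`
  have bdd : ∀ {u : Euc p → ℝ} {K : ℝ}, Measurable u → (∀ z ∈ D, |u z| ≤ K) → IntegrableOn u D :=
    fun {u K} hu hK => Integrable.of_bound hu.aestronglyMeasurable K
      ((ae_restrict_iff' hDm).2 (.of_forall hK))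
  have hh0 : ∀ z ∈ D, 0 ≤ h z := fun z hz => le_trans (by positivity) (hhb z hz).2
  have hhM : ∀ z ∈ D, |h z| ≤ M := fun z hz => by
    rw [abs_of_nonneg (hh0 z hz)]; exact (hhb z hz).1
  have hhi : IntegrableOn h D := bdd hhm hhM
  have hgi : IntegrableOn g D := hg.continuousOn.integrableOn_compact hD
  obtain ⟨G, hG⟩ := hD.exists_bound_of_continuousOn hg.continuousOn
  have hdb : ∀ z ∈ D, |g z - h z| ≤ G + M := fun z hz =>
    (abs_sub _ _).trans (add_le_add (hG z hz) (hhM z hz))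
  have hgm := hg.measurable
  have hdi : IntegrableOn (fun z => (g z - h z) ^ 2) D :=
    bdd (K := (G + M) ^ 2) (by fun_prop) fun z hz => by
      rw [abs_pow]; exact pow_le_pow_left₀ (abs_nonneg _) (hdb z hz) 2
  set T := ∫ z in D, (g z - h z) ^ 2 with hT
  have hT0 : 0 ≤ T := integral_nonneg fun z => sq_nonneg _
  set a := ∫ u in D, h u with ha
  set s := ∫ u in D, g u with hs
  have haa : a₀ ≤ a := by
    have := setIntegral_mono_on (integrable_const (1 / M)) hhi hDm fun z hz => (hhb z hz).2
    rw [setIntegral_const, smul_eq_mul] at this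
    rw [ha₀, div_eq_mul_one_div]
    exact this
  have ha0 : 0 < a := ha₀0.trans_le haa
  have hsa : (s - a) ^ 2 ≤ v * T := by
    have h1 := sq_integral_mul_le (μ := volume.restrict D) (f := fun _ => (1 : ℝ))
      (g := fun z => g z - h z) (integrable_const _) hdi (by
        simp only [one_mul]
        exact hgi.sub hhi)
    simp only [one_mul, one_pow] at h1
    rw [integral_sub hgi hhi, setIntegral_const, smul_eq_mul, mul_one] at h1
    exact h1
  have hfm := measurable_density hD hf
  have hfm' := measurable_density hD hf'.1
  have hf0 : ∀ z, z ∉ D → f z = 0 := fun z hz => density_eq_zero hf hz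
  have hf0' : ∀ z, z ∉ D → f' z = 0 := fun z hz => density_eq_zero hf'.1 hz
  by_cases hcase : |s - a| ≤ a / 2
  · -- the error of the normalized estimator `e` is split as `(g - h) / s + h (1 / s - 1 / a)`
    rw [abs_le] at hcase
    have hs0 : a / 2 ≤ s := by linarith
    have hsp : 0 < s := by linarith
    set e : Euc p → ℝ := D.indicator fun z => g z / s with he
    have hem : Measurable e := (hgm.div_const s).indicator hDm
    have hef : ∀ z ∈ D, e z - f z = (g z - h z) / s + h z * (a - s) / (s * a) := fun z hz => by
      rw [he, indicator_of_mem hz, hfh z hz]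
      field_simp
      ring
    have hb1 : ∀ z ∈ D, (e z - f z) ^ 2 ≤
        8 / a₀ ^ 2 * (g z - h z) ^ 2 + 8 * M ^ 2 * (v * T) / a₀ ^ 4 := by
      intro z hz
      have q1 : ((g z - h z) / s) ^ 2 ≤ 4 / a₀ ^ 2 * (g z - h z) ^ 2 := by
        rw [div_pow, div_eq_mul_inv, mul_comm]
        refine mul_le_mul_of_nonneg_right ?_ (sq_nonneg _)
        rw [inv_eq_one_div, div_le_div_iff₀ (by positivity) (by positivity)]
        nlinarith
      have q2 : (h z * (a - s) / (s * a)) ^ 2 ≤ 4 * M ^ 2 * (v * T) / a₀ ^ 4 := by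
        rw [div_pow, mul_pow, show 4 * M ^ 2 * (v * T) / a₀ ^ 4 =
          M ^ 2 * (v * T) / (a₀ ^ 4 / 4) by field_simp]
        refine div_le_div₀ (by positivity) ?_ (by positivity) ?_
        · refine mul_le_mul (pow_le_pow_left₀ (hh0 z hz) (hhb z hz).1 2) ?_ (sq_nonneg _)
            (sq_nonneg _)
          rw [← neg_sub, neg_sq]
          exact hsa
        · have : a₀ ^ 2 / 2 ≤ s * a := by nlinarith
          calc a₀ ^ 4 / 4 = (a₀ ^ 2 / 2) ^ 2 := by ring
            _ ≤ _ := pow_le_pow_left₀ (by positivity) this 2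
      rw [hef z hz]
      refine (add_sq_le).trans ?_
      calc _ ≤ 2 * (4 / a₀ ^ 2 * (g z - h z) ^ 2 + 4 * M ^ 2 * (v * T) / a₀ ^ 4) := by gcongr
        _ = _ := by ring
    have hi1 : IntegrableOn (fun z => 8 / a₀ ^ 2 * (g z - h z) ^ 2 +
        8 * M ^ 2 * (v * T) / a₀ ^ 4) D := (hdi.const_mul _).add (integrable_const _)
    have hi2 : IntegrableOn (fun z => (e z - f z) ^ 2) D :=
      Integrable.mono' hi1 (by fun_prop) ((ae_restrict_iff' hDm).2 (.of_forall fun z hz => by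
        rw [Real.norm_of_nonneg (sq_nonneg _)]; exact hb1 z hz))
    have hle : ∫ z in D, (e z - f z) ^ 2 ≤ (8 / a₀ ^ 2 + 8 * M ^ 2 * v ^ 2 / a₀ ^ 4) * T := by
      refine (setIntegral_mono_on hi2 hi1 hDm hb1).trans (le_of_eq ?_)
      rw [integral_add (hdi.const_mul _) (integrable_const _), integral_const_mul,
        setIntegral_const, smul_eq_mul, ← hT, ← hv]
      ring
    have htri : l2Dist f' f ≤ 3 * l2Dist e f := by
      have t1 : l2Dist f' f ≤ l2Dist f' e + l2Dist e f := by
        have := eLpNorm_add_le (μ := volume) (p := 2) (f := fun z => f' z - e z)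
          (g := fun z => e z - f z) (by fun_prop) (by fun_prop) (by norm_num)
        refine le_trans (le_of_eq ?_) this
        rw [l2Dist]
        congr 1
        ext z
        simp
      have t2 : l2Dist f e = l2Dist e f := by
        rw [l2Dist, l2Dist, ← eLpNorm_neg]
        congr 1
        ext z
        simp
      calc _ ≤ 2 * l2Dist e f + l2Dist e f := t1.trans (by
            gcongr; rw [← t2]; exact hf'.2 f hf)
        _ = _ := by ring
    have hsq : l2Dist f' f ^ 2 ≤
        ENNReal.ofReal (9 * ((8 / a₀ ^ 2 + 8 * M ^ 2 * v ^ 2 / a₀ ^ 4) * T)) := by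
      calc _ ≤ (3 * l2Dist e f) ^ 2 := by gcongr
        _ = 9 * ENNReal.ofReal (∫ z in D, (e z - f z) ^ 2) := by
          rw [mul_pow, l2Dist_sq_eq (u := e) hD (fun z hz => indicator_of_notMem hz _) hf0 hi2]
          norm_num only
        _ ≤ _ := by
          rw [ENNReal.ofReal_mul (by norm_num), ENNReal.ofReal_ofNat]
          gcongr
    rw [← ENNReal.toReal_pow]
    refine (ENNReal.toReal_mono ENNReal.ofReal_ne_top hsq).trans ?_
    rw [ENNReal.toReal_ofReal (by positivity)]
    have : 0 ≤ 4 * M₀ ^ 2 * v ^ 2 / a₀ ^ 2 * T := by positivity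
    calc _ = (72 / a₀ ^ 2 + 72 * M ^ 2 * v ^ 2 / a₀ ^ 4) * T := by ring
      _ ≤ _ := by linarith
  · -- the masses differ by more than `a / 2`, so that `T` is bounded below
    have h1 : a₀ ^ 2 / 4 ≤ v * T := by
      refine le_trans ?_ hsa
      rw [← sq_abs (s - a)]
      nlinarith
    have hb1 : ∀ z ∈ D, (f' z - f z) ^ 2 ≤ M₀ ^ 2 := fun z hz => by
      have := hf.1 z
      have := hf'.1.1 z
      have := (hf.2.2.2.2.1 z hz).1
      have := (hf'.1.2.2.2.2.1 z hz).1
      exact sq_le_sq' (by linarith) (by linarith)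
    have hi2 : IntegrableOn (fun z => (f' z - f z) ^ 2) D :=
      bdd (K := M₀ ^ 2) (by fun_prop) fun z hz => by
        rw [abs_of_nonneg (sq_nonneg _)]; exact hb1 z hz
    rw [← ENNReal.toReal_pow, l2Dist_sq_eq hD hf0' hf0 hi2, ENNReal.toReal_ofReal
      (integral_nonneg fun z => sq_nonneg _)]
    have h2 := setIntegral_mono_on hi2 (integrable_const (M₀ ^ 2)) hDm hb1
    rw [setIntegral_const, smul_eq_mul, ← hv] at h2
    have h3 : v * M₀ ^ 2 ≤ 4 * M₀ ^ 2 * v ^ 2 / a₀ ^ 2 * T := by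
      have := mul_le_mul_of_nonneg_left h1 (show 0 ≤ 4 * M₀ ^ 2 * v / a₀ ^ 2 by positivity)
      calc v * M₀ ^ 2 = 4 * M₀ ^ 2 * v / a₀ ^ 2 * (a₀ ^ 2 / 4) := by field_simp
        _ ≤ _ := this
        _ = _ := by ring
    have : 0 ≤ (72 / a₀ ^ 2 + 72 * M ^ 2 * v ^ 2 / a₀ ^ 4) * T := by positivity
    calc _ ≤ _ := h2.trans h3
      _ ≤ _ := by linarith

end Projection

/-! ### The error of the estimated densities -/

section Sampling

variable {p q k : ℕ} {Ω : Type*} [MeasurableSpace Ω] {P : Measure Ω}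
  {D : Set (Euc p)} {M₀ L₀ : ℝ} {X : ℕ → Ω → Euc q} {f : ℕ → Ω → Euc p → ℝ}
  {ν : ℕ → Ω → Measure (Euc p)} {Z : ℕ → ℕ → Ω → Euc p} {N : ℕ → ℕ → ℕ} {b : ℕ → ℕ → ℝ}
  {κ : Euc p → ℝ}

/-- With sample sizes of order `n^{(p+4)/4}`, both the squared bias `b⁴` and the variance
`(N b^p)⁻¹` of the kernel estimators are of order `n⁻¹`. -/
theorem IsDensitySampling.exists_bandwidth_bound (hs : IsDensitySampling P D k X f ν Z N b) :
    ∃ C : ℝ, 0 ≤ C ∧ ∀ᶠ n : ℕ in atTop, ∀ i < n, 0 < N n i ∧ 0 < b n i ∧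
      b n i ^ 4 ≤ C * (n : ℝ)⁻¹ ∧ (N n i * b n i ^ p : ℝ)⁻¹ ≤ C * (n : ℝ)⁻¹ := by
  obtain ⟨c, hc, hN⟩ := hs.sample_sizes
  obtain ⟨c₁, c₂, hc₁, hb⟩ := hs.bandwidths
  set e : ℝ := 1 / ((p : ℝ) + 4) with he
  have hp4 : (0 : ℝ) < (p : ℝ) + 4 := by positivity
  set A : ℝ := c ^ (-(4 * e)) with hA
  have hA0 : 0 < A := Real.rpow_pos_of_pos hc _
  refine ⟨(c₂ ^ 4 + (c₁ ^ p)⁻¹) * A, by positivity, ?_⟩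
  filter_upwards [hN, hb, eventually_ge_atTop 1] with n hN hb hn i hi
  have hn0 : (0 : ℝ) < n := by exact_mod_cast hn
  have hNc := hN i hi
  obtain ⟨hb1, hb2⟩ := hb i hi
  have hpos : 0 < c * (n : ℝ) ^ (((p : ℝ) + 4) / 4) := by positivity
  have hN0 : (0 : ℝ) < N n i := hpos.trans_le hNc
  set t : ℝ := (N n i : ℝ) ^ (-e) with ht
  have ht0 : 0 < t := Real.rpow_pos_of_pos hN0 _
  have hb0 : 0 < b n i := (mul_pos hc₁ ht0).trans_le hb1
  have ht4 : t ^ 4 ≤ A * (n : ℝ)⁻¹ := by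
    have e1 : t ^ 4 = (N n i : ℝ) ^ (-(4 * e)) := by
      rw [ht, ← Real.rpow_natCast, ← Real.rpow_mul hN0.le]
      congr 1
      push_cast
      ring
    have e2 : (c * (n : ℝ) ^ (((p : ℝ) + 4) / 4)) ^ (-(4 * e)) = A * (n : ℝ)⁻¹ := by
      rw [Real.mul_rpow hc.le (by positivity), ← Real.rpow_mul hn0.le,
        show ((p : ℝ) + 4) / 4 * -(4 * e) = -1 by rw [he]; field_simp, Real.rpow_neg_one]
    rw [e1, ← e2]
    exact Real.rpow_le_rpow_of_nonpos hpos hNc (by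
      have : 0 < e := by positivity
      linarith)
  have htN : (N n i : ℝ) * t ^ (p + 4) = 1 := by
    rw [ht, ← Real.rpow_natCast, ← Real.rpow_mul hN0.le,
      show -e * ((p + 4 : ℕ) : ℝ) = -1 by rw [he]; push_cast; field_simp, Real.rpow_neg_one,
      mul_inv_cancel₀ hN0.ne']
  have hr : 0 ≤ A * (n : ℝ)⁻¹ := by positivity
  have hinv : 0 < (c₁ ^ p)⁻¹ := by positivity
  refine ⟨by exact_mod_cast hN0, hb0, ?_, ?_⟩
  · calc b n i ^ 4 ≤ (c₂ * t) ^ 4 := pow_le_pow_left₀ hb0.le hb2 4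
      _ = c₂ ^ 4 * t ^ 4 := mul_pow _ _ _
      _ ≤ c₂ ^ 4 * (A * (n : ℝ)⁻¹) := by gcongr
      _ ≤ (c₂ ^ 4 + (c₁ ^ p)⁻¹) * (A * (n : ℝ)⁻¹) := by gcongr; linarith
      _ = _ := by ring
  · calc (N n i * b n i ^ p : ℝ)⁻¹ ≤ (N n i * (c₁ * t) ^ p : ℝ)⁻¹ := by gcongr
      _ = (c₁ ^ p)⁻¹ * t ^ 4 := by
        have : (N n i * (c₁ * t) ^ p : ℝ) * ((c₁ ^ p)⁻¹ * t ^ 4) = 1 := by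
          rw [mul_pow]
          calc _ = (c₁ ^ p * (c₁ ^ p)⁻¹) * (N n i * t ^ (p + 4)) := by ring
            _ = 1 := by rw [htN, mul_inv_cancel₀ (by positivity), one_mul]
        exact inv_eq_of_mul_eq_one_right this
      _ ≤ (c₁ ^ p)⁻¹ * (A * (n : ℝ)⁻¹) := by gcongr
      _ ≤ (c₂ ^ 4 + (c₁ ^ p)⁻¹) * (A * (n : ℝ)⁻¹) := by
        gcongr
        linarith [show 0 ≤ c₂ ^ 4 by positivity]
      _ = _ := by ring

/-- The identity, as a Markov kernel from probability measures on `ℝ^p` to `ℝ^p`. -/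
def parentKernel (p : ℕ) : Kernel (ProbabilityMeasure (Euc p)) (Euc p) :=
  ⟨fun μ => μ, measurable_subtype_coe⟩

instance (p : ℕ) : IsMarkovKernel (parentKernel p) := ⟨fun μ => μ.2⟩

/-- The random parent distribution as a probability measure. -/
def parent (hν : ∀ i ω, IsProbabilityMeasure (ν i ω)) (i : ℕ) (ω : Ω) :
    ProbabilityMeasure (Euc p) :=
  ⟨ν i ω, hν i ω⟩

theorem IsDensitySampling.isCondPair (hs : IsDensitySampling P D k X f ν Z N b)
    (hν : ∀ i ω, IsProbabilityMeasure (ν i ω)) (i : ℕ) {j l : ℕ} (hjl : j ≠ l) :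
    IsCondPair P (parent hν i) (parentKernel p) (Z i j) (Z i l) := by
  rintro B A₁ A₂ ⟨B', hB', rfl⟩ hA₁ hA₂
  have h := hs.conditional_law {(i, j), (i, l)} (fun c => if c.2 = j then A₁ else A₂)
    (ν i ⁻¹' B') (fun c => by split_ifs <;> assumption) ?_
  · have hne : (i, j) ≠ (i, l) := fun h => hjl (Prod.mk.inj h).2
    simp only [Finset.mem_insert, Finset.mem_singleton, iInter_iInter_eq_or_left,
      iInter_iInter_eq_left, Finset.prod_pair hne, if_true, if_neg hjl.symm] at h
    exact h
  · have hle : MeasurableSpace.comap (fun ω => (X i ω, ν i ω)) inferInstance ≤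
        ⨆ l, MeasurableSpace.comap (fun ω => (X l ω, ν l ω)) inferInstance :=
      le_iSup (fun l => MeasurableSpace.comap (fun ω => (X l ω, ν l ω)) inferInstance) i
    exact hle _ ⟨univ ×ˢ B', MeasurableSet.univ.prod hB', by ext; simp⟩

theorem measurable_kernelEstimate_sub (hs : IsDensitySampling P D k X f ν Z N b)
    (hν : ∀ i ω, IsProbabilityMeasure (ν i ω)) (hκ : IsKernel k κ) (i m : ℕ) (β : ℝ) :
    Measurable fun w : Ω × Euc p =>
      kernelEstimate κ β m (fun j => Z i j w.1) w.2 - kernelMean κ β (ν i w.1) w.2 := by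
  have hκm := hκ.continuous.measurable
  have hT : Measurable (parent hν i) := (hs.measurable_parent i).subtype_mk
  refine Measurable.sub ?_ ?_
  · unfold kernelEstimate
    refine Measurable.const_mul (Finset.measurable_sum _ fun j _ => ?_) _
    have := hs.measurable_obs i j
    fun_prop
  · have hF : StronglyMeasurable fun v : (Ω × Euc p) × Euc p =>
        (β ^ p)⁻¹ * κ (β⁻¹ • (v.1.2 - v.2)) :=
      (show Measurable _ by fun_prop).stronglyMeasurable
    exact (hF.integral_kernel_prod_right'
      (κ := (parentKernel p).comap (fun w : Ω × Euc p => parent hν i w.1) (by fun_prop))).measurable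

/-- The integrated variance of a kernel estimator is of order `(N b^p)⁻¹`. -/
theorem IsDensitySampling.lintegral_sq_kernelEstimate_sub_le [IsProbabilityMeasure P]
    (hs : IsDensitySampling P D k X f ν Z N b) (hν : ∀ i ω, IsProbabilityMeasure (ν i ω))
    (hκ : IsKernel k κ) {K M : ℝ} (hK : ∀ u, κ u ≤ K) (i : ℕ) {m : ℕ} (hm : 0 < m) {β : ℝ}
    (hβ : 0 < β) (hM : ∀ ω, ∀ z ∈ D, kernelMean κ β (ν i ω) z ≤ M) (hD : MeasurableSet D) :
    ∫⁻ ω, (∫⁻ z in D, ENNReal.ofReal ((kernelEstimate κ β m (fun j => Z i j ω) z -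
      kernelMean κ β (ν i ω) z) ^ 2)) ∂P ≤ ENNReal.ofReal (K * M * (m * β ^ p)⁻¹) * volume D := by
  have hT : Measurable (parent hν i) := (hs.measurable_parent i).subtype_mk
  have hmeas := measurable_kernelEstimate_sub hs hν hκ i m β
  rw [lintegral_lintegral_swap (hmeas.pow_const 2).ennreal_ofReal.aemeasurable]
  refine (setLIntegral_mono' hD (g := fun _ => ENNReal.ofReal (K * M * (m * β ^ p)⁻¹))
    fun z hz => ?_).trans (by rw [setLIntegral_const])
  have hκm := hκ.continuous.measurable
  have h := lintegral_sq_average_sub_le (P := P) hT (hs.measurable_obs i)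
    (fun j l hjl => hs.isCondPair hν i hjl) (G := fun y => (β ^ p)⁻¹ * κ (β⁻¹ • (z - y)))
    (by fun_prop) (K := (β ^ p)⁻¹ * K) (M := M)
    (fun y => mul_nonneg (by positivity) (hκ.nonneg _))
    (fun y => mul_le_mul_of_nonneg_left (hK _) (by positivity)) (fun ω => hM ω z hz) hm
  refine le_trans (le_of_eq (lintegral_congr fun ω => ?_)) (h.trans (le_of_eq ?_))
  · rw [kernelEstimate, mul_inv, mul_assoc, Finset.mul_sum]
    rfl
  · congr 1
    rw [mul_inv]
    ring

/-- The mean squared `L²` error of the estimated densities is of order `n⁻¹`. -/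
theorem IsDensitySampling.isOp_l2Dist [IsProbabilityMeasure P]
    (hs : IsDensitySampling P D k X f ν Z N b) (hk : 2 ≤ k) (hD : IsCompact D)
    (hf : ∀ i ω, f i ω ∈ densityClass D k M₀ L₀) (hκ : IsKernel k κ)
    {f' : ℕ → ℕ → Ω → Euc p → ℝ}
    (hf' : ∀ n i ω, IsProjectionTo (densityClass D k M₀ L₀)
      (truncatedKernelEstimate D κ (b n i) (N n i) (fun j => Z i j ω)) (f' n i ω)) :
    IsOp P (fun n ω => (n : ℝ)⁻¹ * ∑ i ∈ Finset.range n,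
      (l2Dist (f' n i ω) (f i ω)).toReal ^ 2) fun n => (n : ℝ)⁻¹ := by
  obtain ⟨ε, M, L, hε, hM, htr⟩ := hs.truncation
  have hν : ∀ i ω, IsProbabilityMeasure (ν i ω) := fun i ω => (htr i ω).1
  choose h hhm hh0 hνh hhb hhc hhL hfh using fun i ω => (htr i ω).2
  have hhi : ∀ i ω, Integrable (h i ω) := fun i ω => by
    refine (lintegral_ofReal_ne_top_iff_integrable (hhm i ω).aestronglyMeasurable
      (.of_forall (hh0 i ω))).1 ?_
    have := (hν i ω).measure_univ
    rw [hνh, withDensity_apply _ MeasurableSet.univ, Measure.restrict_univ] at this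
    rw [this]
    exact ENNReal.one_ne_top
  have hDsub : D ⊆ Metric.thickening ε D := Metric.self_subset_thickening hε D
  obtain ⟨Cp, hCp, hproj⟩ := exists_sq_l2Dist_projection_le (k := k) (M₀ := M₀) (L₀ := L₀) hD hM
  obtain ⟨K, hK⟩ := hκ.bounded
  have hK0 : 0 ≤ K := (hκ.nonneg 0).trans (hK 0)
  obtain ⟨r, hr0, hr⟩ := hκ.exists_radius
  obtain ⟨C, hC, hbw⟩ := hs.exists_bandwidth_bound
  set v := volume.real D with hv
  have hvD : volume D = ENNReal.ofReal v := by
    rw [hv, Measure.real, ENNReal.ofReal_toReal hD.measure_lt_top.ne]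
  have hv0 : 0 ≤ v := measureReal_nonneg
  -- the bandwidths tend to zero uniformly
  have hsmall : ∀ᶠ n : ℕ in atTop, ∀ i < n, b n i * r < ε := by
    have ht : Tendsto (fun n : ℕ => C * r ^ 4 * (n : ℝ)⁻¹) atTop (𝓝 0) := by
      simpa using tendsto_inv_atTop_nhds_zero_nat.const_mul (C * r ^ 4)
    filter_upwards [hbw, ht.eventually_lt_const (show 0 < ε ^ 4 by positivity)] with n h1 h2 i hi
    refine lt_of_pow_lt_pow_left₀ 4 hε.le (lt_of_le_of_lt ?_ h2)
    rw [mul_pow]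
    calc _ ≤ C * (n : ℝ)⁻¹ * r ^ 4 := by gcongr; exact (h1 i hi).2.2.1
      _ = _ := by ring
  set W : ℕ → ℕ → Ω → ℝ≥0∞ := fun n i ω => ∫⁻ z in D, ENNReal.ofReal
    ((kernelEstimate κ (b n i) (N n i) (fun j => Z i j ω) z -
      kernelMean κ (b n i) (ν i ω) z) ^ 2) with hW
  have hWm : ∀ n i, Measurable (W n i) := fun n i => by
    have := measurable_kernelEstimate_sub hs hν hκ i (N n i) (b n i)
    exact Measurable.lintegral_prod_right' (f := fun w : Ω × Euc p => ENNReal.ofReal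
      ((kernelEstimate κ (b n i) (N n i) (fun j => Z i j w.1) w.2 -
        kernelMean κ (b n i) (ν i w.1) w.2) ^ 2)) (by fun_prop)
  set c : ℝ := 2 * Cp * (K * M * C * v) + 2 * Cp * ((L * r ^ 2) ^ 2 * C * v) with hc
  refine IsOp.of_lintegral_le (C := c)
    (U := fun n ω => ENNReal.ofReal (n : ℝ)⁻¹ * ∑ i ∈ Finset.range n,
      (ENNReal.ofReal (2 * Cp) * W n i ω +
        ENNReal.ofReal (2 * Cp * ((L * r ^ 2) ^ 2 * (C * (n : ℝ)⁻¹) * v))))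
    (fun n => ?_) ?_ ?_ ?_
  · refine (Measurable.const_mul (Finset.measurable_sum _ fun i _ => ?_) _).aemeasurable
    have := hWm n i
    fun_prop
  · filter_upwards [eventually_ge_atTop 1] with n hn
    positivity
  · filter_upwards [hbw, hsmall, eventually_ge_atTop 1] with n h1 h2 hn
    have hn0 : (0 : ℝ) < n := by exact_mod_cast hn
    rw [lintegral_const_mul _ (Finset.measurable_sum _ fun i _ => by
      have := hWm n i
      fun_prop), lintegral_finsetSum _ fun i _ => by
      have := hWm n i
      fun_prop]
    have hone : ∀ i ∈ Finset.range n, ∫⁻ ω, (ENNReal.ofReal (2 * Cp) * W n i ω +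
        ENNReal.ofReal (2 * Cp * ((L * r ^ 2) ^ 2 * (C * (n : ℝ)⁻¹) * v))) ∂P ≤
        ENNReal.ofReal (c * (n : ℝ)⁻¹) := by
      intro i hi
      rw [Finset.mem_range] at hi
      obtain ⟨hN, hb, -, hvar⟩ := h1 i hi
      have hle := hs.lintegral_sq_kernelEstimate_sub_le hν hκ hK i hN hb (fun ω z hz => by
        rw [hνh i ω]
        exact kernelMean_le hκ (hhm i ω) (hh0 i ω) hr hb (h2 i hi) hz
          fun y hy => (hhb i ω y hy).1) hD.measurableSet
      rw [lintegral_add_right _ measurable_const, lintegral_const_mul _ (hWm n i), lintegral_const,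
        measure_univ, mul_one]
      calc _ ≤ ENNReal.ofReal (2 * Cp) *
            (ENNReal.ofReal (K * M * (C * (n : ℝ)⁻¹)) * ENNReal.ofReal v) +
            ENNReal.ofReal (2 * Cp * ((L * r ^ 2) ^ 2 * (C * (n : ℝ)⁻¹) * v)) := by
            gcongr
            refine hle.trans ?_
            rw [hvD]
            gcongr
        _ = ENNReal.ofReal (c * (n : ℝ)⁻¹) := by
            rw [← ENNReal.ofReal_mul (by positivity), ← ENNReal.ofReal_mul (by positivity),
              ← ENNReal.ofReal_add (by positivity) (by positivity)]
            congr 1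
            rw [hc]
            ring
    refine (mul_le_mul_right (Finset.sum_le_sum hone) _).trans (le_of_eq ?_)
    rw [Finset.sum_const, Finset.card_range, nsmul_eq_mul, ← ENNReal.ofReal_natCast,
      ← mul_assoc, ← ENNReal.ofReal_mul (by positivity), inv_mul_cancel₀ hn0.ne',
      ENNReal.ofReal_one, one_mul]
  · filter_upwards [hbw, hsmall] with n h1 h2 ω
    rw [ENNReal.ofReal_mul (by positivity), ENNReal.ofReal_sum_of_nonneg fun i _ => by positivity]
    gcongr with i hi
    rw [Finset.mem_range] at hi
    obtain ⟨hN, hb, hb4, -⟩ := h1 i hi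
    set g : Euc p → ℝ := kernelEstimate κ (b n i) (N n i) fun j => Z i j ω with hg
    set φ : Euc p → ℝ := kernelMean κ (b n i) (ν i ω) with hφ
    have hgc : Continuous g := by
      have := hκ.continuous
      unfold g kernelEstimate
      fun_prop
    have hle := hproj (h i ω) g (f i ω) (f' n i ω) (hhm i ω) (fun z hz => hhb i ω z (hDsub hz)) hgc
      (hf i ω) (hfh i ω) (hf' n i ω)
    have hpt : ∀ z ∈ D, (g z - h i ω z) ^ 2 ≤
        2 * (g z - φ z) ^ 2 + 2 * ((L * r ^ 2) ^ 2 * (C * (n : ℝ)⁻¹)) := by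
      intro z hz
      have hbias : |φ z - h i ω z| ≤ L * r ^ 2 * b n i ^ 2 := by
        rw [hφ, hνh i ω]
        exact abs_kernelMean_sub_le hk hκ (hhm i ω) (hh0 i ω) (hhi i ω) hr hb (h2 i hi) hz
          (hhc i ω) (hhL i ω 2 (by norm_num) hk)
      have hsq : (φ z - h i ω z) ^ 2 ≤ (L * r ^ 2) ^ 2 * (C * (n : ℝ)⁻¹) := by
        rw [← sq_abs]
        calc _ ≤ (L * r ^ 2 * b n i ^ 2) ^ 2 := pow_le_pow_left₀ (abs_nonneg _) hbias 2
          _ = (L * r ^ 2) ^ 2 * b n i ^ 4 := by ring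
          _ ≤ _ := by gcongr
      calc _ = ((g z - φ z) + (φ z - h i ω z)) ^ 2 := by ring
        _ ≤ 2 * ((g z - φ z) ^ 2 + (φ z - h i ω z) ^ 2) := add_sq_le
        _ ≤ _ := by linarith
    have hT : ENNReal.ofReal (∫ z in D, (g z - h i ω z) ^ 2) ≤
        2 * W n i ω +
          ENNReal.ofReal (2 * ((L * r ^ 2) ^ 2 * (C * (n : ℝ)⁻¹))) * ENNReal.ofReal v := by
      calc _ ≤ ‖∫ z in D, (g z - h i ω z) ^ 2‖ₑ := Real.ofReal_le_enorm _
        _ ≤ ∫⁻ z in D, ‖(g z - h i ω z) ^ 2‖ₑ := enorm_integral_le_lintegral_enorm _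
        _ ≤ ∫⁻ z in D, (2 * ENNReal.ofReal ((g z - φ z) ^ 2) +
            ENNReal.ofReal (2 * ((L * r ^ 2) ^ 2 * (C * (n : ℝ)⁻¹)))) := by
          refine setLIntegral_mono' hD.measurableSet fun z hz => ?_
          rw [Real.enorm_of_nonneg (sq_nonneg _), ← ENNReal.ofReal_ofNat,
            ← ENNReal.ofReal_mul (by norm_num),
            ← ENNReal.ofReal_add (by positivity) (by positivity)]
          exact ENNReal.ofReal_le_ofReal (hpt z hz)
        _ = _ := by
          rw [lintegral_add_right _ measurable_const, setLIntegral_const, hvD,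
            lintegral_const_mul' _ _ (by simp)]
    calc _ ≤ ENNReal.ofReal (Cp * ∫ z in D, (g z - h i ω z) ^ 2) := ENNReal.ofReal_le_ofReal hle
      _ ≤ ENNReal.ofReal Cp * (2 * W n i ω +
          ENNReal.ofReal (2 * ((L * r ^ 2) ^ 2 * (C * (n : ℝ)⁻¹))) * ENNReal.ofReal v) := by
        rw [ENNReal.ofReal_mul hCp]
        gcongr
      _ = _ := by
        rw [mul_add, ← mul_assoc, mul_comm (ENNReal.ofReal Cp) 2,
          ← ENNReal.ofReal_ofNat 2, ← ENNReal.ofReal_mul zero_le_two,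
          ← ENNReal.ofReal_mul (by positivity), ← ENNReal.ofReal_mul hCp]
        congr 2
        ring

end Sampling

end GSWW

end

open GSWW in
theorem theorem3 {p q k : ℕ} (hp : 1 ≤ p) (hk : 2 ≤ k) (hkp : p + 1 ≤ k)
    {Ω : Type*} [MeasurableSpace Ω] (P : Measure Ω) [IsProbabilityMeasure P]
    (D : Set (Euc p)) (hD : IsCompact D) (hDconv : Convex ℝ D)
    (M₀ L₀ : ℝ)
    (𝒢 : Set (ℝ → ℝ)) (h𝒢 : IsUnivariateClass k 𝒢) (I : Sph p → Set ℝ)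
    (hΓconv : Convex ℝ (quantileSlices 𝒢 I)) (hΓclosed : IsClosedSlices (quantileSlices 𝒢 I))
    (ψ : (Euc p → ℝ) → Sph p → ℝ → ℝ) (ψinv : ℝ → (Sph p → ℝ → ℝ) → Euc p → ℝ)
    (C₁ C₂ δ : ℝ → ℝ)
    (hψ : IsSlicingTransform D (densityClass D k M₀ L₀) 𝒢 I ψ ψinv C₁ C₂ δ)
    (X : ℕ → Ω → Euc q) (f : ℕ → Ω → Euc p → ℝ)
    (hf : ∀ i ω, f i ω ∈ densityClass D k M₀ L₀)
    (hmeas : ∀ i, Measurable fun ω => (X i ω, f i ω))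
    (hindep : iIndepFun (fun i ω => (X i ω, f i ω)) P)
    (hident : ∀ i, IdentDistrib (fun ω => (X i ω, f i ω)) (fun ω => (X 0 ω, f 0 ω)) P P)
    (hmoment : MemLp (X 0) 4 P) (hcov : (popCov P (X 0)).PosDef) :
    -- the target is unique
    (∀ x m m',
      IsTarget (densityClass D k M₀ L₀) ψ (quantileSlices 𝒢 I)
        (popObjective P ψ (X 0) (f 0) x) m →
      IsTarget (densityClass D k M₀ L₀) ψ (quantileSlices 𝒢 I)
        (popObjective P ψ (X 0) (f 0) x) m' → m = m') ∧
    -- the minimizers exist for the population and for known densities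
    (∀ x, HasUniqueArgmin (quantileSlices 𝒢 I) (popObjective P ψ (X 0) (f 0) x)) ∧
    (∀ n x ω, 1 ≤ n → HasUniqueArgmin (quantileSlices 𝒢 I)
      (sampleObjective ψ n (fun i => X i ω) (fun i => f i ω) x)) ∧
    -- rates for known densities
    (∀ γ : ℕ → Euc q → Ω → Sph p → ℝ → ℝ,
      (∀ n x ω, 1 ≤ n → IsArgmin (quantileSlices 𝒢 I)
        (sampleObjective ψ n (fun i => X i ω) (fun i => f i ω) x) (γ n x ω)) →
      HasRates P D C₁ C₂ δ
        (fun x => IsTarget (densityClass D k M₀ L₀) ψ (quantileSlices 𝒢 I)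
          (popObjective P ψ (X 0) (f 0) x))
        (fun n τ x ω => ψinv τ (toDensities 𝒢 (γ n x ω)))) ∧
    -- minimizers and rates for estimated densities
    (∀ (ν : ℕ → Ω → Measure (Euc p)) (Z : ℕ → ℕ → Ω → Euc p) (N : ℕ → ℕ → ℕ) (b : ℕ → ℕ → ℝ)
      (κ : Euc p → ℝ) (f' : ℕ → ℕ → Ω → Euc p → ℝ),
      IsDensitySampling P D k X f ν Z N b → IsKernel k κ →
      (∀ n i ω, IsProjectionTo (densityClass D k M₀ L₀)
        (truncatedKernelEstimate D κ (b n i) (N n i) (fun j => Z i j ω)) (f' n i ω)) →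
      (∀ n x ω, 1 ≤ n → HasUniqueArgmin (quantileSlices 𝒢 I)
        (sampleObjective ψ n (fun i => X i ω) (fun i => f' n i ω) x)) ∧
      ∀ γ : ℕ → Euc q → Ω → Sph p → ℝ → ℝ,
        (∀ n x ω, 1 ≤ n → IsArgmin (quantileSlices 𝒢 I)
          (sampleObjective ψ n (fun i => X i ω) (fun i => f' n i ω) x) (γ n x ω)) →
        HasRates P D C₁ C₂ δ
          (fun x => IsTarget (densityClass D k M₀ L₀) ψ (quantileSlices 𝒢 I)
            (popObjective P ψ (X 0) (f 0) x))
          (fun n τ x ω => ψinv τ (toDensities 𝒢 (γ n x ω)))) := by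
  have hop0 : IsOp P (fun n ω => (n : ℝ)⁻¹ * ∑ i ∈ Finset.range n,
      (l2Dist (f i ω) (f i ω)).toReal ^ 2) (fun n => (n : ℝ)⁻¹) := by
    have : IsOp P (fun _ _ => (0 : ℝ)) fun n : ℕ => (n : ℝ)⁻¹ := by
      simpa using isOp_const (P := P) (r := fun n : ℕ => (n : ℝ)⁻¹) (c := 0) fun n => by positivity
    simpa [l2Dist] using this
  obtain ⟨h1, h2, h3⟩ := hasRates_of_surrogates hk hD h𝒢 hΓconv hΓclosed hψ hf hmeas hindep hident
    hmoment hcov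
  obtain ⟨h4, h5⟩ := h3 (fun _ i ω => f i ω) (fun _ i ω => hf i ω) hop0
  exact ⟨h1, h2, h4, h5, fun ν Z N b κ f' hs hκ hf' => h3 f' (fun n i ω => (hf' n i ω).1)
    (hs.isOp_l2Dist hk hD hf hκ hf')⟩
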